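/- **Setting.** For finite sets $A\subseteq[m]=\{1,\dots,m\}$, $B\subseteq[n]$, let $M_{A,B}$ be the chessboard complex: its vertices are the squares $ab'$ with $a\in A$, $b\in B$, and its faces are the sets of squares (including the empty set) no two of which lie in the same row or column. Put $M_{m,n}=M_{[m],[n]}$. Chains, $\tilde H_*$ and $\tilde H^*$ are reduced simplicial with coefficients in $\mathbb Z$; cohomology is formed on the same chain groups, with the coboundary map adjoint to $\partial$ for the form in which the simplices, oriented by a fixed order of the vertices, are orthonormal. For disjoint $A_1,A_2$ and disjoint $B_1,B_2$, the bilinear wedge product $C_{s-1}(M_{A_1,B_1})\times C_{t-1}(M_{A_2,B_2})\to C_{s+t-1}(M_{A_1\cup A_2,B_1\cup B_2})$ concatenates oriented simplices; it also denotes the induced product on homology. *Fundamental cycles.* Let $A=\{a_1<\dots<a_k\}\subseteq[m]$ and $B\subseteq[n]$ with $|B|=k+1$. For a bijection $\sigma:B\to A\cup\{\infty\}$, where $\infty$ is larger than all elements of $A$, let $\operatorname{sgn}(\sigma)$ be the sign of $\sigma$ read as a word in the increasing order of $B$, and set $$\rho_{A,B}=\sum_{\sigma}\operatorname{sgn}(\sigma)\,\bigl(a_1\,\sigma^{-1}(a_1)',\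 \dots,\ a_k\,\sigma^{-1}(a_k)'\bigr).$$ *Tableaux.* Let $m\le n$. Let $\mathcal P_{m,n}$ be the set of pairs $(S,T)$ of standard Young tableaux with $m$ and $n$ cells such that the shape of $S$ is the shape of $T$ with its first row removed. Let $S^*$ be the semistandard tableau of the shape of $T$ obtained from $S$ by adding a cell with entry $\infty$ at the bottom of each of the first $n-m$ columns (some possibly empty). Apply the inverse Robinson–Schensted procedure (by reverse row insertion) to $(S^*,T)$: for $k=n,n-1,\dots,1$ the entry $k$ is crossed out of $T$, and an entry $\sigma(k)$ is popped from some cell of the top row of the left tableau. This gives a word $\sigma=\sigma(1)\cdots\sigma(n)$ in $1,\dots,m,\infty^{n-m}$. Let $i_1<\dots<i_m$ be the places of its finite letters, and let $\gamma(S,T)\in\tilde H^{m-1}(M_{m,n})$ be the class of the oriented simplex $(\sigma(i_1)i_1',\dots,\sigma(i_m)i_m')$. For $1\le i\le n-m$ let $A_i$ be the set of finite entries popped from the $i$-th cell of the top row, let $B_i$ be the set of entries $k$ of $T$ whose crossing out pops an entry from that cell, and put $$\eta(S,T)=\rho_{A_1,B_1}\wedge\cdots\wedge\rho_{A_{n-m},B_{n-m}}$$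 (the empty product being the empty simplex). **Theorem.** Let $m\le n$ be non-negative integers. 1. For all $A\subseteq[m]$, $B\subseteq[n]$ with $|A|=|B|-1$, the complex $M_{A,B}$ is a pseudomanifold (pure, of dimension $|A|-1$; every face of codimension one lies in exactly two facets; any two facets are joined by a sequence of facets in which consecutive ones share a face of codimension one), and $\rho_{A,B}$ is a fundamental cycle of it: $\tilde H_{|A|-1}(M_{A,B})$ is infinite cyclic, generated by $\rho_{A,B}$. 2. The $\eta(S,T)$, $(S,T)\in\mathcal P_{m,n}$, are cycles, and their classes form a $\mathbb Z$-basis of $\tilde H_{m-1}(M_{m,n})$. 3. The oriented simplices defining the $\gamma(S,T)$, $(S,T)\in\mathcal P_{m,n}$, are cocycles, and the images of the $\gamma(S,T)$ form a $\mathbb Z$-basis of the free part $\tilde H^{m-1}(M_{m,n})/\tilde H^{m-1}(M_{m,n})_{\rm tor}$. 4. If $m\ge1$, then $\tilde H_{m-1}(M_{m,n})$ is generated by the classes $\rho_{A,B}\wedge\tau$ with $A\subseteq[m]$, $B\subseteq[n]$, $1\le|A|=|B|-1$ and $\tau\in\tilde H_{m-1-|A|}(M_{[m]\setminus A,[n]\setminus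 B})$. (All these wedge products are cycles.) -/

import Mathlib

open Finset

namespace Chessboard

/-! ### Reduced simplicial chains of a finite simplicial complex

The vertex set `V` is linearly ordered (and finite, where cohomology is concerned).  The basis vector `Finsupp.single s 1` stands for
the oriented simplex `(x₁, …, x_k)` with `s = {x₁ < ⋯ < x_k}`.  Everything is graded by the number
`k` of vertices, so the index `k` below is the dimension `k - 1`. -/

section Chains

variable {V : Type*} [LinearOrder V]

/-- The faces of a complex, together with the empty face (Mathlib's complexes omit it; reduced
homology needs it). -/
def augFaces (Δ : PreAbstractSimplicialComplex V) : Set (Finset V) :=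
  {s | s = ∅ ∨ s ∈ Δ}

variable (V) in
/-- Formal integral combinations of finite subsets of `V`; each chain group of a complex on `V` is a
subgroup of this group. -/
abbrev Chain : Type _ := Finset V →₀ ℤ

/-- The chain group `C_{k-1}(Δ)`, spanned by the faces with `k` vertices. -/
noncomputable def chains (Δ : PreAbstractSimplicialComplex V) (k : ℕ) : Submodule ℤ (Chain V) :=
  Finsupp.supported ℤ ℤ {s | s ∈ augFaces Δ ∧ s.card = k}

/-- `(-1)^j`, where `j` is the number of elements of `s` below `x`, that is, the (0-based) place of
`x` in the increasing list of `insert x s`. -/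
def placeSign (x : V) (s : Finset V) : ℤ :=
  (-1) ^ (s.filter (· < x)).card

/-- The boundary map: `∂ (x₀, …, x_j) = ∑ i, (-1)^i (x₀, …, x̂_i, …, x_j)`. -/
noncomputable def boundary : Chain V →ₗ[ℤ] Chain V :=
  Finsupp.linearCombination ℤ fun s : Finset V =>
    ∑ x ∈ s, Finsupp.single (s.erase x) (placeSign x s)

/-- The cycle group `Z_{k-1}(Δ)`. -/
noncomputable def cycles (Δ : PreAbstractSimplicialComplex V) (k : ℕ) : Submodule ℤ (Chain V) :=
  chains Δ k ⊓ LinearMap.ker boundary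

/-- The boundary group `B_{k-1}(Δ)`. -/
noncomputable def boundaries (Δ : PreAbstractSimplicialComplex V) (k : ℕ) :
    Submodule ℤ (Chain V) :=
  (chains Δ (k + 1)).map boundary

/-- Reduced homology `H̃_{k-1}(Δ; ℤ)`. -/
abbrev Homology (Δ : PreAbstractSimplicialComplex V) (k : ℕ) : Type _ :=
  cycles Δ k ⧸ (boundaries Δ k).submoduleOf (cycles Δ k)

/-- The homology class of a cycle. -/
noncomputable def homologyClass (Δ : PreAbstractSimplicialComplex V) (k : ℕ) (z : Chain V)
    (hz : z ∈ cycles Δ k) : Homology Δ k :=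
  Submodule.Quotient.mk ⟨z, hz⟩

/-- The number of inversions of a list. -/
def inversions : List V → ℕ
  | [] => 0
  | x :: l => l.countP (· < x) + inversions l

/-- The oriented simplex `(x₁, …, x_k)` with its vertices in any order. -/
noncomputable def orientedSimplex (l : List V) : Chain V :=
  if l.Nodup then Finsupp.single l.toFinset ((-1) ^ inversions l) else 0

/-- The wedge product of chains: the bilinear map that concatenates oriented simplices, see
`wedge_orientedSimplex`. -/
noncomputable def wedge (f g : Chain V) : Chain V :=
  f.sum fun s a => g.sum fun t b =>
    if Disjoint s t then
      Finsupp.single (s ∪ t) (a * b * (-1) ^ ((s ×ˢ t).filter fun p => p.2 < p.1).card)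
    else 0

/-- `Δ` is a pseudomanifold (without boundary) whose facets have `d` vertices: it is pure, each face
with `d - 1` vertices lies in exactly two facets, and any two facets are joined by a chain of facets
in which successive ones share `d - 1` vertices. -/
structure IsPseudomanifold (Δ : PreAbstractSimplicialComplex V) (d : ℕ) : Prop where
  pure : ∀ s ∈ augFaces Δ, ∃ t ∈ augFaces Δ, s ⊆ t ∧ t.card = d
  thin : ∀ s ∈ augFaces Δ, s.card + 1 = d →
    {t | t ∈ augFaces Δ ∧ s ⊆ t ∧ t.card = d}.ncard = 2
  connected : ∀ s ∈ augFaces Δ, ∀ t ∈ augFaces Δ, s.card = d → t.card = d →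
    Relation.ReflTransGen
      (fun u v => v ∈ augFaces Δ ∧ v.card = d ∧ (u ∩ v).card + 1 = d) s t

/-- `z` is a fundamental cycle of a complex with `d`-vertex facets: its class is a generator of
`H̃_{d-1}(Δ)`, which is infinite cyclic. -/
def IsFundamentalCycle (Δ : PreAbstractSimplicialComplex V) (d : ℕ) (z : Chain V) : Prop :=
  ∃ hz : z ∈ cycles Δ d, ∀ x : Homology Δ d, ∃! c : ℤ, x = c • homologyClass Δ d z hz

theorem inversions_append (l₁ l₂ : List V) :
    inversions (l₁ ++ l₂) =
      inversions l₁ + inversions l₂ + (l₁.map fun x => l₂.countP (· < x)).sum := by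
  induction l₁ with
  | nil => simp [inversions]
  | cons x l ih => simp only [List.cons_append, inversions, ih, List.countP_append,
      List.map_cons, List.sum_cons]; ring

theorem wedge_orientedSimplex (l₁ l₂ : List V) :
    wedge (orientedSimplex l₁) (orientedSimplex l₂) = orientedSimplex (l₁ ++ l₂) := by
  unfold orientedSimplex
  by_cases h₁ : l₁.Nodup
  · by_cases h₂ : l₂.Nodup
    · have hd : Disjoint l₁.toFinset l₂.toFinset ↔ l₁.Disjoint l₂ :=
        List.disjoint_toFinset_iff_disjoint
      rw [if_pos h₁, if_pos h₂, wedge, Finsupp.sum_single_index, Finsupp.sum_single_index]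
      · by_cases h : l₁.Disjoint l₂
        · rw [if_pos (hd.2 h), if_pos (List.nodup_append'.2 ⟨h₁, h₂, h⟩), List.toFinset_append,
            inversions_append, pow_add, pow_add]
          congr 3
          rw [Finset.card_filter, Finset.sum_product, List.sum_toFinset _ h₁]
          congr 1
          refine List.map_congr_left fun x _ => ?_
          rw [List.sum_toFinset _ h₂, List.countP_eq_length_filter]
          clear hd h h₂
          induction l₂ with
          | nil => simp
          | cons y l ih => by_cases hy : y < x <;> simp [hy, ih, add_comm]
        · rw [if_neg (fun h' => h (hd.1 h')),
            if_neg (fun h' => h (List.nodup_append'.1 h').2.2)]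
      · simp
      · simp [Finsupp.sum]
    · rw [if_neg h₂, if_neg (fun h => h₂ (List.nodup_append'.1 h).2.1)]
      simp [wedge]
  · rw [if_neg h₁, if_neg (fun h => h₁ (List.nodup_append'.1 h).1)]
    simp [wedge]

/-! Cohomology, as a subquotient of the chain groups. -/

variable [Fintype V]

open Classical in
/-- The coboundary map of `Δ`, on the same chain groups: a face `s` is sent to the signed sum of the
faces `s ∪ {x}` of `Δ`.  It is the adjoint of `boundary`, see `pairing_coboundary`. -/
noncomputable def coboundary (Δ : PreAbstractSimplicialComplex V) : Chain V →ₗ[ℤ] Chain V :=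
  Finsupp.linearCombination ℤ fun s : Finset V =>
    ∑ x : V, if x ∉ s ∧ insert x s ∈ augFaces Δ then
      Finsupp.single (insert x s) (placeSign x s) else 0

/-- The bilinear form for which the oriented simplices with increasing vertices are orthonormal. -/
noncomputable def pairing (u v : Chain V) : ℤ :=
  u.sum fun s a => a * v s

/-- The cocycle group `Z^{k-1}(Δ)`. -/
noncomputable def cocycles (Δ : PreAbstractSimplicialComplex V) (k : ℕ) : Submodule ℤ (Chain V) :=
  chains Δ k ⊓ LinearMap.ker (coboundary Δ)

/-- The coboundary group `B^{k-1}(Δ)`; it is zero in dimension `-1`. -/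
noncomputable def coboundaries (Δ : PreAbstractSimplicialComplex V) : ℕ → Submodule ℤ (Chain V)
  | 0 => ⊥
  | k + 1 => (chains Δ k).map (coboundary Δ)

/-- Reduced cohomology `H̃^{k-1}(Δ; ℤ)`. -/
abbrev Cohomology (Δ : PreAbstractSimplicialComplex V) (k : ℕ) : Type _ :=
  cocycles Δ k ⧸ (coboundaries Δ k).submoduleOf (cocycles Δ k)

/-- The cohomology class of a cocycle. -/
noncomputable def cohomologyClass (Δ : PreAbstractSimplicialComplex V) (k : ℕ) (z : Chain V)
    (hz : z ∈ cocycles Δ k) : Cohomology Δ k :=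
  Submodule.Quotient.mk ⟨z, hz⟩

/-- The free part of `H̃^{k-1}(Δ; ℤ)`: the quotient by the torsion subgroup. -/
abbrev FreeCohomology (Δ : PreAbstractSimplicialComplex V) (k : ℕ) : Type _ :=
  Cohomology Δ k ⧸ Submodule.torsion ℤ (Cohomology Δ k)

theorem coboundary_apply (Δ : PreAbstractSimplicialComplex V) (v : Chain V) {t : Finset V}
    (ht : t ∈ augFaces Δ) :
    coboundary Δ v t = ∑ x ∈ t, placeSign x t * v (t.erase x) := by
  classical
  induction v using Finsupp.induction_linear with
  | zero => simp
  | add f g hf hg => simp [hf, hg, mul_add, Finset.sum_add_distrib]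
  | single s b =>
    have hsum : ∑ x ∈ t, placeSign x t * (Finsupp.single s b) (t.erase x) =
        ∑ x : V, if x ∈ t then placeSign x t * (Finsupp.single s b) (t.erase x) else 0 := by
      rw [Finset.sum_ite_mem, Finset.univ_inter]
    rw [hsum]
    simp only [coboundary, Finsupp.linearCombination_single, Finsupp.smul_apply,
      Finsupp.finsetSum_apply, smul_eq_mul, Finset.mul_sum]
    refine Finset.sum_congr rfl fun x _ => ?_
    by_cases h : x ∈ t ∧ t.erase x = s
    · obtain ⟨hx, rfl⟩ := h
      have : placeSign x (t.erase x) = placeSign x t := by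
        unfold placeSign
        congr 2
        ext y
        simp only [Finset.mem_filter, Finset.mem_erase]
        exact ⟨fun h => ⟨h.1.2, h.2⟩, fun h => ⟨⟨h.2.ne, h.1⟩, h.2⟩⟩
      simp [hx, Finset.insert_erase hx, ht, this, mul_comm]
    · have h1 : ¬ (x ∉ s ∧ insert x s = t) := by
        rintro ⟨h1, rfl⟩
        exact h ⟨Finset.mem_insert_self _ _, Finset.erase_insert h1⟩
      have h2 : (if x ∈ t then placeSign x t * (Finsupp.single s b) (t.erase x) else 0) = 0 := by
        split_ifs with hx
        · rw [Finsupp.single_eq_of_ne (fun h3 => h ⟨hx, h3⟩), mul_zero]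
        · rfl
      rw [h2]
      split_ifs with h3
      · rw [Finsupp.single_eq_of_ne (fun h4 => h1 ⟨h3.1, h4.symm⟩), mul_zero]
      · simp

theorem pairing_coboundary (Δ : PreAbstractSimplicialComplex V) (k : ℕ) (u v : Chain V)
    (hu : u ∈ chains Δ k) : pairing u (coboundary Δ v) = pairing (boundary u) v := by
  have key : ∀ w : Chain V, pairing w v = Finsupp.linearCombination ℤ (fun s => v s) w := by
    intro w
    simp [pairing, Finsupp.linearCombination_apply]
  rw [key, boundary, Finsupp.linearCombination_linearCombination,
    Finsupp.linearCombination_apply, pairing]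
  refine Finset.sum_congr rfl fun t ht => ?_
  have h := (Finsupp.mem_supported ℤ u).1 hu ht
  simp only [map_sum, Finsupp.linearCombination_single, smul_eq_mul]
  rw [coboundary_apply Δ v h.1]

end Chains

/-! ### Chessboard complexes -/

/-- The squares of the `m × n` chessboard, ordered lexicographically. -/
abbrev Square (m n : ℕ) : Type := Fin m ×ₗ Fin n

/-- The chessboard complex `M_{A,B}`: its faces are the nonempty sets of squares in `A × B`, no two
of them in the same row or in the same column. -/
def chessboard {m n : ℕ} (A : Finset (Fin m)) (B : Finset (Fin n)) :
    PreAbstractSimplicialComplex (Square m n) where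
  faces := {s | s.Nonempty ∧ (∀ x ∈ s, (ofLex x).1 ∈ A ∧ (ofLex x).2 ∈ B) ∧
    ∀ x ∈ s, ∀ y ∈ s, x ≠ y → (ofLex x).1 ≠ (ofLex y).1 ∧ (ofLex x).2 ≠ (ofLex y).2}
  isRelLowerSet_faces := fun _ hs => ⟨hs.1, fun _ hts ht =>
    ⟨ht, fun x hx => hs.2.1 x (hts hx), fun x hx y hy => hs.2.2 x (hts hx) y (hts hy)⟩⟩

/-- The chessboard complex `M_{m,n}`. -/
abbrev board (m n : ℕ) : PreAbstractSimplicialComplex (Square m n) :=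
  chessboard Finset.univ Finset.univ

/-- The fundamental cycle `ρ_{A,B}` of `M_{A,B}`, for `|B| = |A| + 1`, with `A = {a₀ < ⋯ < a_{k-1}}`
and `B = {b₀ < ⋯ < b_k}`.  A permutation `σ` is read as the word on `A ∪ {∞}` with the `σ j`-th
smallest letter at the place `b_j`, where `∞` is the largest letter.  It contributes, with its sign,
the simplex `(a₀ c₀, …, a_{k-1} c_{k-1})`, where `c_i` is the place of the letter `a_i`. -/
noncomputable def rho {m n : ℕ} (A : Finset (Fin m)) (B : Finset (Fin n)) : Chain (Square m n) :=
  if h : B.card = A.card + 1 then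
    ∑ σ : Equiv.Perm (Fin (A.card + 1)), (Equiv.Perm.sign σ : ℤ) •
      orientedSimplex ((List.finRange A.card).map fun i =>
        toLex (A.orderEmbOfFin rfl i, B.orderEmbOfFin h (σ.symm i.castSucc)))
  else 0

/-! ### Tableaux and the inverse Robinson–Schensted procedure -/

/-- A standard Young tableau of shape `μ` with the labels `0, …, N - 1`. -/
structure StandardTableau (μ : YoungDiagram) (N : ℕ) where
  /-- The filling; each label is used exactly once. -/
  entry : {c : ℕ × ℕ // c ∈ μ} ≃ Fin N
  row_lt : ∀ {i j₁ j₂ : ℕ} (h₁ : (i, j₁) ∈ μ) (h₂ : (i, j₂) ∈ μ), j₁ < j₂ →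
    entry ⟨(i, j₁), h₁⟩ < entry ⟨(i, j₂), h₂⟩
  col_lt : ∀ {i₁ i₂ j : ℕ} (h₁ : (i₁, j) ∈ μ) (h₂ : (i₂, j) ∈ μ), i₁ < i₂ →
    entry ⟨(i₁, j), h₁⟩ < entry ⟨(i₂, j), h₂⟩

/-- The row of the cell of `T` with the label `k`. -/
def StandardTableau.rowOf {μ : YoungDiagram} {N : ℕ} (T : StandardTableau μ N) (k : Fin N) : ℕ :=
  (T.entry.symm k).1.1

/-- The set `P_{m,n}` of pairs of standard tableaux `(S, T)` with `m` and `n` cells such that the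
shape of `S` is the shape of `T` without its first row. -/
structure TableauPair (m n : ℕ) where
  shapeS : YoungDiagram
  shapeT : YoungDiagram
  S : StandardTableau shapeS m
  T : StandardTableau shapeT n
  shape_eq : ∀ i j : ℕ, (i, j) ∈ shapeS ↔ (i + 1, j) ∈ shapeT

/-- The letters `0 < ⋯ < m - 1 < ∞`, where `∞` is `⊤`. -/
abbrev Letter (m : ℕ) : Type := WithTop (Fin m)

/-- Reverse row insertion, on the list of rows (top row first): remove the last cell of row `r`; its
entry `y` replaces the rightmost entry smaller than `y` in the row above, the replaced entry moves up
in the same way, and so on.  The value consists of the entry that leaves the top row, the column of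
the top cell from which it leaves, and the remaining rows.  The default value `⊤` and the last clause
are never reached when `r` is the row of a corner of a semistandard tableau. -/
def reverseInsert {m : ℕ} : List (List (Letter m)) → ℕ → (Letter m × ℕ) × List (List (Letter m))
  | row :: rows, 0 => ((row.getLastD ⊤, row.length - 1), row.dropLast :: rows)
  | row :: rows, r + 1 =>
    let below := reverseInsert rows r
    let y := below.1.1
    let c := (row.takeWhile (· < y)).length - 1
    ((row.getD c ⊤, c), row.set c y :: below.2)
  | [], _ => ((⊤, 0), [])

namespace TableauPair

variable {m n : ℕ} (p : TableauPair m n)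

/-- The entries of `S*`: `S` with a cell `∞` added at the bottom of each of the first `n - m`
columns.  The cells of `S*` are those of `T`. -/
def starEntry (i j : ℕ) : Letter m :=
  if h : (i, j) ∈ p.shapeS then ((p.S.entry ⟨(i, j), h⟩ : Fin m) : Letter m) else ⊤

/-- The rows of `S*`. -/
def starRows : List (List (Letter m)) :=
  (List.range (p.shapeT.colLen 0)).map fun i =>
    (List.range (p.shapeT.rowLen i)).map fun j => p.starEntry i j

/-- The left tableau in the inverse Robinson–Schensted procedure for `(S*, T)`, at the moment when
exactly the labels `0, …, k - 1` of `T` are not yet crossed out. -/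
def leftTableau (k : Fin (n + 1)) : List (List (Letter m)) :=
  Fin.reverseInduction (motive := fun _ => List (List (Letter m))) p.starRows
    (fun l P => (reverseInsert P (p.T.rowOf l)).2) k

/-- The entry that is popped when the label `k` is crossed out of `T`, and the column of the cell of
the top row from which it is popped. -/
def popped (k : Fin n) : Letter m × ℕ :=
  (reverseInsert (p.leftTableau k.succ) (p.T.rowOf k)).1

/-- The multiset permutation `RS⁻¹(S*, T)` of `{0, …, m - 1, ∞^{n-m}}`. -/
def word (k : Fin n) : Letter m := (p.popped k).1

/-- `A_i`: the finite entries popped from the `i`-th cell of the top row. -/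
def setA (i : ℕ) : Finset (Fin m) :=
  Finset.univ.filter fun a => ∃ k, p.popped k = ((a : Letter m), i)

/-- `B_i`: the labels whose crossing out pops an entry from the `i`-th cell of the top row. -/
def setB (i : ℕ) : Finset (Fin n) :=
  Finset.univ.filter fun k => (p.popped k).2 = i

/-- The chain `η(S,T) = ρ_{A_1,B_1} ∧ ⋯ ∧ ρ_{A_{n-m},B_{n-m}}` (an empty product is the empty
simplex). -/
noncomputable def eta : Chain (Square m n) :=
  ((List.range (n - m)).map fun i => rho (p.setA i) (p.setB i)).foldr wedge (orientedSimplex [])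

/-- The oriented simplex `τ(σ) = (σ(i₁) i₁, …, σ(i_m) i_m)` of a word `σ`, where `i₁ < ⋯ < i_m` are
the places of its finite letters. -/
noncomputable def simplexOfWord (w : Fin n → Letter m) : Chain (Square m n) :=
  orientedSimplex ((List.finRange n).filterMap fun k =>
    match w k with
    | ⊤ => none
    | (a : Fin m) => some (toLex (a, k)))

/-- The oriented simplex whose cohomology class is `γ(S,T)`. -/
noncomputable def gamma : Chain (Square m n) :=
  simplexOfWord p.word

end TableauPair

end Chessboard

/-! A facet of the m × n board is an injection φ from rows to columns, or equivalently a word in 0,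
…, m-1 and n-m letters ∞. The facets through a ridge arise by moving one square along its row. So a
top-dimensional chain is a cycle exactly when its coefficients sum to zero as one value of φ varies
(`boundary_eq_zero_iff`). Dually, the facets modulo coboundaries satisfy the same relations
(`isBalanced_mk_facetChain`). Both are instances of `IsBalanced`, and the two bases come from one
analysis of such functions.

Straightening bounds the size from above. If K is a set of n-m+1 columns, only m-1 columns lie
outside K, and the relations force a balanced function to sum to zero over all rearrangements,
within K, of the letters standing in K (`IsBalanced.sum_piFinset_eq_zero`). If the word weakly
increases on K, all the other rearrangements are lexicographically larger
(`wordOf_lt_of_monotoneOn`). Hence all values are integral combinations of those at the words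
without a weakly increasing subword of length n-m+1 (`IsBalanced.mem_of_tableauPair`).
Robinson–Schensted insertion of such a word gives a tableau with at most n-m columns; it contains
n-m letters ∞, no two in one column, so each column ends in exactly one ∞. Such a word therefore
comes from a pair (S, T) (`exists_tableauPair`).

The cycles η(S,T) give the matching lower bound. The letters popped from one cell of the top row
decrease strictly, starting with ∞. This is the lexicographically largest arrangement of these
letters, whereas ρ runs through all arrangements with coefficients ±1. So the word of (S,T) is the
largest one in the support of η(S,T), with coefficient ±1 (`word_le_of_eta_ne_zero`,
`eta_apply_sq`), and the coefficients of the η at the words of the pairs form a triangular matrix of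
determinant ±1. Evaluation at these words is injective on homology by straightening, so the η form a
ℤ-basis. The matrix of pairings of the η with the γ is the same up to transposition and signs.
Pairing with a cycle kills coboundaries and torsion, so the γ are independent, and straightening
modulo coboundaries shows that they span. The generators ρ ∧ τ are obtained from the η, because
factors ρ with an empty set of rows are units of the wedge product.

When |B| = |A| + 1, the facets of M_{A,B} are the permutations of |A| + 1 letters, and adjacent
facets differ by a transposition with ∞. These transpositions generate the symmetric group. So the
facets are connected, and a cycle is determined by one coefficient, the others differing from it by
the signs of permutations. -/

namespace Chessboard

/-! ### Supports of chains. -/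

section Support

variable {V : Type*}

theorem mem_chains_iff {Δ : PreAbstractSimplicialComplex V} {k : ℕ} {z : Chain V} :
    z ∈ chains Δ k ↔ ∀ s, z s ≠ 0 → s ∈ augFaces Δ ∧ s.card = k := by
  rw [chains, Finsupp.mem_supported]
  exact ⟨fun h s hs => h (by simpa using hs), fun h s hs => h s (by simpa using hs)⟩

theorem single_mem_chains {Δ : PreAbstractSimplicialComplex V} {s : Finset V}
    (hs : s ∈ augFaces Δ) (a : ℤ) : Finsupp.single s a ∈ chains Δ s.card :=
  Finsupp.single_mem_supported ℤ a ⟨hs, rfl⟩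

end Support

/-! ### Boundary and wedge product in coordinates; the Leibniz rule. -/

section Wedge

variable {V : Type*} [LinearOrder V]

theorem boundary_single (s : Finset V) (a : ℤ) :
    boundary (Finsupp.single s a) =
      ∑ x ∈ s, Finsupp.single (s.erase x) (a * placeSign x s) := by
  simp [boundary, Finsupp.linearCombination_single, Finset.smul_sum]

theorem placeSign_erase_self (x : V) (s : Finset V) :
    placeSign x (s.erase x) = placeSign x s := by
  unfold placeSign
  congr 2
  ext y
  simp only [Finset.mem_filter, Finset.mem_erase]
  exact ⟨fun h => ⟨h.1.2, h.2⟩, fun h => ⟨⟨h.2.ne, h.1⟩, h.2⟩⟩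

theorem placeSign_mul_self (x : V) (s : Finset V) : placeSign x s * placeSign x s = 1 := by
  simp [placeSign, ← mul_pow]

/-- The boundary read off at a single ridge; this turns the cycle condition into one equation per
ridge. -/
theorem boundary_apply [Fintype V] (z : Chain V) (u : Finset V) :
    boundary z u = ∑ x ∈ univ.filter (· ∉ u), placeSign x u * z (insert x u) := by
  induction z using Finsupp.induction_linear with
  | zero => simp
  | add f g hf hg => simp [hf, hg, mul_add, Finset.sum_add_distrib]
  | single s b =>
    rw [boundary_single, Finsupp.finsetSum_apply, Finset.sum_filter,
      ← Finset.sum_filter_add_sum_filter_not univ (· ∈ s)]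
    rw [Finset.sum_eq_zero (s := univ.filter (· ∉ s)), add_zero]
    · rw [Finset.filter_univ_mem]
      refine Finset.sum_congr rfl fun x hx => ?_
      by_cases h : s.erase x = u
      · subst h
        simp [Finset.insert_erase hx, placeSign_erase_self, mul_comm]
      · rw [Finsupp.single_eq_of_ne (Ne.symm h)]
        split_ifs with hxu
        · rfl
        · rw [Finsupp.single_eq_of_ne, mul_zero]
          rintro rfl
          exact h (Finset.erase_insert hxu)
    · intro x hx
      have hx := (Finset.mem_filter.1 hx).2
      split_ifs with hxu
      · rfl
      · rw [Finsupp.single_eq_of_ne, mul_zero]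
        rintro rfl
        exact hx (Finset.mem_insert_self _ _)

/-- The sign of the shuffle that sorts the concatenation of two oriented simplices. -/
def shuffleSign (s t : Finset V) : ℤ :=
  (-1) ^ ((s ×ˢ t).filter fun p => p.2 < p.1).card

theorem shuffleSign_mul_self (s t : Finset V) : shuffleSign s t * shuffleSign s t = 1 := by
  simp [shuffleSign, ← mul_pow]

theorem wedge_single_single (s t : Finset V) (a b : ℤ) :
    wedge (Finsupp.single s a) (Finsupp.single t b) =
      if Disjoint s t then Finsupp.single (s ∪ t) (a * b * shuffleSign s t) else 0 := by
  rw [wedge, Finsupp.sum_single_index, Finsupp.sum_single_index]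
  · rfl
  · simp
  · simp [Finsupp.sum]

theorem wedge_add_left (f₁ f₂ g : Chain V) :
    wedge (f₁ + f₂) g = wedge f₁ g + wedge f₂ g := by
  unfold wedge
  refine Finsupp.sum_add_index' (fun s => by simp [Finsupp.sum]) fun s a₁ a₂ => ?_
  rw [← Finsupp.sum_add]
  refine Finset.sum_congr rfl fun t _ => ?_
  dsimp only
  split_ifs
  · rw [← Finsupp.single_add]; congr 1; ring
  · simp

theorem wedge_add_right (f g₁ g₂ : Chain V) :
    wedge f (g₁ + g₂) = wedge f g₁ + wedge f g₂ := by
  unfold wedge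
  rw [← Finsupp.sum_add]
  refine Finset.sum_congr rfl fun s _ => ?_
  refine Finsupp.sum_add_index' (fun t => by simp) fun t b₁ b₂ => ?_
  split_ifs
  · rw [← Finsupp.single_add]; congr 1; ring
  · simp

/-- The wedge product as a biadditive map. -/
noncomputable def wedgeHom : Chain V →+ Chain V →+ Chain V :=
  AddMonoidHom.mk' (fun f => AddMonoidHom.mk' (wedge f) (wedge_add_right f)) fun f₁ f₂ => by
    exact DFunLike.ext _ _ (wedge_add_left f₁ f₂)

theorem wedgeHom_apply (f g : Chain V) : wedgeHom f g = wedge f g := rfl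

theorem wedge_eq_sum (f g : Chain V) :
    wedge f g = f.sum fun s a => g.sum fun t b =>
      wedge (Finsupp.single s a) (Finsupp.single t b) := by
  rw [wedge]
  refine Finset.sum_congr rfl fun s _ => Finset.sum_congr rfl fun t _ => ?_
  exact (wedge_single_single s t _ _).symm

theorem wedge_one_left (g : Chain V) : wedge (Finsupp.single ∅ 1) g = g := by
  rw [wedge_eq_sum, Finsupp.sum_single_index]
  · simp [wedge_single_single, shuffleSign]
  · simp [Finsupp.sum, ← wedgeHom_apply]

theorem orientedSimplex_nil : orientedSimplex ([] : List V) = Finsupp.single ∅ 1 := by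
  simp [orientedSimplex, inversions]

theorem exists_of_wedge_ne_zero {f g : Chain V} {u : Finset V} (h : wedge f g u ≠ 0) :
    ∃ s t, f s ≠ 0 ∧ g t ≠ 0 ∧ Disjoint s t ∧ s ∪ t = u := by
  rw [wedge, Finsupp.sum_apply, Finsupp.sum] at h
  obtain ⟨s, hs, h⟩ := Finset.exists_ne_zero_of_sum_ne_zero h
  rw [Finsupp.sum_apply, Finsupp.sum] at h
  obtain ⟨t, ht, h⟩ := Finset.exists_ne_zero_of_sum_ne_zero h
  refine ⟨s, t, Finsupp.mem_support_iff.1 hs, Finsupp.mem_support_iff.1 ht, ?_⟩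
  split_ifs at h with hd
  · refine ⟨hd, ?_⟩
    by_contra hne
    exact h (Finsupp.single_eq_of_ne (Ne.symm hne))
  · simp at h

/-- The coefficients of a wedge product whose factors live on disjoint sets of vertices. -/
theorem wedge_apply_of_separated (P : V → Prop) [DecidablePred P] {f g : Chain V}
    (hf : ∀ s, f s ≠ 0 → ∀ x ∈ s, P x) (hg : ∀ s, g s ≠ 0 → ∀ x ∈ s, ¬ P x) (u : Finset V) :
    wedge f g u = shuffleSign (u.filter P) (u.filter (¬ P ·)) *
      (f (u.filter P) * g (u.filter (¬ P ·))) := by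
  have key : ∀ s t, f s ≠ 0 → g t ≠ 0 → s ∪ t = u → s = u.filter P ∧ t = u.filter (¬ P ·) := by
    rintro s t hs ht rfl
    rw [Finset.filter_union, Finset.filter_union, Finset.filter_true_of_mem (hf s hs),
      Finset.filter_false_of_mem (hg t ht), Finset.filter_true_of_mem (hg t ht),
      Finset.filter_false_of_mem fun x hx => not_not_intro (hf s hs x hx)]
    simp
  by_cases h : f (u.filter P) * g (u.filter (¬ P ·)) = 0
  · rw [h, mul_zero]
    by_contra hne
    obtain ⟨s, t, hs, ht, -, hu⟩ := exists_of_wedge_ne_zero hne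
    obtain ⟨rfl, rfl⟩ := key s t hs ht hu
    exact mul_ne_zero hs ht h
  · have h1 := left_ne_zero_of_mul h
    have h2 := right_ne_zero_of_mul h
    rw [wedge, Finsupp.sum_apply, Finsupp.sum, Finset.sum_eq_single (u.filter P)]
    · rw [Finsupp.sum_apply, Finsupp.sum, Finset.sum_eq_single (u.filter (¬ P ·))]
      · rw [if_pos (Finset.disjoint_filter_filter_not _ _ _), Finset.filter_union_filter_not_eq,
          Finsupp.single_eq_same, shuffleSign]
        ring
      · intro t ht hne
        split_ifs with hd
        · refine Finsupp.single_eq_of_ne fun hu => hne ?_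
          exact (key _ t h1 (Finsupp.mem_support_iff.1 ht) hu.symm).2
        · rfl
      · intro h3
        exact absurd (Finsupp.mem_support_iff.2 h2) h3
    · intro s hs hne
      rw [Finsupp.sum_apply, Finsupp.sum]
      refine Finset.sum_eq_zero fun t ht => ?_
      split_ifs with hd
      · refine Finsupp.single_eq_of_ne fun hu => hne ?_
        exact (key s t (Finsupp.mem_support_iff.1 hs) (Finsupp.mem_support_iff.1 ht) hu.symm).1
      · rfl
    · intro h3
      exact absurd (Finsupp.mem_support_iff.2 h1) h3

theorem placeSign_union {x : V} {s t : Finset V} (h : Disjoint s t) :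
    placeSign x (s ∪ t) = placeSign x s * placeSign x t := by
  unfold placeSign
  rw [Finset.filter_union, Finset.card_union_of_disjoint (Finset.disjoint_filter_filter h), pow_add]

theorem shuffleSign_eq_left {x : V} {s t : Finset V} (hx : x ∈ s) :
    shuffleSign s t = shuffleSign (s.erase x) t * placeSign x t := by
  unfold shuffleSign placeSign
  rw [← pow_add]
  congr 1
  rw [Finset.card_filter, Finset.card_filter, Finset.card_filter, Finset.sum_product,
    Finset.sum_product, ← Finset.sum_erase_add _ _ hx]

theorem shuffleSign_eq_right {x : V} {s t : Finset V} (hx : x ∈ t) (hs : x ∉ s) :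
    shuffleSign s t = shuffleSign s (t.erase x) * ((-1) ^ s.card * placeSign x s) := by
  unfold shuffleSign placeSign
  -- The vertex x of the right factor crosses just the vertices of s above it; as x ∉ s, their
  -- number is the size of s minus the number of those below x.
  have h1 : (-1 : ℤ) ^ s.card * (-1) ^ (s.filter (· < x)).card =
      (-1) ^ (s.filter (x < ·)).card := by
    have : s.card = (s.filter (· < x)).card + (s.filter (x < ·)).card := by
      rw [← Finset.card_filter_add_card_filter_not (s := s) (· < x)]
      congr 2
      refine Finset.filter_congr fun y hy => ?_
      have : y ≠ x := fun h => hs (h ▸ hy)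
      rw [not_lt]
      exact ⟨fun h => lt_of_le_of_ne h this.symm, le_of_lt⟩
    rw [this, pow_add, mul_right_comm, ← mul_pow]
    simp
  rw [h1, ← pow_add]
  congr 1
  rw [Finset.card_filter, Finset.card_filter, Finset.card_filter, Finset.sum_product_right,
    Finset.sum_product_right, ← Finset.sum_erase_add _ _ hx]

theorem boundary_wedge_single {s t : Finset V} (h : Disjoint s t) (a b : ℤ) :
    boundary (wedge (Finsupp.single s a) (Finsupp.single t b)) =
      wedge (boundary (Finsupp.single s a)) (Finsupp.single t b) +
        (-1) ^ s.card • wedge (Finsupp.single s a) (boundary (Finsupp.single t b)) := by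
  rw [wedge_single_single, if_pos h, boundary_single, boundary_single, boundary_single,
    Finset.sum_union h]
  congr 1
  · rw [← wedgeHom_apply, map_sum, AddMonoidHom.finsetSum_apply]
    refine Finset.sum_congr rfl fun x hx => ?_
    have hxt : x ∉ t := Finset.disjoint_left.1 h hx
    rw [wedgeHom_apply, wedge_single_single,
      if_pos (Finset.disjoint_of_subset_left (Finset.erase_subset _ _) h),
      Finset.erase_union_distrib, Finset.erase_eq_of_notMem hxt, placeSign_union h,
      shuffleSign_eq_left hx]
    congr 1
    linear_combination (a * b * shuffleSign (s.erase x) t * placeSign x s) * placeSign_mul_self x t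
  · rw [← wedgeHom_apply, map_sum, Finset.smul_sum]
    refine Finset.sum_congr rfl fun x hx => ?_
    have hxs : x ∉ s := Finset.disjoint_right.1 h hx
    rw [wedgeHom_apply, wedge_single_single,
      if_pos (Finset.disjoint_of_subset_right (Finset.erase_subset _ _) h),
      Finset.erase_union_distrib, Finset.erase_eq_of_notMem hxs, placeSign_union h,
      shuffleSign_eq_right hx hxs, Finsupp.smul_single]
    congr 1
    rw [smul_eq_mul]
    linear_combination (a * b * shuffleSign s (t.erase x) * placeSign x t * (-1) ^ s.card) *
      placeSign_mul_self x s

/-- The Leibniz rule. -/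
theorem boundary_wedge {f g : Chain V} {k : ℕ} (hf : ∀ s, f s ≠ 0 → s.card = k)
    (hfg : ∀ s t, f s ≠ 0 → g t ≠ 0 → Disjoint s t) :
    boundary (wedge f g) = wedge (boundary f) g + (-1) ^ k • wedge f (boundary g) := by
  conv_rhs => rw [← Finsupp.sum_single f, ← Finsupp.sum_single g]
  rw [wedge_eq_sum, map_finsuppSum]
  simp only [← wedgeHom_apply, map_finsuppSum]
  simp only [Finsupp.sum, AddMonoidHom.finsetSum_apply, Finset.smul_sum]
  rw [Finset.sum_comm (s := g.support), Finset.sum_comm (s := g.support),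
    ← Finset.sum_add_distrib]
  refine Finset.sum_congr rfl fun s hs => ?_
  rw [← Finset.sum_add_distrib]
  refine Finset.sum_congr rfl fun t ht => ?_
  have hs := Finsupp.mem_support_iff.1 hs
  have ht := Finsupp.mem_support_iff.1 ht
  have := boundary_wedge_single (hfg s t hs ht) (f s) (g t)
  rw [hf s hs] at this
  exact this

end Wedge

/-! ### Facets as injections, and top cycles as balanced functions. -/

section TopCells

variable {m n k : ℕ}

theorem mem_augFaces_chessboard {A : Finset (Fin m)} {B : Finset (Fin n)}
    {s : Finset (Square m n)} :
    s ∈ augFaces (chessboard A B) ↔ (∀ x ∈ s, (ofLex x).1 ∈ A ∧ (ofLex x).2 ∈ B) ∧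
      ∀ x ∈ s, ∀ y ∈ s, x ≠ y → (ofLex x).1 ≠ (ofLex y).1 ∧ (ofLex x).2 ≠ (ofLex y).2 := by
  constructor
  · rintro (rfl | h)
    · simp
    · exact h.2
  · intro h
    rcases s.eq_empty_or_nonempty with rfl | hs
    · exact Or.inl rfl
    · exact Or.inr ⟨hs, h⟩

theorem augFaces_of_subset {A : Finset (Fin m)} {B : Finset (Fin n)}
    {s t : Finset (Square m n)} (ht : t ∈ augFaces (chessboard A B)) (hst : s ⊆ t) :
    s ∈ augFaces (chessboard A B) := by
  rw [mem_augFaces_chessboard] at ht ⊢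
  exact ⟨fun x hx => ht.1 x (hst hx), fun x hx y hy => ht.2 x (hst hx) y (hst hy)⟩

theorem augFaces_mono {A A' : Finset (Fin m)} {B B' : Finset (Fin n)} (hA : A ⊆ A')
    (hB : B ⊆ B') {s : Finset (Square m n)} (hs : s ∈ augFaces (chessboard A B)) :
    s ∈ augFaces (chessboard A' B') := by
  rw [mem_augFaces_chessboard] at hs ⊢
  exact ⟨fun x hx => ⟨hA (hs.1 x hx).1, hB (hs.1 x hx).2⟩, hs.2⟩

theorem card_image_row {A : Finset (Fin m)} {B : Finset (Fin n)} {s : Finset (Square m n)}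
    (hs : s ∈ augFaces (chessboard A B)) : (s.image fun x => (ofLex x).1).card = s.card := by
  rw [mem_augFaces_chessboard] at hs
  refine Finset.card_image_of_injOn fun x hx y hy h => ?_
  by_contra hne
  exact (hs.2 x hx y hy hne).1 h

theorem card_image_col {A : Finset (Fin m)} {B : Finset (Fin n)} {s : Finset (Square m n)}
    (hs : s ∈ augFaces (chessboard A B)) : (s.image fun x => (ofLex x).2).card = s.card := by
  rw [mem_augFaces_chessboard] at hs
  refine Finset.card_image_of_injOn fun x hx y hy h => ?_
  by_contra hne
  exact (hs.2 x hx y hy hne).2 h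

theorem image_row_subset {A : Finset (Fin m)} {B : Finset (Fin n)} {s : Finset (Square m n)}
    (hs : s ∈ augFaces (chessboard A B)) : (s.image fun x => (ofLex x).1) ⊆ A :=
  Finset.image_subset_iff.2 fun x hx => ((mem_augFaces_chessboard.1 hs).1 x hx).1

theorem card_le_of_mem_augFaces {A : Finset (Fin m)} {B : Finset (Fin n)}
    {s : Finset (Square m n)} (hs : s ∈ augFaces (chessboard A B)) : s.card ≤ A.card :=
  card_image_row hs ▸ Finset.card_le_card (image_row_subset hs)

/-- The simplex with the square `(e i, φ i)` in the row `e i`, for each `i`. -/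
def graph (e : Fin k ↪o Fin m) (φ : Fin k → Fin n) : Finset (Square m n) :=
  univ.image fun i => toLex (e i, φ i)

variable {e : Fin k ↪o Fin m}

theorem mem_graph {φ : Fin k → Fin n} {x : Square m n} :
    x ∈ graph e φ ↔ ∃ i, toLex (e i, φ i) = x := by
  simp [graph]

theorem mk_mem_graph {φ : Fin k → Fin n} {i : Fin k} {b : Fin n} :
    toLex (e i, b) ∈ graph e φ ↔ φ i = b := by
  rw [mem_graph]
  constructor
  · rintro ⟨j, hj⟩
    have := toLex_inj.1 hj
    simp only [Prod.mk.injEq, EmbeddingLike.apply_eq_iff_eq] at this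
    exact this.1 ▸ this.2
  · rintro rfl
    exact ⟨i, rfl⟩

theorem card_graph (φ : Fin k → Fin n) : (graph e φ).card = k := by
  rw [graph, Finset.card_image_of_injective, Finset.card_univ, Fintype.card_fin]
  intro i j h
  have := toLex_inj.1 h
  simp only [Prod.mk.injEq, EmbeddingLike.apply_eq_iff_eq] at this
  exact this.1

theorem graph_injective : Function.Injective (graph (n := n) e) := by
  intro φ ψ h
  funext i
  have : toLex (e i, φ i) ∈ graph e ψ := h ▸ mk_mem_graph.2 rfl
  exact (mk_mem_graph.1 this).symm

theorem graph_mem_iff {A : Finset (Fin m)} {B : Finset (Fin n)} (hA : ∀ i, e i ∈ A)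
    {φ : Fin k → Fin n} :
    graph e φ ∈ augFaces (chessboard A B) ↔ Function.Injective φ ∧ ∀ i, φ i ∈ B := by
  rw [mem_augFaces_chessboard]
  constructor
  · intro h
    refine ⟨fun i j hij => ?_, fun i => (h.1 _ (mk_mem_graph.2 (rfl : φ i = φ i))).2⟩
    by_contra hne
    refine (h.2 (toLex (e i, φ i)) (mk_mem_graph.2 rfl) (toLex (e j, φ j)) (mk_mem_graph.2 rfl)
      fun h => hne ?_).2 hij
    have := toLex_inj.1 h
    simp only [Prod.mk.injEq, EmbeddingLike.apply_eq_iff_eq] at this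
    exact this.1
  · rintro ⟨h1, h2⟩
    constructor
    · intro x hx
      obtain ⟨i, rfl⟩ := mem_graph.1 hx
      exact ⟨hA i, h2 i⟩
    · intro x hx y hy hne
      obtain ⟨i, rfl⟩ := mem_graph.1 hx
      obtain ⟨j, rfl⟩ := mem_graph.1 hy
      have hij : i ≠ j := fun h => hne (h ▸ rfl)
      exact ⟨fun h => hij (e.injective h), fun h => hij (h1 h)⟩

/-- The squares of a face lie in distinct rows, so a face with as many squares as there are rows
occupies each row once. -/
theorem exists_eq_graph {A : Finset (Fin m)} {B : Finset (Fin n)} (hA : univ.image e = A)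
    {s : Finset (Square m n)} (hs : s ∈ augFaces (chessboard A B)) (hk : s.card = k) :
    ∃ φ : Fin k → Fin n, s = graph e φ := by
  have h1 : s.image (fun x => (ofLex x).1) = A := by
    refine Finset.eq_of_subset_of_card_le (image_row_subset hs) ?_
    rw [card_image_row hs, hk, ← hA, Finset.card_image_of_injective _ e.injective]
    simp
  have h2 : ∀ i, ∃ b, toLex (e i, b) ∈ s := by
    intro i
    have : e i ∈ s.image (fun x => (ofLex x).1) := by
      rw [h1, ← hA]
      exact Finset.mem_image_of_mem _ (Finset.mem_univ _)
    obtain ⟨x, hx, hxi⟩ := Finset.mem_image.1 this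
    exact ⟨(ofLex x).2, by rw [← hxi]; exact hx⟩
  choose φ hφ using h2
  refine ⟨φ, (Finset.eq_of_subset_of_card_le (fun x hx => ?_) ?_).symm⟩
  · obtain ⟨i, rfl⟩ := mem_graph.1 hx
    exact hφ i
  · rw [card_graph, hk]

theorem graph_update_eq_insert (φ : Fin k → Fin n) (i : Fin k) (b : Fin n) :
    graph e (Function.update φ i b) =
      insert (toLex (e i, b)) ((graph e φ).erase (toLex (e i, φ i))) := by
  ext x
  simp only [Finset.mem_insert, Finset.mem_erase, mem_graph]
  constructor
  · rintro ⟨j, rfl⟩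
    by_cases h : j = i
    · subst h; left; simp
    · right
      rw [Function.update_of_ne h]
      exact ⟨fun h' => h (e.injective (Prod.ext_iff.1 (toLex_inj.1 h')).1), j, rfl⟩
  · rintro (rfl | ⟨hne, j, rfl⟩)
    · exact ⟨i, by simp⟩
    · refine ⟨j, ?_⟩
      rw [Function.update_of_ne]
      rintro rfl
      exact hne rfl

/-- Squares are ordered by rows first, so the column of a new square does not affect its place among
squares of other rows. All facets through a ridge thus enter its boundary coefficient with one
common sign. -/
theorem placeSign_eq_of_row {u : Finset (Square m n)} {x y : Square m n}
    (hxy : (ofLex x).1 = (ofLex y).1) (hu : ∀ v ∈ u, (ofLex v).1 ≠ (ofLex x).1) :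
    placeSign x u = placeSign y u := by
  unfold placeSign
  congr 2
  refine Finset.filter_congr fun v hv => ?_
  have hvx := hu v hv
  have hvy := hxy ▸ hvx
  rw [Prod.Lex.lt_iff, Prod.Lex.lt_iff]
  simp [hvy, hxy]

theorem row_ne_of_mem_erase_graph {φ : Fin k → Fin n} {i : Fin k} {v : Square m n}
    (hv : v ∈ (graph e φ).erase (toLex (e i, φ i))) : (ofLex v).1 ≠ e i := by
  obtain ⟨hne, hv⟩ := Finset.mem_erase.1 hv
  obtain ⟨j, rfl⟩ := mem_graph.1 hv
  intro h
  have : j = i := e.injective h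
  exact hne (by rw [this])

theorem boundary_apply_erase_graph {A : Finset (Fin m)} {B : Finset (Fin n)}
    (hA : univ.image e = A) {z : Chain (Square m n)} (hz : z ∈ chains (chessboard A B) k)
    (φ : Fin k → Fin n) (i : Fin k) :
    boundary z ((graph e φ).erase (toLex (e i, φ i))) =
      placeSign (toLex (e i, φ i)) ((graph e φ).erase (toLex (e i, φ i))) *
        ∑ b, z (graph e (Function.update φ i b)) := by
  rw [mem_chains_iff] at hz
  set u := (graph e φ).erase (toLex (e i, φ i)) with hu
  have hrow : ∀ v ∈ u, (ofLex v).1 ≠ e i := fun v hv => row_ne_of_mem_erase_graph hv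
  have himg : univ.image (fun b : Fin n => (toLex (e i, b) : Square m n)) ⊆
      univ.filter (· ∉ u) := by
    intro x hx
    obtain ⟨b, -, rfl⟩ := Finset.mem_image.1 hx
    exact Finset.mem_filter.2 ⟨Finset.mem_univ _, fun h => hrow _ h rfl⟩
  rw [boundary_apply, ← Finset.sum_subset himg, Finset.sum_image, Finset.mul_sum]
  · refine Finset.sum_congr rfl fun b _ => ?_
    rw [graph_update_eq_insert, ← hu]
    congr 1
    exact placeSign_eq_of_row rfl hrow
  · intro b _ c _ h
    exact (Prod.ext_iff.1 (toLex_inj.1 h)).2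
  -- A square outside the vacated row shares its row with a square of the ridge or lies outside A,
  -- so it contributes nothing.
  · intro x hx hxi
    have hxu := (Finset.mem_filter.1 hx).2
    by_contra hne
    obtain ⟨hface, hcard⟩ := hz _ (right_ne_zero_of_mul hne)
    rw [mem_augFaces_chessboard] at hface
    have hxA := (hface.1 x (Finset.mem_insert_self _ _)).1
    rw [← hA] at hxA
    obtain ⟨j, -, hj⟩ := Finset.mem_image.1 hxA
    by_cases hji : j = i
    · subst hji
      exact hxi (Finset.mem_image.2 ⟨(ofLex x).2, Finset.mem_univ _, by rw [hj]; rfl⟩)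
    · have hju : (toLex (e j, φ j) : Square m n) ∈ u :=
        Finset.mem_erase.2 ⟨fun h => hji (e.injective (Prod.ext_iff.1 (toLex_inj.1 h)).1),
          mk_mem_graph.2 rfl⟩
      refine (hface.2 x (Finset.mem_insert_self _ _) _ (Finset.mem_insert_of_mem hju) ?_).1 hj.symm
      rintro rfl
      exact hxu hju

theorem boundary_eq_zero_iff {A : Finset (Fin m)} {B : Finset (Fin n)}
    (hA : univ.image e = A) {z : Chain (Square m n)} (hz : z ∈ chains (chessboard A B) k) :
    boundary z = 0 ↔ ∀ (φ : Fin k → Fin n) i, ∑ b, z (graph e (Function.update φ i b)) = 0 := by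
  constructor
  · intro h φ i
    have := boundary_apply_erase_graph hA hz φ i
    rw [h, Finsupp.zero_apply] at this
    refine (mul_eq_zero.1 this.symm).resolve_left ?_
    simp [placeSign]
  · intro h
    ext u
    rw [Finsupp.zero_apply]
    by_contra hne
    rw [boundary_apply] at hne
    obtain ⟨x, hx, hxne⟩ := Finset.exists_ne_zero_of_sum_ne_zero hne
    have hxu := (Finset.mem_filter.1 hx).2
    obtain ⟨hface, hcard⟩ := mem_chains_iff.1 hz _ (right_ne_zero_of_mul hxne)
    obtain ⟨φ, hφ⟩ := exists_eq_graph hA hface hcard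
    obtain ⟨i, rfl⟩ := mem_graph.1 (hφ ▸ Finset.mem_insert_self x u)
    rw [← boundary_apply, ← Finset.erase_insert hxu, hφ,
      boundary_apply_erase_graph hA hz, h, mul_zero] at hne
    exact hne rfl

/-- A function on maps which vanishes unless its argument is injective, and which is summed to zero
when one value of the argument varies.  The coefficients of the top-dimensional cycles of a
chessboard complex are of this kind. -/
structure IsBalanced {ι κ M : Type*} [DecidableEq ι] [Fintype κ] [AddCommMonoid M]
    (f : (ι → κ) → M) : Prop where
  eq_zero : ∀ φ, ¬ Function.Injective φ → f φ = 0
  sum_update : ∀ φ i, ∑ b, f (Function.update φ i b) = 0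

theorem isBalanced_of_mem_cycles {A : Finset (Fin m)} {B : Finset (Fin n)}
    (hA : univ.image e = A) {z : Chain (Square m n)} (hz : z ∈ cycles (chessboard A B) k) :
    IsBalanced fun φ : Fin k → Fin n => z (graph e φ) where
  eq_zero φ hφ := by
    by_contra hne
    refine hφ ((graph_mem_iff fun i => ?_).1 (mem_chains_iff.1 hz.1 _ hne).1).1
    rw [← hA]
    exact Finset.mem_image_of_mem _ (Finset.mem_univ _)
  sum_update := (boundary_eq_zero_iff hA hz.1).1 hz.2

/-- No face has more squares than there are rows in A. -/
theorem boundaries_eq_bot {A : Finset (Fin m)} {B : Finset (Fin n)} (hk : A.card ≤ k) :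
    boundaries (chessboard A B) k = ⊥ := by
  have : chains (chessboard A B) (k + 1) = ⊥ := by
    rw [eq_bot_iff]
    intro z hz
    rw [Submodule.mem_bot]
    ext s
    by_contra hne
    obtain ⟨h1, h2⟩ := mem_chains_iff.1 hz s hne
    have := card_le_of_mem_augFaces h1
    omega
  rw [boundaries, this, Submodule.map_bot]

/-- In the top dimension, homology classes are cycles. -/
noncomputable def topHomologyEquiv {A : Finset (Fin m)} {B : Finset (Fin n)} (hk : A.card ≤ k) :
    Homology (chessboard A B) k ≃ₗ[ℤ] cycles (chessboard A B) k :=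
  Submodule.quotEquivOfEqBot _ (by
    rw [boundaries_eq_bot hk, Submodule.submoduleOf, Submodule.comap_bot, Submodule.ker_subtype])

theorem topHomologyEquiv_homologyClass {A : Finset (Fin m)} {B : Finset (Fin n)}
    (hk : A.card ≤ k) (z : Chain (Square m n)) (hz : z ∈ cycles (chessboard A B) k) :
    topHomologyEquiv hk (homologyClass (chessboard A B) k z hz) = ⟨z, hz⟩ :=
  Submodule.quotEquivOfEqBot_apply_mk _ _ _

end TopCells

/-! ### Oriented simplices listed in increasing order. -/

section SortedSimplices

theorem inversions_eq_zero {V : Type*} [LinearOrder V] {l : List V} (h : l.Pairwise (· < ·)) :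
    inversions l = 0 := by
  induction l with
  | nil => rfl
  | cons x l ih =>
    rw [List.pairwise_cons] at h
    rw [inversions, ih h.2, add_zero, List.countP_eq_zero]
    intro y hy
    simpa using (h.1 y hy).le

theorem orientedSimplex_of_pairwise_lt {V : Type*} [LinearOrder V] {l : List V}
    (h : l.Pairwise (· < ·)) : orientedSimplex l = Finsupp.single l.toFinset 1 := by
  rw [orientedSimplex, if_pos (show l.Nodup from h.imp fun h => h.ne), inversions_eq_zero h,
    pow_zero]

theorem orientedSimplex_eq_graph {m n k : ℕ} (e : Fin k ↪o Fin m) (φ : Fin k → Fin n) :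
    orientedSimplex ((List.finRange k).map fun i => (toLex (e i, φ i) : Square m n)) =
      Finsupp.single (graph e φ) 1 := by
  rw [orientedSimplex_of_pairwise_lt]
  · congr 1
  · rw [List.pairwise_map]
    refine (List.pairwise_lt_finRange k).imp fun h => ?_
    rw [Prod.Lex.lt_iff]
    exact Or.inl (e.strictMono h)

end SortedSimplices

/-! ### Chessboards with one more column than rows. -/

section FundamentalCycles

open Equiv

/-- The transpositions (x last) generate the symmetric group, since (x y) = (x last)(y last)(x
last). It serves twice: with r as connectedness by adjacent facets, and with r as proportionality of
the coefficients of a cycle. -/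
theorem perm_induction_swap_last {k : ℕ} {r : Perm (Fin (k + 1)) → Perm (Fin (k + 1)) → Prop}
    (hr : ∀ σ, r σ σ) (ht : ∀ σ τ π, r σ τ → r τ π → r σ π)
    (h : ∀ σ (i : Fin k), r σ (swap i.castSucc (Fin.last k) * σ)) (σ τ : Perm (Fin (k + 1))) :
    r σ τ := by
  have hlast : ∀ σ x, r σ (swap x (Fin.last k) * σ) := by
    intro σ x
    induction x using Fin.lastCases with
    | last => rw [swap_self]; exact hr σ
    | cast i => exact h σ i
  have hswap : ∀ σ x y, r σ (swap x y * σ) := by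
    intro σ x y
    by_cases hy : y = Fin.last k
    · subst hy; exact hlast σ x
    by_cases hxy : x = y
    · subst hxy; rw [swap_self]; exact hr σ
    · have := swap_mul_swap_mul_swap (x := Fin.last k) (y := y) (z := x) (Ne.symm hy)
      by_cases hx : x = Fin.last k
      · subst hx; rw [swap_comm]; exact hlast σ y
      have h2 := swap_mul_swap_mul_swap (x := y) (y := Fin.last k) (z := x) hy (Ne.symm hxy)
      rw [← h2, mul_assoc, mul_assoc, swap_comm (Fin.last k) x, swap_comm y (Fin.last k)]
      have a1 := hlast σ x
      have a2 := hlast (swap x (Fin.last k) * σ) y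
      have a3 := hlast (swap y (Fin.last k) * (swap x (Fin.last k) * σ)) x
      rw [swap_comm y (Fin.last k)] at a2 a3
      exact ht _ _ _ a1 (ht _ _ _ a2 a3)
  have key : ∀ π : Perm (Fin (k + 1)), r σ (π * σ) := by
    intro π
    induction π using Equiv.Perm.swap_induction_on with
    | one => exact hr σ
    | swap_mul f x y _ ih => exact ht _ _ _ ih (by rw [mul_assoc]; exact hswap _ x y)
  simpa using key (τ * σ⁻¹)

variable {m n k : ℕ} {e : Fin k ↪o Fin m} {b : Fin (k + 1) ↪o Fin n}

/-- The places of the letters `0, …, k - 1` in the word `σ` on the places given by `b`. -/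
def places (b : Fin (k + 1) ↪o Fin n) (σ : Perm (Fin (k + 1))) (i : Fin k) : Fin n :=
  b (σ.symm i.castSucc)

theorem places_injective_apply (σ : Perm (Fin (k + 1))) : Function.Injective (places b σ) :=
  fun _ _ h => Fin.castSucc_injective k (σ.symm.injective (b.injective h))

theorem places_injective : Function.Injective (places (k := k) b) := by
  intro σ τ h
  have h1 : ∀ i : Fin k, σ.symm i.castSucc = τ.symm i.castSucc := fun i =>
    b.injective (congrFun h i)
  have h2 : σ.symm (Fin.last k) = τ.symm (Fin.last k) := by
    -- Where all other letters have equal places, only one place is left for ∞.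
    by_contra hne
    obtain ⟨x, hx⟩ := σ.symm.surjective (τ.symm (Fin.last k))
    induction x using Fin.lastCases with
    | last => exact hne hx
    | cast i => rw [h1, τ.symm.apply_eq_iff_eq] at hx; exact (Fin.castSucc_lt_last i).ne hx
  apply Equiv.symm_bijective.injective
  ext x : 1
  induction x using Fin.lastCases with
  | last => exact h2
  | cast i => exact h1 i

/-- An injection into k + 1 places misses exactly one of them, and that one receives ∞. -/
theorem exists_places {B : Finset (Fin n)} (hB : univ.image b = B) {φ : Fin k → Fin n}
    (hφ : Function.Injective φ) (hφB : ∀ i, φ i ∈ B) : ∃ σ, places b σ = φ := by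
  have h1 : ∀ i, ∃ j, b j = φ i := by
    intro i
    have := hφB i
    rw [← hB] at this
    simpa using this
  choose ψ hψ using h1
  have hψi : Function.Injective ψ := fun i j h => hφ (by rw [← hψ, ← hψ, h])
  obtain ⟨c, hc⟩ : ∃ c, c ∉ Set.range ψ := by
    by_contra! hcon
    have := Fintype.card_le_of_surjective ψ hcon
    simp at this
  have hs : Function.Injective (Fin.snoc ψ c : Fin (k + 1) → Fin (k + 1)) :=
    Fin.snoc_injective_iff.2 ⟨hψi, hc⟩
  let τ : Perm (Fin (k + 1)) := Equiv.ofBijective _ (Finite.injective_iff_bijective.1 hs)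
  refine ⟨τ.symm, ?_⟩
  funext i
  rw [places, Equiv.symm_symm, ← hψ]
  congr 1
  exact Fin.snoc_castSucc (α := fun _ => Fin (k + 1)) c ψ i

/-- Exchanging a letter with ∞ moves one square into the free column: the passage to the
neighbouring facet. -/
theorem places_swap_mul (σ : Perm (Fin (k + 1))) (i : Fin k) :
    places b (swap i.castSucc (Fin.last k) * σ) =
      Function.update (places b σ) i (b (σ.symm (Fin.last k))) := by
  funext j
  have : (swap i.castSucc (Fin.last k) * σ).symm j.castSucc =
      σ.symm (swap i.castSucc (Fin.last k) j.castSucc) := by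
    rw [← Equiv.Perm.inv_def, mul_inv_rev, swap_inv]
    rfl
  rw [places, this]
  by_cases h : j = i
  · subst h; simp
  · rw [Function.update_of_ne h, swap_apply_of_ne_of_ne, places]
    · exact fun h' => h (Fin.castSucc_injective k h')
    · exact (Fin.castSucc_lt_last j).ne

theorem eq_or_eq_of_update_places {B : Finset (Fin n)} (hB : univ.image b = B)
    {σ : Perm (Fin (k + 1))} {i : Fin k} {c : Fin n} (hc : c ∈ B)
    (hi : Function.Injective (Function.update (places b σ) i c)) :
    c = places b σ i ∨ c = b (σ.symm (Fin.last k)) := by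
  rw [← hB] at hc
  obtain ⟨x, -, rfl⟩ := Finset.mem_image.1 hc
  obtain ⟨y, rfl⟩ := σ.symm.surjective x
  induction y using Fin.lastCases with
  | last => exact Or.inr rfl
  | cast j =>
    left
    by_cases h : j = i
    · rw [h]; rfl
    · exact absurd (hi (a₁ := j) (a₂ := i) (by simp [Function.update_of_ne h, places])) h

theorem places_ne_last (σ : Perm (Fin (k + 1))) (i : Fin k) :
    places b σ i ≠ b (σ.symm (Fin.last k)) := fun h =>
  (Fin.castSucc_lt_last i).ne (σ.symm.injective (b.injective h))

theorem graph_places_mem {A : Finset (Fin m)} {B : Finset (Fin n)} (hA : univ.image e = A)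
    (hB : univ.image b = B) (σ : Perm (Fin (k + 1))) :
    graph e (places b σ) ∈ augFaces (chessboard A B) :=
  (graph_mem_iff fun _ => hA ▸ Finset.mem_image_of_mem _ (Finset.mem_univ _)).2
    ⟨places_injective_apply σ, fun _ => hB ▸ Finset.mem_image_of_mem _ (Finset.mem_univ _)⟩

theorem exists_eq_graph_places {A : Finset (Fin m)} {B : Finset (Fin n)} (hA : univ.image e = A)
    (hB : univ.image b = B) {s : Finset (Square m n)} (hs : s ∈ augFaces (chessboard A B))
    (hk : s.card = k) : ∃ σ, s = graph e (places b σ) := by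
  obtain ⟨φ, rfl⟩ := exists_eq_graph hA hs hk
  obtain ⟨h1, h2⟩ := (graph_mem_iff fun i =>
    hA ▸ Finset.mem_image_of_mem e (Finset.mem_univ i)).1 hs
  obtain ⟨σ, rfl⟩ := exists_places hB h1 h2
  exact ⟨σ, rfl⟩

/-- A face with fewer squares than rows leaves a free row and, as there are enough columns, a free
column; add the square where they meet. -/
theorem exists_facet {A : Finset (Fin m)} {B : Finset (Fin n)} (hAB : A.card ≤ B.card)
    {s : Finset (Square m n)} (hs : s ∈ augFaces (chessboard A B)) :
    ∃ t ∈ augFaces (chessboard A B), s ⊆ t ∧ t.card = A.card := by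
  induction hd : A.card - s.card generalizing s with
  | zero =>
    have := card_le_of_mem_augFaces hs
    exact ⟨s, hs, Finset.Subset.refl _, by omega⟩
  | succ d ih =>
    obtain ⟨a, haA, ha⟩ : ∃ a ∈ A, a ∉ s.image fun x => (ofLex x).1 := by
      apply Finset.exists_mem_notMem_of_card_lt_card
      rw [card_image_row hs]; omega
    obtain ⟨c, hcB, hc⟩ : ∃ c ∈ B, c ∉ s.image fun x => (ofLex x).2 := by
      apply Finset.exists_mem_notMem_of_card_lt_card
      rw [card_image_col hs]; omega
    have ha' : ∀ x ∈ s, (ofLex x).1 ≠ a := fun x hx h => ha (Finset.mem_image.2 ⟨x, hx, h⟩)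
    have hc' : ∀ x ∈ s, (ofLex x).2 ≠ c := fun x hx h => hc (Finset.mem_image.2 ⟨x, hx, h⟩)
    have hnot : (toLex (a, c) : Square m n) ∉ s := fun h => ha' _ h rfl
    have hface : insert (toLex (a, c)) s ∈ augFaces (chessboard A B) := by
      have hs := mem_augFaces_chessboard.1 hs
      rw [mem_augFaces_chessboard]
      constructor
      · intro x hx
        rcases Finset.mem_insert.1 hx with rfl | hx
        · exact ⟨haA, hcB⟩
        · exact hs.1 x hx
      · intro x hx y hy hne
        rcases Finset.mem_insert.1 hx with rfl | hx <;> rcases Finset.mem_insert.1 hy with rfl | hy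
        · exact absurd rfl hne
        · exact ⟨(ha' y hy).symm, (hc' y hy).symm⟩
        · exact ⟨ha' x hx, hc' x hx⟩
        · exact hs.2 x hx y hy hne
    obtain ⟨t, ht, hst, htc⟩ := ih hface (by rw [Finset.card_insert_of_notMem hnot]; omega)
    exact ⟨t, ht, (Finset.subset_insert _ _).trans hst, htc⟩

theorem isPseudomanifold_aux {A : Finset (Fin m)} {B : Finset (Fin n)} (hA : univ.image e = A)
    (hB : univ.image b = B) : IsPseudomanifold (chessboard A B) k := by
  have hAc : A.card = k := by
    rw [← hA, Finset.card_image_of_injective _ e.injective]; simp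
  have hBc : B.card = k + 1 := by
    rw [← hB, Finset.card_image_of_injective _ b.injective]; simp
  have heA : ∀ i, e i ∈ A := fun i => hA ▸ Finset.mem_image_of_mem _ (Finset.mem_univ _)
  have hpure : ∀ s ∈ augFaces (chessboard A B), ∃ t ∈ augFaces (chessboard A B),
      s ⊆ t ∧ t.card = k := fun s hs => hAc ▸ exists_facet (by omega) hs
  have hinter : ∀ (σ : Perm (Fin (k + 1))) (i : Fin k),
      graph e (places b σ) ∩ graph e (places b (swap i.castSucc (Fin.last k) * σ)) =
        (graph e (places b σ)).erase (toLex (e i, places b σ i)) := by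
    intro σ i
    rw [places_swap_mul, graph_update_eq_insert, Finset.inter_insert_of_notMem,
      Finset.inter_eq_right.2 (Finset.erase_subset _ _)]
    rw [mk_mem_graph]
    exact places_ne_last σ i
  refine ⟨hpure, ?_, ?_⟩
  · intro s hs hsk
    obtain ⟨t, ht, hst, htk⟩ := hpure s hs
    obtain ⟨σ, rfl⟩ := exists_eq_graph_places hA hB ht htk
    obtain ⟨x, hx, hxs⟩ := Finset.exists_mem_notMem_of_card_lt_card (s := s)
      (t := graph e (places b σ)) (by omega)
    obtain ⟨i, rfl⟩ := mem_graph.1 hx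
    have hse : s = (graph e (places b σ)).erase (toLex (e i, places b σ i)) := by
      refine Finset.eq_of_subset_of_card_le (fun y hy => Finset.mem_erase.2
        ⟨fun h => hxs (h ▸ hy), hst hy⟩) ?_
      rw [Finset.card_erase_of_mem hx, card_graph]
      omega
    -- The ridge leaves one row and two columns free: the column just vacated and the one marked ∞.
    have hset : {t | t ∈ augFaces (chessboard A B) ∧ s ⊆ t ∧ t.card = k} =
        {graph e (places b σ), graph e (places b (swap i.castSucc (Fin.last k) * σ))} := by
      ext t
      simp only [Set.mem_ofPred_eq, Set.mem_insert_iff, Set.mem_singleton_iff]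
      constructor
      · rintro ⟨h1, h2, h3⟩
        obtain ⟨φ, rfl⟩ := exists_eq_graph hA h1 h3
        have hup : φ = Function.update (places b σ) i (φ i) := by
          funext j
          by_cases hj : j = i
          · subst hj; simp
          · rw [Function.update_of_ne hj, ← mk_mem_graph (e := e)]
            apply h2
            rw [hse]
            exact Finset.mem_erase.2 ⟨fun h => hj (e.injective (Prod.ext_iff.1 (toLex_inj.1 h)).1),
              mk_mem_graph.2 rfl⟩
        obtain ⟨h4, h5⟩ := (graph_mem_iff heA).1 h1
        rw [hup] at h4
        rw [places_swap_mul]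
        rcases eq_or_eq_of_update_places hB (h5 i) h4 with h6 | h6
        · left; rw [hup, h6, Function.update_eq_self]
        · right; rw [hup, h6]
      · rintro (rfl | rfl)
        · exact ⟨ht, hst, htk⟩
        · refine ⟨graph_places_mem hA hB _, ?_, card_graph _⟩
          rw [hse, ← hinter]
          exact Finset.inter_subset_right
    rw [hset, Set.ncard_pair]
    intro h
    have := congrFun (graph_injective h) i
    rw [places_swap_mul, Function.update_self] at this
    exact places_ne_last σ i this
  · intro s hs t ht hsk htk
    obtain ⟨σ, rfl⟩ := exists_eq_graph_places hA hB hs hsk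
    obtain ⟨τ, rfl⟩ := exists_eq_graph_places hA hB ht htk
    refine perm_induction_swap_last (r := fun σ τ => Relation.ReflTransGen
      (fun u v => v ∈ augFaces (chessboard A B) ∧ v.card = k ∧ (u ∩ v).card + 1 = k)
      (graph e (places b σ)) (graph e (places b τ))) (fun _ => Relation.ReflTransGen.refl)
      (fun _ _ _ h1 h2 => h1.trans h2) (fun σ i => Relation.ReflTransGen.single
        ⟨graph_places_mem hA hB _, card_graph _, ?_⟩) σ τ
    rw [hinter, Finset.card_erase_of_mem (mk_mem_graph.2 rfl), card_graph]
    have := i.2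
    omega

/-- Only two facets contain a given ridge, so the cycle condition makes their coefficients opposite,
just as a transposition changes the sign of a permutation. -/
theorem coeff_sign {A : Finset (Fin m)} {B : Finset (Fin n)} (hA : univ.image e = A)
    (hB : univ.image b = B) {z : Chain (Square m n)} (hz : z ∈ cycles (chessboard A B) k)
    (σ : Perm (Fin (k + 1))) :
    z (graph e (places b σ)) = Perm.sign σ * z (graph e (places b 1)) := by
  have hbal := isBalanced_of_mem_cycles hA hz
  have := perm_induction_swap_last (r := fun σ τ : Perm (Fin (k + 1)) =>
    z (graph e (places b τ)) = (Perm.sign τ * Perm.sign σ : ℤ) * z (graph e (places b σ)))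
    ?_ ?_ ?_ 1 σ
  · simpa using this
  · intro σ
    rw [← Units.val_mul, Int.units_mul_self]; simp
  · intro σ τ π h1 h2
    have h3 : (Perm.sign τ * Perm.sign τ : ℤ) = 1 := by
      rw [← Units.val_mul, Int.units_mul_self]; simp
    rw [h2, h1]
    linear_combination (Perm.sign π * Perm.sign σ * z (graph e (places b σ)) : ℤ) * h3
  · intro σ i
    have h1 := hbal.sum_update (places b σ) i
    rw [Finset.sum_eq_add (places b σ i) (b (σ.symm (Fin.last k))) (places_ne_last σ i),
      Function.update_eq_self, ← places_swap_mul] at h1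
    · have h3 : (Perm.sign σ * Perm.sign σ : ℤ) = 1 := by
        rw [← Units.val_mul, Int.units_mul_self]; simp
      rw [Perm.sign_mul, Perm.sign_swap (Fin.castSucc_lt_last i).ne]
      push_cast
      linear_combination h1 + z (graph e (places b σ)) * h3
    · rintro c - ⟨h2, h3⟩
      by_contra hne
      obtain ⟨h4, h5⟩ := (graph_mem_iff fun i => hA ▸ Finset.mem_image_of_mem e
        (Finset.mem_univ i)).1 (mem_chains_iff.1 hz.1 _ hne).1
      rcases eq_or_eq_of_update_places hB (by simpa using h5 i) h4 with h6 | h6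
      · exact h2 h6
      · exact h3 h6
    · intro h; exact absurd (Finset.mem_univ _) h
    · intro h; exact absurd (Finset.mem_univ _) h

/-- The signed sum over all words of the places given by `b`. -/
noncomputable def signedSum (e : Fin k ↪o Fin m) (b : Fin (k + 1) ↪o Fin n) :
    Chain (Square m n) :=
  ∑ σ : Perm (Fin (k + 1)), (Perm.sign σ : ℤ) • Finsupp.single (graph e (places b σ)) 1

theorem rho_eq_signedSum {A : Finset (Fin m)} {B : Finset (Fin n)} (h : B.card = A.card + 1) :
    rho A B = signedSum (A.orderEmbOfFin rfl) (B.orderEmbOfFin h) := by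
  rw [rho, dif_pos h, signedSum]
  refine Finset.sum_congr rfl fun σ _ => ?_
  rw [← orientedSimplex_eq_graph]
  rfl

theorem signedSum_apply (φ : Fin k → Fin n) :
    signedSum e b (graph e φ) =
      ∑ σ : Perm (Fin (k + 1)), if places b σ = φ then (Perm.sign σ : ℤ) else 0 := by
  rw [signedSum, Finsupp.finsetSum_apply]
  refine Finset.sum_congr rfl fun σ _ => ?_
  rw [Finsupp.smul_apply, Finsupp.single_apply]
  simp [graph_injective.eq_iff]

theorem signedSum_apply_places (σ : Perm (Fin (k + 1))) :
    signedSum e b (graph e (places b σ)) = Perm.sign σ := by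
  simp [signedSum_apply, places_injective.eq_iff]

/-- Exchanging the letter i with ∞ fixes the ridge that omits the row of i and reverses signs, so
each coefficient of the boundary equals its own negative. -/
theorem signedSum_mem_cycles {A : Finset (Fin m)} {B : Finset (Fin n)} (hA : univ.image e = A)
    (hB : univ.image b = B) : signedSum e b ∈ cycles (chessboard A B) k := by
  have hc : signedSum e b ∈ chains (chessboard A B) k := by
    refine Submodule.sum_mem _ fun σ _ => Submodule.smul_mem _ _ ?_
    have := single_mem_chains (graph_places_mem hA hB σ) 1
    rwa [card_graph] at this
  refine ⟨hc, (boundary_eq_zero_iff hA hc).2 fun φ i => ?_⟩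
  simp only [signedSum_apply]
  rw [Finset.sum_comm]
  have hin : ∀ σ : Perm (Fin (k + 1)),
      (∑ c, if places b σ = Function.update φ i c then (Perm.sign σ : ℤ) else 0) =
        if ∀ j ≠ i, places b σ j = φ j then (Perm.sign σ : ℤ) else 0 := by
    intro σ
    split_ifs with h
    · rw [Finset.sum_eq_single (places b σ i), if_pos]
      · exact Function.eq_update_iff.2 ⟨rfl, h⟩
      · intro c _ hc
        rw [if_neg]
        intro h'
        exact hc ((Function.eq_update_iff.1 h').1).symm
      · intro h; exact absurd (Finset.mem_univ _) h
    · refine Finset.sum_eq_zero fun c _ => if_neg fun h' => h (Function.eq_update_iff.1 h').2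
  simp only [hin]
  have hself : ∀ x : ℤ, x = -x → x = 0 := by omega
  apply hself
  rw [← Finset.sum_neg_distrib]
  refine Fintype.sum_equiv (Equiv.mulLeft (swap i.castSucc (Fin.last k))) _ _ fun σ => ?_
  rw [Equiv.coe_mulLeft, places_swap_mul, Perm.sign_mul,
    Perm.sign_swap (Fin.castSucc_lt_last i).ne]
  have : (∀ j ≠ i, Function.update (places b σ) i (b (σ.symm (Fin.last k))) j = φ j) ↔
      ∀ j ≠ i, places b σ j = φ j :=
    forall₂_congr fun j hj => by rw [Function.update_of_ne hj]
  simp only [this]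
  split_ifs <;> simp

theorem isFundamentalCycle_aux {A : Finset (Fin m)} {B : Finset (Fin n)} (hA : univ.image e = A)
    (hB : univ.image b = B) : IsFundamentalCycle (chessboard A B) k (signedSum e b) := by
  have hAc : A.card ≤ k := by
    rw [← hA, Finset.card_image_of_injective _ e.injective]; simp
  refine ⟨signedSum_mem_cycles hA hB, fun x => ?_⟩
  have hiff : ∀ c : ℤ, x = c • homologyClass _ k _ (signedSum_mem_cycles hA hB) ↔
      ((topHomologyEquiv hAc x : cycles (chessboard A B) k) : Chain (Square m n)) =
        c • signedSum e b := by
    intro c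
    rw [← (topHomologyEquiv hAc).injective.eq_iff, map_smul, topHomologyEquiv_homologyClass,
      ← Subtype.coe_injective.eq_iff]
    rfl
  simp only [hiff]
  obtain ⟨z, hz⟩ := topHomologyEquiv hAc x
  -- The multiple is read off at the identity word, where the fundamental cycle has coefficient 1.
  refine ⟨z (graph e (places b 1)), ?_, ?_⟩
  · ext s
    by_cases hs : s ∈ augFaces (chessboard A B) ∧ s.card = k
    · obtain ⟨σ, rfl⟩ := exists_eq_graph_places hA hB hs.1 hs.2
      rw [Finsupp.smul_apply, signedSum_apply_places]
      simp only [coeff_sign hA hB hz σ, smul_eq_mul, mul_comm]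
    · have h0 : ∀ y ∈ cycles (chessboard A B) k, y s = 0 := by
        intro y hy
        by_contra hne
        exact hs (mem_chains_iff.1 hy.1 s hne)
      rw [Finsupp.smul_apply, h0 _ (signedSum_mem_cycles hA hB), h0 z hz, smul_zero]
  · intro c hc
    have := DFunLike.congr_fun hc (graph e (places b 1))
    rw [Finsupp.smul_apply, signedSum_apply_places] at this
    simpa using this.symm

theorem image_orderEmbOfFin_univ {N d : ℕ} (s : Finset (Fin N)) (h : s.card = d) :
    univ.image (s.orderEmbOfFin h) = s := by
  simp

variable {A : Finset (Fin m)} {B : Finset (Fin n)}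

theorem isPseudomanifold_chessboard (h : B.card = A.card + 1) :
    IsPseudomanifold (chessboard A B) A.card :=
  isPseudomanifold_aux (image_orderEmbOfFin_univ A rfl) (image_orderEmbOfFin_univ B h)

theorem isFundamentalCycle_rho (h : B.card = A.card + 1) :
    IsFundamentalCycle (chessboard A B) A.card (rho A B) := by
  rw [rho_eq_signedSum h]
  exact isFundamentalCycle_aux (image_orderEmbOfFin_univ A rfl) (image_orderEmbOfFin_univ B h)

theorem rho_mem_cycles (h : B.card = A.card + 1) :
    rho A B ∈ cycles (chessboard A B) A.card :=
  (isFundamentalCycle_rho h).1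

theorem rho_apply_sq {s : Finset (Square m n)} (h : B.card = A.card + 1)
    (hs : s ∈ augFaces (chessboard A B)) (hk : s.card = A.card) :
    rho A B s * rho A B s = 1 := by
  rw [rho_eq_signedSum h]
  obtain ⟨σ, rfl⟩ := exists_eq_graph_places (image_orderEmbOfFin_univ A rfl)
    (image_orderEmbOfFin_univ B h) hs hk
  rw [signedSum_apply_places, ← Units.val_mul, Int.units_mul_self, Units.val_one]

end FundamentalCycles

/-! ### Rows as lists read with a default entry. -/

section Rows

variable {α : Type*} {d : α}

theorem getD_set_self {l : List α} {c : ℕ} (h : c < l.length) (y : α) :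
    (l.set c y).getD c d = y := by
  simp [List.getD_eq_getElem?_getD, h]

theorem getD_set_ne (l : List α) {c j : ℕ} (h : j ≠ c) (y : α) :
    (l.set c y).getD j d = l.getD j d := by
  simp [List.getD_eq_getElem?_getD, List.getElem?_set_ne h.symm]

theorem set_getD_self (l : List α) (c : ℕ) : l.set c (l.getD c d) = l := by
  by_cases h : c < l.length
  · rw [List.getD_eq_getElem _ _ h, List.set_getElem_self]
  · rw [List.set_eq_of_length_le (not_lt.1 h)]

theorem getD_concat_length (l : List α) (x : α) : (l ++ [x]).getD l.length d = x := by
  simp [List.getD_eq_getElem?_getD]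

theorem getD_dropLast {l : List α} {j : ℕ} (h : j < l.length - 1) :
    l.dropLast.getD j d = l.getD j d := by
  rw [List.getD_eq_getElem?_getD, List.getD_eq_getElem?_getD, List.getElem?_dropLast, if_pos h]

theorem concat_dropLast {l : List α} (h : 0 < l.length) :
    l.dropLast ++ [l.getD (l.length - 1) d] = l := by
  have hne : l ≠ [] := List.length_pos_iff.1 h
  have : l.getD (l.length - 1) d = l.getLast hne := by
    rw [List.getLast_eq_getElem, List.getD_eq_getElem]
  rw [this, List.dropLast_append_getLast]

theorem getLastD_eq_getD (l : List α) : l.getLastD d = l.getD (l.length - 1) d := by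
  rw [List.getLastD_eq_getLast?, List.getLast?_eq_getElem?, List.getD_eq_getElem?_getD]

theorem length_takeWhile_le (p : α → Bool) (l : List α) : (l.takeWhile p).length ≤ l.length :=
  (List.takeWhile_prefix p).length_le

theorem getD_of_lt_takeWhile {p : α → Bool} {l : List α} {j : ℕ}
    (h : j < (l.takeWhile p).length) : p (l.getD j d) = true := by
  induction l generalizing j with
  | nil => simp at h
  | cons x l ih =>
    by_cases hx : p x
    · rw [List.takeWhile_cons_of_pos hx] at h
      cases j with
      | zero => simpa using hx
      | succ j => simpa using ih (by simpa using h)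
    · rw [List.takeWhile_cons_of_neg hx] at h
      simp at h

theorem getD_length_takeWhile {p : α → Bool} {l : List α}
    (h : (l.takeWhile p).length < l.length) :
    p (l.getD (l.takeWhile p).length d) = false := by
  induction l with
  | nil => simp at h
  | cons x l ih =>
    by_cases hx : p x
    · rw [List.takeWhile_cons_of_pos hx] at h ⊢
      simpa using ih (by simpa using h)
    · rw [List.takeWhile_cons_of_neg hx]
      simpa using hx

theorem length_takeWhile_eq {p : α → Bool} {l : List α} {t : ℕ} (ht : t ≤ l.length)
    (h1 : ∀ j < t, p (l.getD j d) = true) (h2 : t < l.length → p (l.getD t d) = false) :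
    (l.takeWhile p).length = t := by
  apply le_antisymm
  · by_contra! h
    have := h2 (h.trans_le (length_takeWhile_le p l))
    rw [getD_of_lt_takeWhile h] at this
    cases this
  · by_contra! h
    have := getD_length_takeWhile (d := d) (h.trans_le ht)
    rw [h1 _ h] at this
    cases this

end Rows

/-! ### Row insertion, reverse insertion, and their inversion. -/

section Insertion

variable {m : ℕ}

/-- Row insertion: the letter `x` replaces the leftmost larger entry of the top row, which is
inserted into the next row in the same way, or is put at the end of the row.  The value consists of
the new rows and the row of the new cell. -/
def insertLetter : List (List (Letter m)) → Letter m → List (List (Letter m)) × ℕ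
  | [], _ => ([], 0)
  | row :: rows, x =>
    let c := (row.takeWhile (· ≤ x)).length
    if c = row.length then ((row ++ [x]) :: rows, 0)
    else
      let below := insertLetter rows (row.getD c ⊤)
      (row.set c x :: below.1, below.2 + 1)

/-- The column of the top row into which `x` is inserted. -/
def insertColumn (P : List (List (Letter m))) (x : Letter m) : ℕ :=
  ((P.headD []).takeWhile (· ≤ x)).length

theorem insertLetter_concat {row : List (Letter m)} {rows : List (List (Letter m))}
    {x : Letter m} (h : (row.takeWhile (· ≤ x)).length = row.length) :
    insertLetter (row :: rows) x = ((row ++ [x]) :: rows, 0) := by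
  rw [insertLetter]
  exact if_pos h

theorem insertLetter_bump {row : List (Letter m)} {rows : List (List (Letter m))} {x : Letter m}
    {c : ℕ} (hc : (row.takeWhile (· ≤ x)).length = c) (h : c < row.length) :
    insertLetter (row :: rows) x =
      (row.set c x :: (insertLetter rows (row.getD c ⊤)).1,
        (insertLetter rows (row.getD c ⊤)).2 + 1) := by
  subst hc
  rw [insertLetter]
  exact if_neg h.ne

theorem insertColumn_le (P : List (List (Letter m))) (x : Letter m) :
    insertColumn P x ≤ (P.headD []).length :=
  length_takeWhile_le _ _

theorem getD_le_of_lt_insertColumn {P : List (List (Letter m))} {x : Letter m} {j : ℕ}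
    (h : j < insertColumn P x) : (P.headD []).getD j ⊤ ≤ x := by
  simpa using getD_of_lt_takeWhile (d := (⊤ : Letter m)) h

theorem lt_getD_insertColumn {P : List (List (Letter m))} {x : Letter m}
    (h : insertColumn P x < (P.headD []).length) : x < (P.headD []).getD (insertColumn P x) ⊤ := by
  have := getD_length_takeWhile (d := (⊤ : Letter m)) h
  rwa [decide_eq_false_iff_not, not_le] at this

/-- The effect of an insertion on the top row. -/
theorem headD_insertLetter {P : List (List (Letter m))} (hP : P ≠ []) (x : Letter m) :
    (insertLetter P x).1.headD [] = if insertColumn P x = (P.headD []).length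
      then P.headD [] ++ [x] else (P.headD []).set (insertColumn P x) x := by
  cases P with
  | nil => exact absurd rfl hP
  | cons row rows =>
    rcases (length_takeWhile_le (· ≤ x) row).lt_or_eq with h | h
    · rw [insertLetter_bump rfl h]
      exact (if_neg h.ne).symm
    · rw [insertLetter_concat h]
      exact (if_pos h).symm

theorem headD_insertLetter_getD_self {P : List (List (Letter m))} (hP : P ≠ [])
    (x : Letter m) :
    ((insertLetter P x).1.headD []).getD (insertColumn P x) ⊤ = x := by
  rw [headD_insertLetter hP]
  split_ifs with h
  · rw [h, getD_concat_length]
  · exact getD_set_self (lt_of_le_of_ne (insertColumn_le P x) h) x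

theorem headD_insertLetter_getD_ne {P : List (List (Letter m))} (hP : P ≠ [])
    (x : Letter m) {j : ℕ} (hj : j ≠ insertColumn P x) :
    ((insertLetter P x).1.headD []).getD j ⊤ = (P.headD []).getD j ⊤ := by
  rw [headD_insertLetter hP]
  split_ifs with h
  · rw [h] at hj
    rcases lt_or_gt_of_ne hj with h1 | h1
    · rw [List.getD_append _ _ _ _ h1]
    · rw [List.getD_eq_default _ _ h1.le, List.getD_eq_default]
      simpa using h1
  · exact getD_set_ne _ hj x

theorem insertColumn_lt_length {P : List (List (Letter m))} (hP : P ≠ [])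
    (x : Letter m) :
    insertColumn P x < ((insertLetter P x).1.headD []).length := by
  rw [headD_insertLetter hP]
  split_ifs with h
  · simp [h]
  · rw [List.length_set]
    exact lt_of_le_of_ne (insertColumn_le P x) h

theorem length_headD_le_insertLetter {P : List (List (Letter m))} (hP : P ≠ [])
    (x : Letter m) :
    (P.headD []).length ≤ ((insertLetter P x).1.headD []).length := by
  rw [headD_insertLetter hP]
  split_ifs <;> simp

theorem lt_length_of_lt_insertLetter {P : List (List (Letter m))} (hP : P ≠ [])
    (x : Letter m) {j : ℕ} (hj : j ≠ insertColumn P x)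
    (h : j < ((insertLetter P x).1.headD []).length) : j < (P.headD []).length := by
  rw [headD_insertLetter hP] at h
  split_ifs at h with h1
  · rw [List.length_append, List.length_singleton] at h
    omega
  · simpa using h

/-- The entries of the first row are smaller than the entries below them. -/
def Dominates (r s : List (Letter m)) : Prop :=
  s.length ≤ r.length ∧ ∀ j < s.length, r.getD j ⊤ < s.getD j ⊤

/-- Lists of rows that form a semistandard tableau. -/
def IsSemistandard : List (List (Letter m)) → Prop
  | [] => True
  | row :: rows =>
    (Monotone fun j => row.getD j ⊤) ∧ Dominates row (rows.headD []) ∧ IsSemistandard rows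

theorem headD_eq_getD (P : List (List (Letter m))) : P.headD [] = P.getD 0 [] := by
  cases P <;> rfl

theorem isSemistandard_iff {P : List (List (Letter m))} :
    IsSemistandard P ↔ ∀ i, (Monotone fun j => (P.getD i []).getD j ⊤) ∧
      Dominates (P.getD i []) (P.getD (i + 1) []) := by
  induction P with
  | nil => simp [IsSemistandard, Dominates, monotone_const]
  | cons row rows ih =>
    rw [IsSemistandard, ih]
    constructor
    · rintro ⟨h1, h2, h3⟩ i
      cases i with
      | zero =>
        exact ⟨h1, by simpa only [List.getD_cons_zero, List.getD_cons_succ, headD_eq_getD] using h2⟩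
      | succ i => simpa only [List.getD_cons_succ] using h3 i
    · intro h
      refine ⟨(h 0).1, ?_, fun i => by simpa only [List.getD_cons_succ] using h (i + 1)⟩
      simpa only [List.getD_cons_zero, List.getD_cons_succ, headD_eq_getD] using (h 0).2

theorem IsSemistandard.monotone_headD {P : List (List (Letter m))} (h : IsSemistandard P) :
    Monotone fun j => (P.headD []).getD j ⊤ := by
  rw [headD_eq_getD]
  exact (isSemistandard_iff.1 h 0).1

theorem monotone_set {row : List (Letter m)} (h : Monotone fun j => row.getD j ⊤) {c : ℕ}
    (hc : c < row.length) {y : Letter m} (h1 : ∀ j < c, row.getD j ⊤ ≤ y)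
    (h2 : ∀ j > c, y ≤ row.getD j ⊤) : Monotone fun j => (row.set c y).getD j ⊤ := by
  intro i j hij
  dsimp only
  by_cases hi : i = c <;> by_cases hj : j = c
  · rw [hi, hj]
  · rw [hi, getD_set_self hc, getD_set_ne _ hj]
    exact h2 j (by omega)
  · rw [hj, getD_set_self hc, getD_set_ne _ hi]
    exact h1 i (by omega)
  · rw [getD_set_ne _ hi, getD_set_ne _ hj]
    exact h hij

theorem monotone_concat {row : List (Letter m)} (h : Monotone fun j => row.getD j ⊤)
    {x : Letter m} (h1 : ∀ j < row.length, row.getD j ⊤ ≤ x) :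
    Monotone fun j => (row ++ [x]).getD j ⊤ := by
  intro i j hij
  dsimp only
  rcases lt_trichotomy j row.length with hj | hj | hj
  · rw [List.getD_append _ _ _ _ hj, List.getD_append _ _ _ _ (hij.trans_lt hj)]
    exact h hij
  · rw [hj, getD_concat_length]
    rcases hij.lt_or_eq with hi | hi
    · rw [List.getD_append _ _ _ _ (hj ▸ hi)]
      exact h1 i (hj ▸ hi)
    · rw [hi, hj, getD_concat_length]
  · rw [List.getD_eq_default (n := j)]
    · exact le_top
    · simpa using hj

theorem monotone_dropLast {row : List (Letter m)} (h : Monotone fun j => row.getD j ⊤) :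
    Monotone fun j => row.dropLast.getD j ⊤ := by
  intro i j hij
  dsimp only
  by_cases hj : j < row.length - 1
  · rw [getD_dropLast hj, getD_dropLast (by omega)]
    exact h hij
  · rw [List.getD_eq_default (n := j)]
    · exact le_top
    · rw [List.length_dropLast]; omega

/-- Bumping stops at an empty row at the latest. Otherwise a letter falling past the last row would
be lost, which is why tableaux are kept with spare empty rows. -/
theorem insertLetter_snd_lt {P : List (List (Letter m))} (h : [] ∈ P) (x : Letter m) :
    (insertLetter P x).2 < P.length := by
  induction P generalizing x with
  | nil => simp at h
  | cons row rows ih =>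
    rcases (length_takeWhile_le (· ≤ x) row).lt_or_eq with h1 | h1
    · rw [insertLetter_bump rfl h1]
      have hne : [] ≠ row := by
        rintro rfl
        simp at h1
      have := ih ((List.mem_cons.1 h).resolve_left hne) (row.getD (row.takeWhile (· ≤ x)).length ⊤)
      simpa using this
    · rw [insertLetter_concat h1]
      simp

theorem length_insertLetter (P : List (List (Letter m))) (x : Letter m) :
    (insertLetter P x).1.length = P.length := by
  induction P generalizing x with
  | nil => rfl
  | cons row rows ih =>
    rcases (length_takeWhile_le (· ≤ x) row).lt_or_eq with h1 | h1
    · rw [insertLetter_bump rfl h1]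
      simp [ih]
    · rw [insertLetter_concat h1]
      simp

theorem length_getD_insertLetter {P : List (List (Letter m))} {x : Letter m}
    (h : (insertLetter P x).2 < P.length) (i : ℕ) :
    ((insertLetter P x).1.getD i []).length =
      (P.getD i []).length + if i = (insertLetter P x).2 then 1 else 0 := by
  induction P generalizing x i with
  | nil => simp at h
  | cons row rows ih =>
    rcases (length_takeWhile_le (· ≤ x) row).lt_or_eq with h1 | h1
    · rw [insertLetter_bump rfl h1] at h ⊢
      cases i with
      | zero => simp
      | succ i =>
        simp only [List.length_cons, add_lt_add_iff_right] at h
        simpa only [List.getD_cons_succ, add_left_inj] using ih h i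
    · rw [insertLetter_concat h1]
      cases i with
      | zero => simp
      | succ i => simp

/-- The sum of the values of `g` at all entries. -/
def entrySum (g : Letter m → ℕ) (P : List (List (Letter m))) : ℕ :=
  (P.map fun row => (row.map g).sum).sum

/-- With g constant this counts cells, and with g an indicator it tracks the multiset of entries. -/
theorem entrySum_insertLetter (g : Letter m → ℕ) {P : List (List (Letter m))} {x : Letter m}
    (h : (insertLetter P x).2 < P.length) :
    entrySum g (insertLetter P x).1 = entrySum g P + g x := by
  induction P generalizing x with
  | nil => simp at h
  | cons row rows ih =>
    have hset : ∀ (l : List (Letter m)) (c : ℕ), c < l.length →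
        ((l.set c x).map g).sum + g (l.getD c ⊤) = (l.map g).sum + g x := by
      intro l
      induction l with
      | nil => intro c hc; simp at hc
      | cons y l ih =>
        intro c hc
        cases c with
        | zero => simp; ring
        | succ c =>
          have := ih c (by simpa using hc)
          simp only [List.set_cons_succ, List.map_cons, List.sum_cons, List.getD_cons_succ]
          omega
    rcases (length_takeWhile_le (· ≤ x) row).lt_or_eq with h1 | h1
    · rw [insertLetter_bump rfl h1] at h ⊢
      simp only [List.length_cons, add_lt_add_iff_right] at h
      have h2 := ih h
      have h3 := hset row _ h1
      simp only [entrySum, List.map_cons, List.sum_cons] at h2 ⊢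
      omega
    · rw [insertLetter_concat h1]
      simp only [entrySum, List.map_cons, List.sum_cons, List.map_append, List.sum_append,
        List.map_nil, List.sum_nil]
      omega

/-- The bumped letter enters the next row weakly to the left of the column it left, which keeps
columns strict. It also allows reverse insertion to find the same column again. -/
theorem isSemistandard_insertLetter {P : List (List (Letter m))} (hP : IsSemistandard P)
    {x : Letter m} (h : (insertLetter P x).2 < P.length) :
    IsSemistandard (insertLetter P x).1 ∧
      reverseInsert (insertLetter P x).1 (insertLetter P x).2 = ((x, insertColumn P x), P) := by
  induction P generalizing x with
  | nil => simp at h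
  | cons row rows ih =>
    obtain ⟨hmono, hdom, hss⟩ := hP
    have hcol : insertColumn (row :: rows) x = (row.takeWhile (· ≤ x)).length := rfl
    rcases (length_takeWhile_le (· ≤ x) row).lt_or_eq with h1 | h1
    · rw [insertLetter_bump rfl h1] at h ⊢
      rw [hcol]
      set c := (row.takeWhile (· ≤ x)).length with hc
      set y := row.getD c ⊤ with hy
      simp only [List.length_cons, add_lt_add_iff_right] at h
      have hlt : ∀ j < c, row.getD j ⊤ ≤ x := fun j hj =>
        getD_le_of_lt_insertColumn (P := row :: rows) hj
      have hxy : x < y := lt_getD_insertColumn (P := row :: rows) h1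
      have hge : ∀ j > c, x ≤ row.getD j ⊤ := fun j hj => hxy.le.trans (hmono hj.le)
      obtain ⟨ih1, ih2⟩ := ih hss h
      have hne : rows ≠ [] := by
        rintro rfl
        simp at h
      -- The entry below the bumped y already exceeds y, so y cannot pass its column.
      have hcc : insertColumn rows y ≤ c := by
        by_contra! hcon
        have h2 := getD_le_of_lt_insertColumn hcon
        have h3 := hdom.2 c (hcon.trans_le (insertColumn_le _ _))
        exact absurd (h3.trans_le h2) (lt_irrefl _)
      have hrow' : ∀ j, (row.set c x).getD j ⊤ ≤ row.getD j ⊤ := by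
        intro j
        by_cases hj : j = c
        · rw [hj, getD_set_self h1]; exact hxy.le
        · rw [getD_set_ne _ hj]
      refine ⟨⟨monotone_set hmono h1 hlt hge, ⟨?_, ?_⟩, ih1⟩, ?_⟩
      · rw [List.length_set]
        by_contra! hcon
        have h2 := lt_length_of_lt_insertLetter hne y (by omega) hcon
        have h3 := hdom.1
        omega
      · intro j hj
        by_cases hjc : j = insertColumn rows y
        · rw [hjc, headD_insertLetter_getD_self hne]
          rcases hcc.lt_or_eq with h2 | h2
          · rw [getD_set_ne _ h2.ne]
            exact (hlt _ h2).trans_lt hxy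
          · rw [h2, getD_set_self h1]
            exact hxy
        · rw [headD_insertLetter_getD_ne hne _ hjc]
          exact (hrow' j).trans_lt (hdom.2 j (lt_length_of_lt_insertLetter hne y hjc hj))
      -- After the replacement, c is the last column whose entry is smaller than y, so reverse
      -- insertion takes x back out of it.
      · have htake : ((row.set c x).takeWhile (· < y)).length = c + 1 := by
          refine length_takeWhile_eq (d := ⊤) (by rw [List.length_set]; omega) ?_ ?_
          · intro j hj
            rw [decide_eq_true_iff]
            by_cases hjc : j = c
            · rw [hjc, getD_set_self h1]; exact hxy
            · rw [getD_set_ne _ hjc]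
              exact (hlt j (by omega)).trans_lt hxy
          · intro _
            rw [decide_eq_false_iff_not, not_lt, getD_set_ne _ (by omega)]
            exact hmono (Nat.le_succ c)
        simp only [reverseInsert, ih2, htake, Nat.add_sub_cancel, getD_set_self h1, List.set_set]
        rw [set_getD_self]
    · rw [insertLetter_concat h1, hcol]
      refine ⟨⟨monotone_concat hmono fun j hj =>
        getD_le_of_lt_insertColumn (P := row :: rows) (by rw [hcol, h1]; exact hj),
        ⟨?_, ?_⟩, hss⟩, ?_⟩
      · rw [List.length_append]
        exact hdom.1.trans (Nat.le_add_right _ _)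
      · intro j hj
        rw [List.getD_append _ _ _ _ (hj.trans_le hdom.1)]
        exact hdom.2 j hj
      · simp [reverseInsert, h1]

theorem length_reverseInsert (P : List (List (Letter m))) (r : ℕ) :
    (reverseInsert P r).2.length = P.length := by
  induction P generalizing r with
  | nil => cases r <;> rfl
  | cons row rows ih => cases r <;> simp [reverseInsert, ih]

/-- Spare rows below the starting row are not touched, so the tableau may be padded. -/
theorem reverseInsert_append {P : List (List (Letter m))} {r : ℕ} (h : r < P.length)
    (Z : List (List (Letter m))) :
    reverseInsert (P ++ Z) r = ((reverseInsert P r).1, (reverseInsert P r).2 ++ Z) := by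
  induction P generalizing r with
  | nil => simp at h
  | cons row rows ih =>
    cases r with
    | zero => rfl
    | succ r =>
      have := ih (r := r) (by simpa using h)
      simp [reverseInsert, this]

/-- Reverse insertion at the end of the row of a corner is undone by insertion. -/
theorem insertLetter_reverseInsert {P : List (List (Letter m))} (hP : IsSemistandard P) {r : ℕ}
    (hr : r < P.length) (hcorner : (P.getD (r + 1) []).length < (P.getD r []).length) :
    IsSemistandard (reverseInsert P r).2 ∧
      insertLetter (reverseInsert P r).2 (reverseInsert P r).1.1 = (P, r) ∧
      insertColumn (reverseInsert P r).2 (reverseInsert P r).1.1 = (reverseInsert P r).1.2 := by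
  induction P generalizing r with
  | nil => simp at hr
  | cons row rows ih =>
    obtain ⟨hmono, hdom, hss⟩ := hP
    cases r with
    | zero =>
      rw [List.getD_cons_succ, List.getD_cons_zero, ← headD_eq_getD] at hcorner
      have hpos : 0 < row.length := by omega
      have htake : (row.dropLast.takeWhile (· ≤ row.getLastD ⊤)).length = row.length - 1 := by
        refine length_takeWhile_eq (d := ⊤) (by simp) ?_ ?_
        · intro j hj
          rw [decide_eq_true_iff, getD_dropLast hj, getLastD_eq_getD]
          exact hmono (by omega)
        · intro h
          simp at h
      refine ⟨⟨monotone_dropLast hmono, ⟨?_, ?_⟩, hss⟩, ?_, htake⟩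
      · rw [List.length_dropLast]; omega
      · intro j hj
        rw [getD_dropLast (by omega)]
        exact hdom.2 j hj
      · rw [reverseInsert]
        rw [insertLetter_concat (by rw [htake, List.length_dropLast]), getLastD_eq_getD,
          concat_dropLast hpos]
    | succ r =>
      have hr' : r < rows.length := by simpa using hr
      obtain ⟨ih1, ih2, ih3⟩ := ih hss hr' (by simpa only [List.getD_cons_succ] using hcorner)
      rw [reverseInsert]
      have hlen := length_reverseInsert rows r
      generalize hb : reverseInsert rows r = below at ih1 ih2 ih3 hlen
      obtain ⟨⟨y, c₁⟩, rows'⟩ := below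
      dsimp only at ih1 ih2 ih3 hlen ⊢
      have hne : rows' ≠ [] := by
        rintro rfl
        rw [← hlen] at hr'
        simp at hr'
      set t := (row.takeWhile (· < y)).length with ht
      have hself := headD_insertLetter_getD_self hne y
      have hother := fun j => headD_insertLetter_getD_ne hne y (j := j)
      have hlt := insertColumn_lt_length hne y
      have hle := length_headD_le_insertLetter hne y
      have hgt := lt_getD_insertColumn (P := rows') (x := y)
      rw [ih2] at hself hother hlt hle
      rw [ih3] at hself hother hlt hgt
      dsimp only at hself hother hlt hle
      have hc₁ : row.getD c₁ ⊤ < y := hself ▸ hdom.2 c₁ hlt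
      have htl : t ≤ row.length := length_takeWhile_le _ _
      have hty : ∀ j ≥ t, y ≤ row.getD j ⊤ := by
        intro j hj
        refine le_trans ?_ (hmono hj)
        rcases htl.lt_or_eq with h | h
        · simpa using getD_length_takeWhile (d := (⊤ : Letter m)) h
        · dsimp only
          rw [List.getD_eq_default _ _ h.ge]
          exact le_top
      have hyt : ∀ j < t, row.getD j ⊤ < y := by
        intro j hj
        simpa using getD_of_lt_takeWhile (d := (⊤ : Letter m)) hj
      -- The letter y leaves the column c₁ below, and the entry above it is smaller. So some entry
      -- of this row is smaller than y, and t - 1 is a true column, weakly to the right of c₁.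
      have htc : c₁ < t := by
        by_contra! h
        exact absurd (hc₁.trans_le (hty _ h)) (lt_irrefl _)
      obtain ⟨c, hc⟩ : ∃ c, t = c + 1 := ⟨t - 1, by omega⟩
      rw [hc, Nat.add_sub_cancel]
      have hcl : c < row.length := by omega
      have hxy : row.getD c ⊤ < y := hyt c (by omega)
      have htake : ((row.set c y).takeWhile (· ≤ row.getD c ⊤)).length = c := by
        refine length_takeWhile_eq (d := ⊤) (by rw [List.length_set]; omega) ?_ ?_
        · intro j hj
          rw [decide_eq_true_iff, getD_set_ne _ hj.ne]
          exact hmono hj.le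
        · intro _
          rw [decide_eq_false_iff_not, not_le, getD_set_self hcl]
          exact hxy
      refine ⟨⟨monotone_set hmono hcl (fun j hj => (hyt j (by omega)).le)
        (fun j hj => hty j (by omega)), ⟨?_, ?_⟩, ih1⟩, ?_, htake⟩
      · rw [List.length_set]
        exact hle.trans hdom.1
      · intro j hj
        have hj' : j < (rows.headD []).length := hj.trans_le hle
        by_cases hjc : j = c
        · rw [hjc, getD_set_self hcl]
          -- The row below now has an entry larger than y in the column c₁ ≤ c, hence also in the
          -- column c.
          exact (hgt (by omega)).trans_le (ih1.monotone_headD (by omega))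
        · rw [getD_set_ne _ hjc]
          by_cases hj1 : j = c₁
          · rw [hj1] at hj ⊢
            exact hc₁.trans (hgt hj)
          · rw [← hother j hj1]
            exact hdom.2 j hj'
      · rw [insertLetter_bump htake (by rw [List.length_set]; exact hcl), getD_set_self hcl, ih2,
          List.set_set, set_getD_self]

end Insertion

/-! ### Labels before a given stage. -/

section Before

variable {n : ℕ}

/-- The labels that precede the stage `k`. -/
def before (k : Fin (n + 1)) : Finset (Fin n) := univ.filter fun l => l.castSucc < k

theorem mem_before {k : Fin (n + 1)} {l : Fin n} : l ∈ before k ↔ l.castSucc < k := by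
  simp [before]

theorem before_zero : before (0 : Fin (n + 1)) = ∅ := by
  ext l; simp [before]

theorem before_last : before (Fin.last n) = univ := by
  ext l; simp [before, Fin.castSucc_lt_last]

theorem before_succ (k : Fin n) : before k.succ = insert k (before k.castSucc) := by
  ext l
  rw [mem_before, Finset.mem_insert, mem_before, Fin.castSucc_lt_succ_iff,
    Fin.castSucc_lt_castSucc_iff, le_iff_eq_or_lt]

theorem notMem_before (k : Fin n) : k ∉ before k.castSucc := by
  simp [mem_before]

theorem card_filter_before_succ (r : Fin n → ℕ) (k : Fin n) (i : ℕ) :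
    ((before k.succ).filter (r · = i)).card =
      ((before k.castSucc).filter (r · = i)).card + if i = r k then 1 else 0 := by
  rw [before_succ, Finset.filter_insert]
  split_ifs with h1 h2 h2
  · rw [Finset.card_insert_of_notMem fun h => notMem_before k (Finset.mem_filter.1 h).1]
  · exact absurd h1.symm h2
  · exact absurd h2.symm h1
  · rfl

end Before

/-! ### Runs of Robinson–Schensted insertion. -/

section Runs

variable {m n : ℕ}

/-- The stages `P` of the Robinson–Schensted insertion of the word `w`, where `r` records the rows
of the new cells. -/
structure IsRun (w : Fin n → Letter m) (P : Fin (n + 1) → List (List (Letter m)))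
    (r : Fin n → ℕ) : Prop where
  zero : P 0 = List.replicate n []
  step : ∀ k, insertLetter (P k.castSucc) (w k) = (P k.succ, r k)

theorem exists_isRun (w : Fin n → Letter m) : ∃ P r, IsRun w P r :=
  ⟨Fin.induction (List.replicate n []) fun k Q => (insertLetter Q (w k)).1, _, by simp,
    fun k => by rw [Fin.induction_succ]⟩

theorem IsRun.unique {w : Fin n → Letter m} {P P' : Fin (n + 1) → List (List (Letter m))}
    {r r' : Fin n → ℕ} (h : IsRun w P r) (h' : IsRun w P' r') : P = P' ∧ r = r' := by
  have hP : ∀ k, P k = P' k := by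
    intro k
    induction k using Fin.induction with
    | zero => rw [h.zero, h'.zero]
    | succ k ih =>
      have h1 := h.step k
      rw [ih, h'.step k] at h1
      exact (Prod.ext_iff.1 h1).1.symm
  refine ⟨funext hP, funext fun k => ?_⟩
  have h1 := h.step k
  rw [hP, h'.step k] at h1
  exact (Prod.ext_iff.1 h1).2.symm

theorem nil_mem_of_entrySum_lt {P : List (List (Letter m))}
    (h : entrySum (fun _ => 1) P < P.length) : [] ∈ P := by
  induction P with
  | nil => simp at h
  | cons row rows ih =>
    rcases row with _ | ⟨x, row⟩
    · simp
    · refine List.mem_cons_of_mem _ (ih ?_)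
      simp [entrySum] at h ⊢
      omega

namespace IsRun

variable {w : Fin n → Letter m} {P : Fin (n + 1) → List (List (Letter m))} {r : Fin n → ℕ}

theorem step_fst (h : IsRun w P r) (k : Fin n) :
    (insertLetter (P k.castSucc) (w k)).1 = P k.succ := by rw [h.step]

theorem step_snd (h : IsRun w P r) (k : Fin n) :
    (insertLetter (P k.castSucc) (w k)).2 = r k := by rw [h.step]

theorem length_eq (h : IsRun w P r) (k : Fin (n + 1)) : (P k).length = n := by
  induction k using Fin.induction with
  | zero => simp [h.zero]
  | succ k ih => rw [← h.step_fst, length_insertLetter, ih]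

/-- The claims are proved together: before a step fewer than n letters occupy the n rows, so an
empty row is left and the insertion does not run off the end, and then no letter is lost. The count
needs the constant g, hence the induction for all g at once. -/
theorem row_lt_and_entrySum (h : IsRun w P r) (g : Letter m → ℕ) (k : Fin (n + 1)) :
    (∀ l ∈ before k, r l < n) ∧ entrySum g (P k) = ∑ l ∈ before k, g (w l) := by
  induction k using Fin.induction generalizing g with
  | zero => simp [before_zero, h.zero, entrySum]
  | succ k ih =>
    have hr : r k < n := by
      rw [← h.step_snd]
      refine (insertLetter_snd_lt ?_ _).trans_eq (h.length_eq k.castSucc)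
      apply nil_mem_of_entrySum_lt
      rw [(ih _).2, h.length_eq]
      refine lt_of_le_of_lt ?_ k.2
      have : before k.castSucc ⊆ Finset.Iio k := fun l hl => by
        rw [mem_before] at hl
        exact Finset.mem_Iio.2 hl
      simpa using Finset.card_le_card this
    constructor
    · rw [before_succ]
      exact fun l hl => (Finset.mem_insert.1 hl).elim (fun h => h ▸ hr) ((ih g).1 l)
    · rw [← h.step_fst, entrySum_insertLetter, (ih g).2, before_succ,
        Finset.sum_insert (notMem_before k), add_comm]
      rw [h.step_snd, h.length_eq]
      exact hr

theorem row_lt (h : IsRun w P r) (k : Fin n) : r k < n :=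
  (h.row_lt_and_entrySum (fun _ => 0) (Fin.last n)).1 k (by simp [before_last])

theorem entrySum_last (h : IsRun w P r) (g : Letter m → ℕ) :
    entrySum g (P (Fin.last n)) = ∑ k, g (w k) := by
  rw [(h.row_lt_and_entrySum g _).2, before_last]

theorem snd_lt (h : IsRun w P r) (k : Fin n) :
    (insertLetter (P k.castSucc) (w k)).2 < (P k.castSucc).length := by
  rw [h.step_snd, h.length_eq]
  exact h.row_lt k

theorem isSemistandard (h : IsRun w P r) (k : Fin (n + 1)) : IsSemistandard (P k) := by
  induction k using Fin.induction with
  | zero =>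
    rw [h.zero, isSemistandard_iff]
    intro i
    have : ∀ i, (List.replicate n ([] : List (Letter m))).getD i [] = [] := by
      intro i
      rw [List.getD_eq_getElem?_getD, List.getElem?_replicate]
      split_ifs <;> rfl
    rw [this, this]
    exact ⟨fun _ _ _ => le_rfl, le_rfl, fun j hj => by simp at hj⟩
  | succ k ih =>
    rw [← h.step_fst]
    exact (isSemistandard_insertLetter ih (h.snd_lt k)).1

theorem reverseInsert_succ (h : IsRun w P r) (k : Fin n) :
    reverseInsert (P k.succ) (r k) = ((w k, insertColumn (P k.castSucc) (w k)), P k.castSucc) := by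
  have := (isSemistandard_insertLetter (h.isSemistandard k.castSucc) (h.snd_lt k)).2
  rwa [h.step_fst, h.step_snd] at this

theorem length_row_succ (h : IsRun w P r) (k : Fin n) (i : ℕ) :
    ((P k.succ).getD i []).length =
      ((P k.castSucc).getD i []).length + if i = r k then 1 else 0 := by
  have := length_getD_insertLetter (h.snd_lt k) i
  rwa [h.step_fst, h.step_snd] at this

theorem length_row (h : IsRun w P r) (k : Fin (n + 1)) (i : ℕ) :
    ((P k).getD i []).length = ((before k).filter (r · = i)).card := by
  induction k using Fin.induction with
  | zero => simp [h.zero, before_zero, List.getElem?_replicate]; split_ifs <;> rfl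
  | succ k ih => rw [h.length_row_succ, ih, card_filter_before_succ]

theorem ne_nil (h : IsRun w P r) (k : Fin n) : P k.castSucc ≠ [] := by
  intro h0
  have h1 := h.snd_lt k
  rw [h0] at h1
  simp at h1

/-- The letters that enter the top row in the same column decrease. -/
theorem lt_of_insertColumn_eq (h : IsRun w P r) {k l : Fin n} (hkl : k < l)
    (hc : insertColumn (P k.castSucc) (w k) = insertColumn (P l.castSucc) (w l)) :
    w l < w k := by
  -- Once filled, a cell of the top row changes only to smaller entries. A later letter entering the
  -- same column displaces a strictly larger one, which is at most `w k`.
  have key : ∀ j : Fin (n + 1), k.castSucc < j →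
      insertColumn (P k.castSucc) (w k) < ((P j).headD []).length ∧
        ((P j).headD []).getD (insertColumn (P k.castSucc) (w k)) ⊤ ≤ w k := by
    intro j
    induction j using Fin.induction with
    | zero => intro hj; exact absurd hj (Fin.not_lt_zero _)
    | succ j ih =>
      intro hj
      rw [Fin.castSucc_lt_succ_iff] at hj
      rw [← h.step_fst]
      rcases hj.eq_or_lt with rfl | hj
      · exact ⟨insertColumn_lt_length (h.ne_nil _) _,
          (headD_insertLetter_getD_self (h.ne_nil _) _).le⟩
      · obtain ⟨h1, h2⟩ := ih hj
        refine ⟨h1.trans_le (length_headD_le_insertLetter (h.ne_nil _) _), ?_⟩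
        by_cases hcol : insertColumn (P k.castSucc) (w k) = insertColumn (P j.castSucc) (w j)
        · rw [hcol] at h1 h2 ⊢
          rw [headD_insertLetter_getD_self (h.ne_nil _)]
          exact (lt_getD_insertColumn h1).le.trans h2
        · rw [headD_insertLetter_getD_ne (h.ne_nil _) _ hcol]
          exact h2
  obtain ⟨h1, h2⟩ := key l.castSucc hkl
  rw [hc] at h1 h2
  exact (lt_getD_insertColumn h1).trans_le h2

/-- Each cell of the top row ends a weakly increasing subword. -/
theorem exists_monotoneOn (h : IsRun w P r) (k : Fin (n + 1)) {j : ℕ}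
    (hj : j < ((P k).headD []).length) :
    ∃ K ⊆ before k, K.card = j + 1 ∧ MonotoneOn w K ∧
      ∀ l ∈ K, w l ≤ ((P k).headD []).getD j ⊤ := by
  induction k using Fin.induction generalizing j with
  | zero =>
    rw [h.zero, headD_eq_getD] at hj
    simp [List.getElem?_replicate] at hj
    split_ifs at hj <;> simp at hj
  | succ k ih =>
    rw [← h.step_fst] at hj ⊢
    have hsub : before k.castSucc ⊆ before k.succ := by
      rw [before_succ]; exact Finset.subset_insert _ _
    by_cases hjc : j = insertColumn (P k.castSucc) (w k)
    · rw [hjc, headD_insertLetter_getD_self (h.ne_nil _)]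
      rw [← hjc]
      rcases j with _ | j
      · exact ⟨{k}, by rw [before_succ]; simp, by simp, by simp, by simp⟩
      · have hle := insertColumn_le (P k.castSucc) (w k)
        -- The new letter is at least its left neighbour, so it extends the subword that ends there.
        obtain ⟨K, h1, h2, h3, h4⟩ := ih (j := j) (by omega)
        have hlast : ((P k.castSucc).headD []).getD j ⊤ ≤ w k :=
          getD_le_of_lt_insertColumn (by omega)
        have hk : k ∉ K := fun h => notMem_before k (h1 h)
        refine ⟨insert k K, ?_, ?_, ?_, ?_⟩
        · rw [before_succ]; exact Finset.insert_subset_insert _ h1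
        · rw [Finset.card_insert_of_notMem hk, h2]
        · intro a ha b hb hab
          rw [Finset.mem_coe, Finset.mem_insert] at ha hb
          rcases ha with rfl | ha <;> rcases hb with rfl | hb
          · exact le_rfl
          · exact absurd (mem_before.1 (h1 hb)) (not_lt.2 hab)
          · exact (h4 a ha).trans hlast
          · exact h3 ha hb hab
        · intro l hl
          rcases Finset.mem_insert.1 hl with rfl | hl
          · exact le_rfl
          · exact (h4 l hl).trans hlast
    · rw [headD_insertLetter_getD_ne (h.ne_nil _) _ hjc]
      obtain ⟨K, h1, h2⟩ := ih (lt_length_of_lt_insertLetter (h.ne_nil _) _ hjc hj)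
      exact ⟨K, h1.trans hsub, h2⟩

end IsRun

theorem sum_map_eq_sum_range (g : Letter m → ℕ) (row : List (Letter m)) :
    (row.map g).sum = ∑ j ∈ range row.length, g (row.getD j ⊤) := by
  induction row with
  | nil => simp
  | cons x row ih =>
    rw [List.length_cons, Finset.sum_range_succ', List.map_cons, List.sum_cons, ih, add_comm]
    simp only [List.getD_cons_succ, List.getD_cons_zero]

theorem entrySum_eq_sum_range (g : Letter m → ℕ) (P : List (List (Letter m))) :
    entrySum g P = ∑ i ∈ range P.length, ∑ j ∈ range (P.getD i []).length,
      g ((P.getD i []).getD j ⊤) := by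
  induction P with
  | nil => simp [entrySum]
  | cons row rows ih =>
    rw [List.length_cons, Finset.sum_range_succ']
    simp only [List.getD_cons_succ, List.getD_cons_zero]
    rw [← ih, ← sum_map_eq_sum_range, add_comm]
    simp [entrySum]

theorem entrySum_eq_sum_cells (g : Letter m → ℕ) {P : List (List (Letter m))} {μ : YoungDiagram}
    (h : ∀ i, (P.getD i []).length = μ.rowLen i) :
    entrySum g P = ∑ c ∈ μ.cells, g ((P.getD c.1 []).getD c.2 ⊤) := by
  rw [entrySum_eq_sum_range, eq_comm]
  refine Finset.sum_finset_product _ _ _ fun c => ?_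
  rw [YoungDiagram.mem_cells, Finset.mem_range, Finset.mem_range, h]
  rw [show c = (c.1, c.2) from rfl, YoungDiagram.mem_iff_lt_rowLen]
  refine ⟨fun hc => ⟨?_, hc⟩, fun hc => hc.2⟩
  by_contra! hlen
  have := h c.1
  rw [List.getD_eq_default _ _ hlen] at this
  simp only [List.length_nil] at this
  omega

end Runs

/-! ### Standard tableaux through the rows of their labels. -/

namespace StandardTableau

variable {μ : YoungDiagram} {N : ℕ} (T : StandardTableau μ N)

/-- The column of the cell with the label `k`. -/
def colOf (k : Fin N) : ℕ := (T.entry.symm k).1.2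

theorem rowOf_entry {i j : ℕ} (h : (i, j) ∈ μ) : T.rowOf (T.entry ⟨(i, j), h⟩) = i := by
  simp [rowOf]

theorem colOf_entry {i j : ℕ} (h : (i, j) ∈ μ) : T.colOf (T.entry ⟨(i, j), h⟩) = j := by
  simp [colOf]

theorem exists_entry_eq (k : Fin N) :
    ∃ h : (T.rowOf k, T.colOf k) ∈ μ, T.entry ⟨(T.rowOf k, T.colOf k), h⟩ = k :=
  ⟨(T.entry.symm k).2, T.entry.apply_symm_apply k⟩

theorem lt_iff_colOf_lt {k l : Fin N} (h : T.rowOf k = T.rowOf l) :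
    k < l ↔ T.colOf k < T.colOf l := by
  obtain ⟨hk, hk'⟩ := T.exists_entry_eq k
  obtain ⟨hl, hl'⟩ := T.exists_entry_eq l
  have key : ∀ {k l : Fin N}, T.rowOf k = T.rowOf l → T.colOf k < T.colOf l → k < l := by
    intro k l h hlt
    obtain ⟨hk, -⟩ := T.exists_entry_eq k
    obtain ⟨hl, hl'⟩ := T.exists_entry_eq l
    have hk2 : (T.rowOf l, T.colOf k) ∈ μ := h ▸ hk
    have := T.row_lt hk2 hl hlt
    rw [hl'] at this
    have he : T.entry ⟨(T.rowOf l, T.colOf k), hk2⟩ = k :=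
      T.entry.eq_symm_apply.1 (Subtype.ext (Prod.ext h.symm rfl))
    rwa [he] at this
  refine ⟨fun hkl => ?_, key h⟩
  by_contra! hge
  rcases hge.lt_or_eq with h1 | h1
  · exact absurd (key h.symm h1) (not_lt.2 hkl.le)
  · apply hkl.ne
    rw [← hk', ← hl']
    congr 2
    exact Prod.ext h h1.symm

theorem card_cells {μ : YoungDiagram} {N : ℕ} (T : StandardTableau μ N) : μ.cells.card = N := by
  let _ := Fintype.ofEquiv _ T.entry.symm
  rw [← Fintype.card_of_subtype μ.cells YoungDiagram.mem_cells, Fintype.card_congr T.entry,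
    Fintype.card_fin]

theorem card_rowOf_eq (i : ℕ) : (univ.filter (T.rowOf · = i)).card = μ.rowLen i := by
  rw [← Finset.card_range (μ.rowLen i)]
  refine Finset.card_nbij T.colOf ?_ ?_ ?_
  · intro k hk
    obtain ⟨h, -⟩ := T.exists_entry_eq k
    rw [(Finset.mem_filter.1 hk).2] at h
    exact Finset.mem_range.2 (YoungDiagram.mem_iff_lt_rowLen.1 h)
  · intro k hk l hl h
    have hk := (Finset.mem_filter.1 hk).2
    have hl := (Finset.mem_filter.1 hl).2
    have h1 := (T.lt_iff_colOf_lt (hk.trans hl.symm)).1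
    have h2 := (T.lt_iff_colOf_lt (hl.trans hk.symm)).1
    by_contra hne
    rcases lt_or_gt_of_ne hne with h3 | h3
    · exact (h1 h3).ne h
    · exact (h2 h3).ne h.symm
  · intro j hj
    have hj := YoungDiagram.mem_iff_lt_rowLen.2 (Finset.mem_range.1 hj)
    exact ⟨T.entry ⟨(i, j), hj⟩, by simp [T.rowOf_entry], T.colOf_entry hj⟩

/-- The cell of k is a corner among the labels up to k. Each earlier label of the next row has a
still earlier label directly above it, which injects that row into the row of k without k. -/
theorem card_before_row_succ_lt (k : Fin N) :
    ((before k.succ).filter (T.rowOf · = T.rowOf k + 1)).card <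
      ((before k.succ).filter (T.rowOf · = T.rowOf k)).card := by
  rw [card_filter_before_succ, card_filter_before_succ, if_pos rfl, if_neg (by omega), add_zero,
    Nat.lt_succ_iff]
  have hmem : ∀ l, (T.rowOf l - 1, T.colOf l) ∈ μ := fun l =>
    μ.up_left_mem (Nat.sub_le _ _) le_rfl (T.exists_entry_eq l).1
  refine Finset.card_le_card_of_injOn (fun l => T.entry ⟨(T.rowOf l - 1, T.colOf l), hmem l⟩) ?_ ?_
  · intro l hl
    obtain ⟨h1, h2⟩ := Finset.mem_filter.1 hl
    rw [Finset.mem_coe, Finset.mem_filter, T.rowOf_entry, h2]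
    refine ⟨?_, rfl⟩
    rw [mem_before, Fin.castSucc_lt_castSucc_iff] at h1 ⊢
    refine lt_trans ?_ h1
    obtain ⟨h3, h4⟩ := T.exists_entry_eq l
    have := T.col_lt (hmem l) h3 (by omega)
    rwa [h4] at this
  · intro l hl l' hl' h
    obtain ⟨h1, h2⟩ := Finset.mem_filter.1 hl
    obtain ⟨h1', h2'⟩ := Finset.mem_filter.1 hl'
    have h3 := congrArg T.colOf h
    dsimp only at h3
    rw [T.colOf_entry, T.colOf_entry] at h3
    by_contra hne
    have h4 := (T.lt_iff_colOf_lt (h2.trans h2'.symm)).1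
    have h5 := (T.lt_iff_colOf_lt (h2'.trans h2.symm)).1
    rcases lt_or_gt_of_ne hne with h6 | h6
    · exact (h4 h6).ne h3
    · exact (h5 h6).ne h3.symm

/-- Labels increase along a row, so the earlier labels of that row are exactly those to the left of
k. Columns are thus recovered from rows. -/
theorem card_before_rowOf (k : Fin N) :
    ((before k.castSucc).filter (T.rowOf · = T.rowOf k)).card = T.colOf k := by
  rw [← Finset.card_range (T.colOf k)]
  refine Finset.card_nbij T.colOf ?_ ?_ ?_
  · intro l hl
    obtain ⟨h1, h2⟩ := Finset.mem_filter.1 hl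
    exact Finset.mem_range.2 ((T.lt_iff_colOf_lt h2).1 (by simpa [mem_before] using h1))
  · intro k hk l hl h
    have hk := (Finset.mem_filter.1 hk).2
    have hl := (Finset.mem_filter.1 hl).2
    have h1 := (T.lt_iff_colOf_lt (hk.trans hl.symm)).1
    have h2 := (T.lt_iff_colOf_lt (hl.trans hk.symm)).1
    by_contra hne
    rcases lt_or_gt_of_ne hne with h3 | h3
    · exact (h1 h3).ne h
    · exact (h2 h3).ne h.symm
  · intro j hj
    have hj := Finset.mem_range.1 hj
    have hmem := μ.up_left_mem le_rfl hj.le (T.exists_entry_eq k).1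
    refine ⟨T.entry ⟨(T.rowOf k, j), hmem⟩, ?_, T.colOf_entry hmem⟩
    rw [Finset.mem_coe, Finset.mem_filter, mem_before, Fin.castSucc_lt_castSucc_iff]
    refine ⟨?_, T.rowOf_entry hmem⟩
    rw [T.lt_iff_colOf_lt (T.rowOf_entry hmem), T.colOf_entry]
    exact hj

/-- A standard tableau is determined by the rows of its labels. -/
theorem ext_of_rowOf {T T' : StandardTableau μ N} (h : T.rowOf = T'.rowOf) : T = T' := by
  have hsymm : ∀ k, T.entry.symm k = T'.entry.symm k := by
    intro k
    refine Subtype.ext (Prod.ext (congrFun h k) ?_)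
    show T.colOf k = T'.colOf k
    rw [← card_before_rowOf, ← card_before_rowOf, h]
  have : T.entry = T'.entry := Equiv.symm_bijective.injective (Equiv.ext hsymm)
  cases T; cases T'
  congr

end StandardTableau

/-! ### The inverse procedure as a run of insertions. -/

namespace TableauPair

variable {m n : ℕ} (p : TableauPair m n)

theorem mem_shapeT_of_mem_shapeS {i j : ℕ} (h : (i, j) ∈ p.shapeS) : (i, j) ∈ p.shapeT :=
  p.shapeT.up_left_mem (Nat.le_succ i) le_rfl ((p.shape_eq i j).1 h)

theorem starEntry_of_mem {i j : ℕ} (h : (i, j) ∈ p.shapeS) :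
    p.starEntry i j = ((p.S.entry ⟨(i, j), h⟩ : Fin m) : Letter m) := dif_pos h

theorem starEntry_of_notMem {i j : ℕ} (h : (i, j) ∉ p.shapeS) : p.starEntry i j = ⊤ := dif_neg h

theorem mem_shapeS_iff {i j : ℕ} : (i, j) ∈ p.shapeS ↔ p.starEntry i j ≠ ⊤ := by
  by_cases h : (i, j) ∈ p.shapeS
  · simp [h, p.starEntry_of_mem h]
  · simp [h, p.starEntry_of_notMem h]

theorem colLen_le : p.shapeT.colLen 0 ≤ n := by
  rw [YoungDiagram.colLen_eq_card]
  exact (Finset.card_le_card (Finset.filter_subset _ _)).trans_eq p.T.card_cells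

/-- The left tableau, with empty rows added so that there are `n` rows. -/
def paddedTableau (k : Fin (n + 1)) : List (List (Letter m)) :=
  p.leftTableau k ++ List.replicate (n - p.shapeT.colLen 0) []

theorem leftTableau_last : p.leftTableau (Fin.last n) = p.starRows :=
  Fin.reverseInduction_last

theorem leftTableau_castSucc (k : Fin n) :
    p.leftTableau k.castSucc = (reverseInsert (p.leftTableau k.succ) (p.T.rowOf k)).2 :=
  Fin.reverseInduction_castSucc _

theorem length_leftTableau (k : Fin (n + 1)) : (p.leftTableau k).length = p.shapeT.colLen 0 := by
  induction k using Fin.reverseInduction with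
  | last => simp [leftTableau_last, starRows]
  | cast k ih => rw [leftTableau_castSucc, length_reverseInsert, ih]

theorem length_paddedTableau (k : Fin (n + 1)) : (p.paddedTableau k).length = n := by
  have := p.colLen_le
  rw [paddedTableau, List.length_append, length_leftTableau, List.length_replicate]
  omega

theorem rowOf_lt_colLen (k : Fin n) : p.T.rowOf k < p.shapeT.colLen 0 := by
  obtain ⟨h, -⟩ := p.T.exists_entry_eq k
  exact YoungDiagram.mem_iff_lt_colLen.1 (p.shapeT.up_left_mem le_rfl (Nat.zero_le _) h)

theorem reverseInsert_paddedTableau (k : Fin n) :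
    reverseInsert (p.paddedTableau k.succ) (p.T.rowOf k) =
      (p.popped k, p.paddedTableau k.castSucc) := by
  rw [paddedTableau, reverseInsert_append, paddedTableau, leftTableau_castSucc]
  · rfl
  · rw [length_leftTableau]
    exact p.rowOf_lt_colLen k

theorem getD_paddedTableau_last (i : ℕ) :
    (p.paddedTableau (Fin.last n)).getD i [] =
      (List.range (p.shapeT.rowLen i)).map (p.starEntry i) := by
  rw [paddedTableau, leftTableau_last, List.getD_eq_getElem?_getD]
  by_cases h : i < p.shapeT.colLen 0
  · rw [List.getElem?_append_left (by simpa [starRows] using h)]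
    simp [starRows, h]
  · have : p.shapeT.rowLen i = 0 := by
      by_contra! hne
      exact h (YoungDiagram.mem_iff_lt_colLen.1
        (YoungDiagram.mem_iff_lt_rowLen.2 (Nat.pos_of_ne_zero hne)))
    rw [List.getElem?_append_right (by simpa [starRows] using h), List.getElem?_replicate, this]
    split_ifs <;> rfl

theorem getD_getD_paddedTableau_last (i j : ℕ) :
    ((p.paddedTableau (Fin.last n)).getD i []).getD j ⊤ = p.starEntry i j := by
  rw [getD_paddedTableau_last]
  by_cases h : j < p.shapeT.rowLen i
  · rw [List.getD_eq_getElem _ _ (by simpa using h)]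
    simp
  · rw [List.getD_eq_default _ _ (by simpa using h), starEntry_of_notMem]
    exact fun h' => h (YoungDiagram.mem_iff_lt_rowLen.1 (p.mem_shapeT_of_mem_shapeS h'))

theorem length_getD_paddedTableau_last (i : ℕ) :
    ((p.paddedTableau (Fin.last n)).getD i []).length = p.shapeT.rowLen i := by
  rw [getD_paddedTableau_last, List.length_map, List.length_range]

/-- Above any cell of T outside the top row there is a cell of S, so no two ∞ stand in one column;
rows are weak because the cells of S form an initial part of each row. -/
theorem isSemistandard_paddedTableau_last : IsSemistandard (p.paddedTableau (Fin.last n)) := by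
  rw [isSemistandard_iff]
  intro i
  refine ⟨?_, ?_, ?_⟩
  · intro j₁ j₂ h
    dsimp only
    rw [getD_getD_paddedTableau_last, getD_getD_paddedTableau_last]
    by_cases h2 : (i, j₂) ∈ p.shapeS
    · have h1 := p.shapeS.up_left_mem le_rfl h h2
      rw [p.starEntry_of_mem h1, p.starEntry_of_mem h2, WithTop.coe_le_coe]
      rcases h.lt_or_eq with h | rfl
      · exact (p.S.row_lt h1 h2 h).le
      · exact le_rfl
    · rw [p.starEntry_of_notMem h2]
      exact le_top
  · rw [length_getD_paddedTableau_last, length_getD_paddedTableau_last]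
    exact p.shapeT.rowLen_anti _ _ (Nat.le_succ i)
  · intro j hj
    rw [length_getD_paddedTableau_last, ← YoungDiagram.mem_iff_lt_rowLen, ← p.shape_eq] at hj
    rw [getD_getD_paddedTableau_last, getD_getD_paddedTableau_last, p.starEntry_of_mem hj]
    by_cases h2 : (i + 1, j) ∈ p.shapeS
    · rw [p.starEntry_of_mem h2, WithTop.coe_lt_coe]
      exact p.S.col_lt hj h2 (Nat.lt_succ_self i)
    · rw [p.starEntry_of_notMem h2]
      exact WithTop.coe_lt_top _

/-- The two claims support each other: the shape is that of the labels not yet crossed out, so the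
next label sits in a corner, and removal from a corner preserves both. -/
theorem paddedTableau_spec (k : Fin (n + 1)) : IsSemistandard (p.paddedTableau k) ∧
    ∀ i, ((p.paddedTableau k).getD i []).length = ((before k).filter (p.T.rowOf · = i)).card := by
  induction k using Fin.reverseInduction with
  | last =>
    refine ⟨p.isSemistandard_paddedTableau_last, fun i => ?_⟩
    rw [length_getD_paddedTableau_last, before_last, p.T.card_rowOf_eq]
  | cast k ih =>
    have hr : p.T.rowOf k < (p.paddedTableau k.succ).length := by
      rw [length_paddedTableau]
      exact (p.rowOf_lt_colLen k).trans_le p.colLen_le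
    obtain ⟨h1, h2, h3⟩ := insertLetter_reverseInsert ih.1 hr
      (by rw [ih.2, ih.2]; exact p.T.card_before_row_succ_lt k)
    rw [reverseInsert_paddedTableau] at h1 h2
    dsimp only at h1 h2
    refine ⟨h1, fun i => ?_⟩
    have := length_getD_insertLetter (P := p.paddedTableau k.castSucc) (x := (p.popped k).1)
      (by rw [h2, length_paddedTableau]; rwa [length_paddedTableau] at hr) i
    rw [h2, ih.2, card_filter_before_succ] at this
    exact (Nat.add_right_cancel this).symm

theorem insert_paddedTableau (k : Fin n) :
    insertLetter (p.paddedTableau k.castSucc) (p.word k) =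
        (p.paddedTableau k.succ, p.T.rowOf k) ∧
      insertColumn (p.paddedTableau k.castSucc) (p.word k) = (p.popped k).2 := by
  have hr : p.T.rowOf k < (p.paddedTableau k.succ).length := by
    rw [length_paddedTableau]
    exact (p.rowOf_lt_colLen k).trans_le p.colLen_le
  obtain ⟨-, h2, h3⟩ := insertLetter_reverseInsert (p.paddedTableau_spec k.succ).1 hr
    (by rw [(p.paddedTableau_spec _).2, (p.paddedTableau_spec _).2]
        exact p.T.card_before_row_succ_lt k)
  rw [reverseInsert_paddedTableau] at h2 h3
  exact ⟨h2, h3⟩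

theorem isRun : IsRun p.word p.paddedTableau p.T.rowOf where
  zero := by
    rw [List.eq_replicate_iff]
    refine ⟨p.length_paddedTableau 0, fun row hrow => ?_⟩
    obtain ⟨i, hi, rfl⟩ := List.getElem_of_mem hrow
    have := (p.paddedTableau_spec 0).2 i
    rw [before_zero, List.getD_eq_getElem _ _ hi] at this
    exact List.length_eq_zero_iff.1 (by simpa using this)
  step k := (p.insert_paddedTableau k).1

/-- Insertion of the word is deterministic. Its final tableau returns S* and hence S, and the rows
of its new cells return T. -/
theorem word_injective : Function.Injective (word : TableauPair m n → Fin n → Letter m) := by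
  intro p q h
  have hq := q.isRun
  rw [← h] at hq
  obtain ⟨hP, hr⟩ := p.isRun.unique hq
  have hT : p.shapeT = q.shapeT := by
    refine SetLike.ext fun c => ?_
    rw [show c = (c.1, c.2) from rfl, YoungDiagram.mem_iff_lt_rowLen,
      YoungDiagram.mem_iff_lt_rowLen, ← p.T.card_rowOf_eq, ← q.T.card_rowOf_eq, hr]
  have hstar : p.starEntry = q.starEntry := by
    funext i j
    rw [← getD_getD_paddedTableau_last, ← getD_getD_paddedTableau_last, hP]
  have hS : p.shapeS = q.shapeS := by
    refine SetLike.ext fun c => ?_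
    rw [show c = (c.1, c.2) from rfl, mem_shapeS_iff, mem_shapeS_iff, hstar]
  have hSe : ∀ (i j : ℕ) (h : (i, j) ∈ p.shapeS) (h' : (i, j) ∈ q.shapeS),
      p.S.entry ⟨(i, j), h⟩ = q.S.entry ⟨(i, j), h'⟩ := by
    intro i j h h'
    have := congrFun₂ hstar i j
    rwa [p.starEntry_of_mem h, q.starEntry_of_mem h', WithTop.coe_inj] at this
  clear hq hP hstar h
  obtain ⟨μ, ν, S, T, hμν⟩ := p
  obtain ⟨μ', ν', S', T', hμν'⟩ := q
  dsimp only at hT hS hSe hr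
  subst hT hS
  have h1 : T = T' := StandardTableau.ext_of_rowOf hr
  have h2 : S = S' := by
    have : S.entry = S'.entry := Equiv.ext fun c => hSe c.1.1 c.1.2 c.2 c.2
    cases S; cases S'
    congr
  subst h1 h2
  rfl

end TableauPair

/-! ### Words attached to injections. -/

section Words

variable {m n : ℕ}

/-- The word on `0, …, m - 1, ∞^{n-m}` with the letter `a` at the place `φ a`. -/
noncomputable def wordOf (φ : Fin m → Fin n) (k : Fin n) : Letter m :=
  open Classical in if h : ∃ a, φ a = k then (h.choose : Fin m) else ⊤

theorem wordOf_eq_coe_iff {φ : Fin m → Fin n} (hφ : Function.Injective φ) {k : Fin n}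
    {a : Fin m} : wordOf φ k = a ↔ φ a = k := by
  unfold wordOf
  split_ifs with h
  · rw [WithTop.coe_inj]
    exact ⟨fun h' => h' ▸ h.choose_spec, fun h' => hφ (h.choose_spec.trans h'.symm)⟩
  · refine ⟨fun h' => absurd h' (WithTop.coe_ne_top).symm, fun h' => absurd ⟨a, h'⟩ h⟩

theorem eq_wordOf {φ : Fin m → Fin n} (hφ : Function.Injective φ) {w : Fin n → Letter m}
    (h : ∀ k a, w k = (a : Fin m) ↔ φ a = k) : w = wordOf φ := by
  funext k
  induction hw : w k using WithTop.recTopCoe with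
  | top =>
    induction hφk : wordOf φ k using WithTop.recTopCoe with
    | top => rfl
    | coe a =>
      rw [wordOf_eq_coe_iff hφ, ← h, hw] at hφk
      exact hφk
  | coe a => exact ((wordOf_eq_coe_iff hφ).2 ((h k a).1 hw)).symm

theorem wordOf_injective_of_injective {φ ψ : Fin m → Fin n} (hφ : Function.Injective φ)
    (hψ : Function.Injective ψ) (h : wordOf φ = wordOf ψ) : φ = ψ := by
  funext a
  exact (((wordOf_eq_coe_iff hψ).1 (h ▸ (wordOf_eq_coe_iff hφ).2 rfl)).symm)

theorem filter_wordOf_ne_top {φ : Fin m → Fin n} (hφ : Function.Injective φ) :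
    univ.filter (wordOf φ · ≠ ⊤) = univ.image φ := by
  ext k
  simp only [Finset.mem_filter, Finset.mem_univ, true_and, Finset.mem_image,
    WithTop.ne_top_iff_exists, eq_comm (b := wordOf φ k), wordOf_eq_coe_iff hφ]

theorem card_filter_wordOf_eq_top {φ : Fin m → Fin n} (hφ : Function.Injective φ) :
    (univ.filter (wordOf φ · = ⊤)).card = n - m := by
  have h1 := Finset.card_filter_add_card_filter_not (s := (univ : Finset (Fin n))) (wordOf φ · = ⊤)
  have h2 := filter_wordOf_ne_top hφ
  simp only [ne_eq] at h2
  rw [h2, Finset.card_image_of_injective _ hφ, Finset.card_univ, Finset.card_univ,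
    Fintype.card_fin, Fintype.card_fin] at h1
  omega

end Words

/-! ### The word of a pair and its classes A_i, B_i. -/

namespace TableauPair

variable {m n : ℕ} (p : TableauPair m n)

/-- The word and S* have the same multiset of letters; indicators g extract multiplicities. -/
theorem sum_word (g : Letter m → ℕ) :
    ∑ k, g (p.word k) = ∑ c ∈ p.shapeT.cells, g (p.starEntry c.1 c.2) := by
  rw [← p.isRun.entrySum_last, entrySum_eq_sum_cells g p.length_getD_paddedTableau_last]
  simp only [getD_getD_paddedTableau_last]

theorem existsUnique_word (a : Fin m) : ∃! k, p.word k = a := by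
  have h1 := p.sum_word fun x => if x = a then 1 else 0
  rw [Finset.sum_eq_single (p.S.entry.symm a).1] at h1
  · rw [p.starEntry_of_mem (p.S.entry.symm a).2, if_pos, ← Finset.card_filter,
      Finset.card_eq_one] at h1
    · obtain ⟨k, hk⟩ := h1
      refine ⟨k, by simpa using hk.ge (Finset.mem_singleton_self k), fun l hl => ?_⟩
      exact Finset.mem_singleton.1 (hk.le (by simpa using hl))
    · exact congrArg _ (p.S.entry.apply_symm_apply a)
  · rintro ⟨i, j⟩ - hne
    rw [if_neg]
    intro h
    have hmem : (i, j) ∈ p.shapeS := p.mem_shapeS_iff.2 (by rw [h]; exact WithTop.coe_ne_top)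
    rw [p.starEntry_of_mem hmem, WithTop.coe_inj] at h
    exact hne (by rw [← h, Equiv.symm_apply_apply])
  · intro h
    exact absurd (p.mem_shapeT_of_mem_shapeS (p.S.entry.symm a).2) h

/-- The place of the letter `a` in the word of `p`. -/
noncomputable def place (a : Fin m) : Fin n := (p.existsUnique_word a).choose

theorem word_eq_coe_iff {k : Fin n} {a : Fin m} : p.word k = a ↔ p.place a = k :=
  ⟨fun h => (p.existsUnique_word a).unique (p.existsUnique_word a).choose_spec.1 h,
    fun h => h ▸ (p.existsUnique_word a).choose_spec.1⟩

theorem word_place (a : Fin m) : p.word (p.place a) = a := p.word_eq_coe_iff.2 rfl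

theorem place_injective : Function.Injective p.place := fun a b h => by
  have := p.word_place a
  rwa [h, word_place, WithTop.coe_inj, eq_comm] at this

theorem word_eq_wordOf : p.word = wordOf p.place :=
  eq_wordOf p.place_injective fun _ _ => p.word_eq_coe_iff

/-- The cells of T below its top row correspond to the m cells of S, shifted by one row. -/
theorem rowLen_zero : p.shapeT.rowLen 0 = n - m := by
  have h1 := Finset.card_filter_add_card_filter_not (s := p.shapeT.cells) (·.1 = 0)
  have h2 : (p.shapeT.cells.filter fun c => ¬ c.1 = 0).card = m := by
    refine Eq.trans ?_ p.S.card_cells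
    refine Finset.card_nbij' (fun c => (c.1 - 1, c.2)) (fun c => (c.1 + 1, c.2)) ?_ ?_ ?_ ?_
    · rintro ⟨i, j⟩ hc
      obtain ⟨h3, h4⟩ := Finset.mem_filter.1 hc
      obtain ⟨i, rfl⟩ := Nat.exists_eq_succ_of_ne_zero h4
      exact (p.shape_eq i j).2 h3
    · rintro ⟨i, j⟩ hc
      exact Finset.mem_filter.2 ⟨(p.shape_eq i j).1 hc, Nat.succ_ne_zero i⟩
    · rintro ⟨i, j⟩ hc
      obtain ⟨i, rfl⟩ := Nat.exists_eq_succ_of_ne_zero (Finset.mem_filter.1 hc).2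
      rfl
    · rintro ⟨i, j⟩ hc
      rfl
  rw [h2, p.T.card_cells] at h1
  rw [YoungDiagram.rowLen_eq_card, YoungDiagram.row]
  omega

theorem popped_snd_lt (k : Fin n) : (p.popped k).2 < n - m := by
  have h1 := insertColumn_lt_length (p.isRun.ne_nil k) (p.word k)
  rw [(p.insert_paddedTableau k).2, p.isRun.step_fst, headD_eq_getD, p.isRun.length_row] at h1
  refine h1.trans_le ?_
  rw [← p.rowLen_zero, ← p.T.card_rowOf_eq]
  exact Finset.card_le_card (Finset.filter_subset_filter _ (Finset.subset_univ _))

theorem word_lt_word {k l : Fin n} (hkl : k < l) (h : (p.popped k).2 = (p.popped l).2) :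
    p.word l < p.word k := by
  rw [← (p.insert_paddedTableau k).2, ← (p.insert_paddedTableau l).2] at h
  exact p.isRun.lt_of_insertColumn_eq hkl h

theorem mem_setB {i : ℕ} {k : Fin n} : k ∈ p.setB i ↔ (p.popped k).2 = i := by simp [setB]

theorem mem_setA {i : ℕ} {a : Fin m} : a ∈ p.setA i ↔ p.place a ∈ p.setB i := by
  rw [mem_setB, setA, Finset.mem_filter]
  constructor
  · rintro ⟨-, k, hk⟩
    rw [p.word_eq_coe_iff.1 (congrArg Prod.fst hk), hk]
  · rintro rfl
    exact ⟨Finset.mem_univ _, p.place a, Prod.ext (p.word_place a) rfl⟩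

/-- Letters from one cell decrease strictly, so each cell pops ∞ at most once. As n - m letters ∞
leave through n - m cells, each cell pops it exactly once. -/
theorem exists_top_mem_setB {i : ℕ} (hi : i < n - m) : ∃ k ∈ p.setB i, p.word k = ⊤ := by
  have h1 : (univ.filter (p.word · = ⊤)).image (fun k => (p.popped k).2) = range (n - m) := by
    refine Finset.eq_of_subset_of_card_le ?_ ?_
    · intro i hi
      obtain ⟨k, -, rfl⟩ := Finset.mem_image.1 hi
      exact Finset.mem_range.2 (p.popped_snd_lt k)
    · rw [Finset.card_image_of_injOn, Finset.card_range, word_eq_wordOf,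
        card_filter_wordOf_eq_top p.place_injective]
      intro k hk l hl h
      have hk := (Finset.mem_filter.1 hk).2
      have hl := (Finset.mem_filter.1 hl).2
      by_contra hne
      rcases lt_or_gt_of_ne hne with h1 | h1
      · exact (p.word_lt_word h1 h).ne (hl.trans hk.symm)
      · exact (p.word_lt_word h1 h.symm).ne (hk.trans hl.symm)
  obtain ⟨k, hk, rfl⟩ := Finset.mem_image.1 (h1 ▸ Finset.mem_range.2 hi)
  exact ⟨k, p.mem_setB.2 rfl, (Finset.mem_filter.1 hk).2⟩

theorem card_setB {i : ℕ} (hi : i < n - m) : (p.setB i).card = (p.setA i).card + 1 := by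
  obtain ⟨k, hk, hkt⟩ := p.exists_top_mem_setB hi
  have hnot : k ∉ (p.setA i).image p.place := by
    intro h
    obtain ⟨a, -, rfl⟩ := Finset.mem_image.1 h
    rw [word_place] at hkt
    exact WithTop.coe_ne_top hkt
  rw [← Finset.card_image_of_injective _ p.place_injective, ← Finset.card_insert_of_notMem hnot]
  congr 1
  ext l
  rw [Finset.mem_insert, Finset.mem_image]
  constructor
  · intro hl
    induction hw : p.word l using WithTop.recTopCoe with
    | top =>
      left
      rw [mem_setB] at hk hl
      by_contra hne
      rcases lt_or_gt_of_ne hne with h1 | h1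
      · exact (p.word_lt_word h1 (hl.trans hk.symm)).ne (hkt.trans hw.symm)
      · exact (p.word_lt_word h1 (hk.trans hl.symm)).ne (hw.trans hkt.symm)
    | coe a =>
      have := p.word_eq_coe_iff.1 hw
      exact Or.inr ⟨a, p.mem_setA.2 (this ▸ hl), this⟩
  · rintro (rfl | ⟨a, ha, rfl⟩)
    · exact hk
    · exact p.mem_setA.1 ha

end TableauPair

/-! ### Words without long weakly increasing subwords. -/

section Surjectivity

theorem exists_youngDiagram {f : ℕ → ℕ} (hf : Antitone f) {N : ℕ} (hN : f N = 0) :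
    ∃ μ : YoungDiagram, ∀ i j, (i, j) ∈ μ ↔ j < f i := by
  have hlt : ∀ i j, j < f i → i < N := by
    intro i j h
    by_contra! hle
    have := hf hle
    omega
  have hlower : IsLowerSet
      (((range N ×ˢ range (f 0)).filter fun c => c.2 < f c.1 : Finset (ℕ × ℕ)) : Set (ℕ × ℕ)) := by
    rintro ⟨i, j⟩ ⟨i', j'⟩ ⟨hi, hj⟩ h
    simp only [Finset.coe_filter, Finset.mem_product, Finset.mem_range, Set.mem_ofPred_eq] at h ⊢
    simp only at hi hj
    have h1 := @hf _ _ hi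
    have h2 := @hf _ _ (Nat.zero_le i')
    omega
  refine ⟨⟨_, hlower⟩, fun i j => ?_⟩
  rw [YoungDiagram.mem_mk]
  simp only [Finset.mem_filter, Finset.mem_product, Finset.mem_range]
  have h1 := hlt i j
  have h2 := @hf _ _ (Nat.zero_le i)
  exact ⟨fun h => h.2, fun h => ⟨⟨h1 h, by omega⟩, h⟩⟩

variable {m n : ℕ}

namespace IsRun

variable {w : Fin n → Letter m} {P : Fin (n + 1) → List (List (Letter m))} {r : Fin n → ℕ}

theorem length_row_mono (h : IsRun w P r) (i : ℕ) {k l : Fin (n + 1)} (hkl : k ≤ l) :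
    ((P k).getD i []).length ≤ ((P l).getD i []).length := by
  rw [h.length_row, h.length_row]
  refine Finset.card_le_card (Finset.filter_subset_filter _ fun x hx => ?_)
  rw [mem_before] at hx ⊢
  exact hx.trans_le hkl

theorem length_row_anti (h : IsRun w P r) (k : Fin (n + 1)) :
    Antitone fun i => ((P k).getD i []).length :=
  antitone_nat_of_succ_le fun i => (isSemistandard_iff.1 (h.isSemistandard k) i).2.1

/-- The cell that is added when the label `k` is inserted. -/
def newCell (P : Fin (n + 1) → List (List (Letter m))) (r : Fin n → ℕ) (k : Fin n) : ℕ × ℕ :=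
  (r k, ((P k.castSucc).getD (r k) []).length)

theorem newCell_lt (h : IsRun w P r) {k : Fin n} {l : Fin (n + 1)} (hkl : k.castSucc < l) :
    (newCell P r k).2 < ((P l).getD (r k) []).length := by
  have h1 := h.length_row_succ k (r k)
  rw [if_pos rfl] at h1
  have h2 := h.length_row_mono (r k) (Fin.castSucc_lt_iff_succ_le.1 hkl)
  rw [newCell]
  omega

/-- A cell, once added, lies inside all later shapes, so it cannot be new again. -/
theorem newCell_injective (h : IsRun w P r) : Function.Injective (newCell P r) := by
  have key : ∀ k l : Fin n, k < l → newCell P r k ≠ newCell P r l := by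
    intro k l hkl heq
    have h1 := h.newCell_lt (k := k) (l := l.castSucc) hkl
    have h2 : r k = r l := congrArg Prod.fst heq
    rw [heq, newCell, h2] at h1
    exact lt_irrefl _ h1
  intro k l heq
  by_contra hne
  rcases lt_or_gt_of_ne hne with h1 | h1
  · exact key k l h1 heq
  · exact key l k h1 heq.symm

theorem exists_newCell_eq (h : IsRun w P r) (k : Fin (n + 1)) {i j : ℕ}
    (hj : j < ((P k).getD i []).length) : ∃ l, newCell P r l = (i, j) := by
  induction k using Fin.induction with
  | zero =>
    rw [h.length_row, before_zero] at hj
    simp at hj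
  | succ k ih =>
    by_cases hj' : j < ((P k.castSucc).getD i []).length
    · exact ih hj'
    · rw [h.length_row_succ] at hj
      split_ifs at hj with hi
      · refine ⟨k, ?_⟩
        rw [newCell, ← hi]
        congr 1
        omega
      · omega

/-- The recording tableau of a run. -/
theorem exists_standardTableau (h : IsRun w P r) {μ : YoungDiagram}
    (hμ : ∀ i j, (i, j) ∈ μ ↔ j < ((P (Fin.last n)).getD i []).length) :
    ∃ T : StandardTableau μ n, T.rowOf = r := by
  let f : Fin n → {c : ℕ × ℕ // c ∈ μ} := fun k =>
    ⟨newCell P r k, (hμ _ _).2 (h.newCell_lt (Fin.castSucc_lt_last k))⟩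
  have hf : Function.Bijective f := by
    constructor
    · intro k l hkl
      exact h.newCell_injective (congrArg Subtype.val hkl)
    · rintro ⟨⟨i, j⟩, hc⟩
      obtain ⟨k, hk⟩ := h.exists_newCell_eq _ ((hμ i j).1 hc)
      exact ⟨k, Subtype.ext hk⟩
  let E := Equiv.ofBijective f hf
  have hE : ∀ {i j : ℕ} (hc : (i, j) ∈ μ), newCell P r (E.symm ⟨(i, j), hc⟩) = (i, j) := by
    intro i j hc
    exact congrArg Subtype.val (E.apply_symm_apply ⟨(i, j), hc⟩)
  refine ⟨⟨E.symm, ?_, ?_⟩, ?_⟩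
  · intro i j₁ j₂ h₁ h₂ hlt
    have e1 := hE h₁
    have e2 := hE h₂
    set k := E.symm ⟨(i, j₁), h₁⟩
    set l := E.symm ⟨(i, j₂), h₂⟩
    -- If the left cell were not added first, its row would have been longer when it was added than
    -- when the right cell was.
    by_contra! hle
    have h3 := h.length_row_mono (r l) (Fin.castSucc_le_castSucc_iff.2 hle)
    simp only [newCell, Prod.mk.injEq] at e1 e2
    rw [e2.2, e2.1, ← e1.1, e1.2] at h3
    omega
  · intro i₁ i₂ j h₁ h₂ hlt
    have e1 := hE h₁
    have e2 := hE h₂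
    set k := E.symm ⟨(i₁, j), h₁⟩
    set l := E.symm ⟨(i₂, j), h₂⟩
    by_contra! hle
    have h3 := h.newCell_lt (k := l) (l := l.succ) (Fin.castSucc_lt_succ)
    have h4 := h.length_row_anti l.succ hlt.le
    have h5 := h.length_row_succ l i₁
    have h6 := h.length_row_mono i₁ (Fin.castSucc_le_castSucc_iff.2 hle)
    rw [e2] at h3
    simp only [newCell, Prod.mk.injEq] at e1 e2
    rw [e2.1] at h3 h5
    rw [if_neg hlt.ne] at h5
    rw [e1.1] at e1
    dsimp only at h3 h4
    omega
  · rfl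

end IsRun

/-- Every word without a weakly increasing subword of length `n - m + 1` comes from a pair of
tableaux. -/
theorem exists_tableauPair {φ : Fin m → Fin n} (hφ : Function.Injective φ)
    (hgood : ∀ K : Finset (Fin n), K.card = n - m + 1 → ¬ MonotoneOn (wordOf φ) K) :
    ∃ p : TableauPair m n, p.word = wordOf φ := by
  obtain ⟨P, r, h⟩ := exists_isRun (wordOf φ)
  set Q := P (Fin.last n) with hQ
  have hss := isSemistandard_iff.1 (h.isSemistandard (Fin.last n))
  rw [← hQ] at hss
  have hanti := h.length_row_anti (Fin.last n)
  rw [← hQ] at hanti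
  have hQlen : Q.length = n := h.length_eq _
  have hzero : ∀ i, n ≤ i → (Q.getD i []).length = 0 := by
    intro i hi
    rw [List.getD_eq_default _ _ (hQlen ▸ hi)]
    rfl
  obtain ⟨μT, hμT⟩ := exists_youngDiagram hanti (N := n) (hzero n le_rfl)
  obtain ⟨μS, hμS⟩ := exists_youngDiagram (f := fun i => (Q.getD (i + 1) []).length)
    (fun i j hij => hanti (Nat.succ_le_succ hij)) (N := n) (hzero (n + 1) (Nat.le_succ n))
  have hST : ∀ i j, (i, j) ∈ μS ↔ (i + 1, j) ∈ μT := fun i j => by rw [hμS, hμT]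
  obtain ⟨T, hT⟩ := h.exists_standardTableau hμT
  have hrowLen : ∀ i, (Q.getD i []).length = μT.rowLen i := fun i =>
    eq_of_forall_lt_iff fun j => by rw [← hμT, YoungDiagram.mem_iff_lt_rowLen]
  set ent : ℕ → ℕ → Letter m := fun i j => (Q.getD i []).getD j ⊤ with hent
  have hsum : ∀ g : Letter m → ℕ, ∑ c ∈ μT.cells, g (ent c.1 c.2) = ∑ k, g (wordOf φ k) := by
    intro g
    rw [← h.entrySum_last, ← hQ, entrySum_eq_sum_cells g hrowLen]
  have hcol : ∀ i i' j, i < i' → (i', j) ∈ μT → ent i j < ent i' j := by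
    intro i i' j hii hmem
    obtain ⟨d, rfl⟩ := Nat.exists_eq_add_of_lt hii
    clear hii
    induction d with
    | zero => exact (hss i).2.2 j ((hμT _ _).1 hmem)
    | succ d ih =>
      exact (ih (μT.up_left_mem (by omega) le_rfl hmem)).trans
        ((hss (i + d + 1)).2.2 j ((hμT _ _).1 hmem))
  -- A top row with n - m + 1 cells would end a weakly increasing subword of that length.
  have hcolumns : μT.rowLen 0 ≤ n - m := by
    by_contra! hlt
    rw [← hrowLen, ← headD_eq_getD] at hlt
    obtain ⟨K, -, hK, hmono, -⟩ := h.exists_monotoneOn (Fin.last n) hlt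
    exact hgood K hK hmono
  -- Strict columns contain ∞ at most once, and there are n - m letters ∞ in at most n - m columns.
  -- So every column has one, necessarily at its bottom.
  have htop : ∀ i j, (i, j) ∈ μT → (i + 1, j) ∉ μT → ent i j = ⊤ := by
    intro i j hmem hnot
    have hcard : (μT.cells.filter fun c => ent c.1 c.2 = ⊤).card = n - m := by
      rw [← card_filter_wordOf_eq_top hφ, Finset.card_filter, Finset.card_filter]
      exact hsum fun x => if x = ⊤ then 1 else 0
    have himg : (μT.cells.filter fun c => ent c.1 c.2 = ⊤).image Prod.snd =
        range (μT.rowLen 0) := by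
      refine Finset.eq_of_subset_of_card_le ?_ ?_
      · intro j hj
        obtain ⟨⟨i, j⟩, hc, rfl⟩ := Finset.mem_image.1 hj
        have hc := (YoungDiagram.mem_cells _).1 (Finset.mem_filter.1 hc).1
        exact Finset.mem_range.2 (YoungDiagram.mem_iff_lt_rowLen.1
          (μT.up_left_mem (Nat.zero_le _) le_rfl hc))
      · rw [Finset.card_image_of_injOn, hcard, Finset.card_range]
        · exact hcolumns
        · rintro ⟨i, j⟩ hc ⟨i', j'⟩ hc' heq
          obtain ⟨h1, h2⟩ := Finset.mem_filter.1 hc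
          obtain ⟨h1', h2'⟩ := Finset.mem_filter.1 hc'
          rw [YoungDiagram.mem_cells] at h1 h1'
          dsimp only at heq h2 h2'
          subst heq
          congr 1
          by_contra hne
          rcases lt_or_gt_of_ne hne with h3 | h3
          · exact (hcol _ _ _ h3 h1').ne (h2.trans h2'.symm)
          · exact (hcol _ _ _ h3 h1).ne (h2'.trans h2.symm)
    have hj : j ∈ range (μT.rowLen 0) := Finset.mem_range.2 (YoungDiagram.mem_iff_lt_rowLen.1
      (μT.up_left_mem (Nat.zero_le _) le_rfl hmem))
    rw [← himg] at hj
    obtain ⟨⟨i', j'⟩, hc, rfl⟩ := Finset.mem_image.1 hj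
    obtain ⟨h1, h2⟩ := Finset.mem_filter.1 hc
    rw [YoungDiagram.mem_cells] at h1
    dsimp only at h2 hmem hnot ⊢
    rcases lt_trichotomy i i' with h3 | h3 | h3
    · exact absurd (μT.up_left_mem h3 le_rfl h1) hnot
    · rw [h3, h2]
    · have h4 := hcol _ _ _ h3 hmem
      rw [h2] at h4
      exact absurd h4 not_top_lt
  have hfin : ∀ i j, (i, j) ∈ μS → ent i j ≠ ⊤ := fun i j hmem =>
    (lt_of_lt_of_le (hcol i (i + 1) j (Nat.lt_succ_self i) ((hST i j).1 hmem)) le_top).ne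
  have hout : ∀ i j, (i, j) ∉ μS → ent i j = ⊤ := by
    intro i j hnot
    rw [hST] at hnot
    by_cases hmem : (i, j) ∈ μT
    · exact htop i j hmem hnot
    · exact List.getD_eq_default _ _ (not_lt.1 fun h' => hmem ((hμT i j).2 h'))
  -- Insertion preserves the multiset of letters, so each finite letter fills one cell; this makes
  -- the finite part a standard filling.
  have honce : ∀ a : Fin m, (μT.cells.filter fun c => ent c.1 c.2 = a).card = 1 := by
    intro a
    rw [Finset.card_filter, hsum fun x => if x = (a : Letter m) then 1 else 0,
      ← Finset.card_filter, Finset.card_eq_one]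
    refine ⟨φ a, ?_⟩
    ext k
    simp [wordOf_eq_coe_iff hφ, eq_comm]
  let f : {c : ℕ × ℕ // c ∈ μS} → Fin m := fun c => (ent c.1.1 c.1.2).untop (hfin _ _ c.2)
  have hfc : ∀ c, (f c : Letter m) = ent c.1.1 c.1.2 := fun c => WithTop.coe_untop _ _
  have hmemST : ∀ {i j}, (i, j) ∈ μS → (i, j) ∈ μT := fun {i j} hmem =>
    μT.up_left_mem (Nat.le_succ i) le_rfl ((hST i j).1 hmem)
  have hf : Function.Bijective f := by
    constructor
    · rintro c d hcd
      obtain ⟨e, he⟩ := Finset.card_eq_one.1 (honce (f c))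
      have h1 : c.1 ∈ ({e} : Finset (ℕ × ℕ)) := by
        rw [← he]
        exact Finset.mem_filter.2 ⟨hmemST c.2, (hfc c).symm⟩
      have h2 : d.1 ∈ ({e} : Finset (ℕ × ℕ)) := by
        rw [← he]
        exact Finset.mem_filter.2 ⟨hmemST d.2, by rw [hcd, hfc]⟩
      exact Subtype.ext ((Finset.mem_singleton.1 h1).trans (Finset.mem_singleton.1 h2).symm)
    · intro a
      obtain ⟨⟨i, j⟩, he⟩ := Finset.card_eq_one.1 (honce a)
      have h1 := (Finset.mem_filter.1 (he.ge (Finset.mem_singleton_self _))).2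
      dsimp only at h1
      have h2 : (i, j) ∈ μS := by
        by_contra hnot
        rw [hout i j hnot] at h1
        exact WithTop.coe_ne_top h1.symm
      refine ⟨⟨(i, j), h2⟩, ?_⟩
      rw [← WithTop.coe_inj, hfc]
      exact h1
  have hmono : ∀ i, Monotone (ent i) := fun i => (hss i).1
  let p : TableauPair m n :=
    { shapeS := μS
      shapeT := μT
      S :=
        { entry := Equiv.ofBijective f hf
          row_lt := by
            intro i j₁ j₂ h₁ h₂ hlt
            refine lt_of_le_of_ne ?_ fun heq => ?_
            · rw [← WithTop.coe_le_coe]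
              simp only [Equiv.ofBijective_apply, hfc]
              exact hmono i hlt.le
            · have := congrArg Prod.snd (congrArg Subtype.val (hf.1 heq))
              exact hlt.ne this
          col_lt := by
            intro i₁ i₂ j h₁ h₂ hlt
            rw [← WithTop.coe_lt_coe]
            simp only [Equiv.ofBijective_apply, hfc]
            exact hcol _ _ _ hlt (hmemST h₂) }
      T := T
      shape_eq := hST }
  have hstar : ∀ i j, p.starEntry i j = ent i j := by
    intro i j
    by_cases hmem : (i, j) ∈ μS
    · exact (p.starEntry_of_mem hmem).trans (hfc ⟨(i, j), hmem⟩)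
    · exact (p.starEntry_of_notMem hmem).trans (hout i j hmem).symm
  have hlast : p.paddedTableau (Fin.last n) = Q := by
    refine List.ext_getElem (by rw [p.length_paddedTableau, hQlen]) fun i h1 h2 => ?_
    rw [← List.getD_eq_getElem _ [] h1, ← List.getD_eq_getElem _ [] h2]
    refine List.ext_getElem (by rw [p.length_getD_paddedTableau_last, hrowLen]) fun j h3 h4 => ?_
    rw [← List.getD_eq_getElem _ ⊤ h3, ← List.getD_eq_getElem _ ⊤ h4,
      p.getD_getD_paddedTableau_last, hstar]
  -- The final tableaux agree, and both sequences are obtained from them by the same reverse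
  -- insertions.
  have hall : ∀ k, p.paddedTableau k = P k := by
    intro k
    induction k using Fin.reverseInduction with
    | last => exact hlast
    | cast k ih =>
      have h1 := p.reverseInsert_paddedTableau k
      rw [ih, show p.T.rowOf k = r k from congrFun hT k, h.reverseInsert_succ] at h1
      exact (congrArg Prod.snd h1).symm
  refine ⟨p, funext fun k => ?_⟩
  have h1 := p.reverseInsert_paddedTableau k
  rw [hall, show p.T.rowOf k = r k from congrFun hT k, h.reverseInsert_succ] at h1
  exact (congrArg (fun x => x.1.1) h1).symm

end Surjectivity

/-! ### Straightening of balanced functions. -/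

section Straightening

/-- Freeing one argument completely and summing over it first gives a defining relation for each
choice of the other arguments. -/
theorem sum_piFinset_update_univ {ι κ M : Type*} [Fintype ι] [DecidableEq ι] [Fintype κ]
    [DecidableEq κ] [AddCommMonoid M] {f : (ι → κ) → M} (hf : IsBalanced f) (t : ι → Finset κ)
    (a : ι) : ∑ ψ ∈ Fintype.piFinset (Function.update t a univ), f ψ = 0 := by
  rcases isEmpty_or_nonempty κ with hκ | ⟨⟨c⟩⟩
  · exact Finset.sum_eq_zero fun ψ _ => (hκ.false (ψ a)).elim
  have h : ∑ x ∈ Fintype.piFinset (Function.update t a {c}) ×ˢ (univ : Finset κ),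
      f (Function.update x.1 a x.2) =
      ∑ ψ ∈ Fintype.piFinset (Function.update t a univ), f ψ := by
    refine Finset.sum_nbij' (fun x => Function.update x.1 a x.2)
      (fun ψ => (Function.update ψ a c, ψ a)) ?_ ?_ ?_ ?_ ?_
    · rintro ⟨χ, j⟩ hx
      have hχ := Fintype.mem_piFinset.1 (Finset.mem_product.1 hx).1
      refine Fintype.mem_piFinset.2 fun i => ?_
      by_cases hi : i = a
      · subst hi; simp
      · have := hχ i
        simpa [Function.update_of_ne hi] using this
    · intro ψ hψ
      have hψ := Fintype.mem_piFinset.1 hψ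
      refine Finset.mem_product.2 ⟨Fintype.mem_piFinset.2 fun i => ?_, Finset.mem_univ _⟩
      by_cases hi : i = a
      · subst hi; simp
      · have := hψ i
        simpa [Function.update_of_ne hi] using this
    · rintro ⟨χ, j⟩ hx
      have hχ := Fintype.mem_piFinset.1 (Finset.mem_product.1 hx).1 a
      simp only [Function.update_self, Finset.mem_singleton] at hχ
      simp [← hχ]
    · intro ψ _
      simp
    · intro x _
      rfl
  rw [← h, Finset.sum_product]
  exact Finset.sum_eq_zero fun χ _ => hf.sum_update χ a

/-- The sum over all rearrangements on a large set of places vanishes. -/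
theorem IsBalanced.sum_piFinset_eq_zero {ι κ M : Type*} [Fintype ι] [DecidableEq ι] [Fintype κ]
    [DecidableEq κ] [AddCommGroup M] {f : (ι → κ) → M} (hf : IsBalanced f) {K : Finset κ}
    (hK : Kᶜ.card < Fintype.card ι) (s : Finset ι) (t : ι → Finset κ) (ht : ∀ a ∈ s, t a = K)
    (ht' : ∀ a ∉ s, t a ⊆ Kᶜ) : ∑ ψ ∈ Fintype.piFinset t, f ψ = 0 := by
  induction s using Finset.induction generalizing t with
  | empty =>
    -- Now all values lie in the complement of K, which is too small for an injection.
    refine Finset.sum_eq_zero fun ψ hψ => hf.eq_zero ψ fun hinj => ?_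
    have hψ := Fintype.mem_piFinset.1 hψ
    have h1 : univ.image ψ ⊆ Kᶜ := Finset.image_subset_iff.2 fun a _ =>
      ht' a (Finset.notMem_empty a) (hψ a)
    have h2 := Finset.card_le_card h1
    rw [Finset.card_image_of_injective _ hinj, Finset.card_univ] at h2
    omega
  | insert a s ha ih =>
    -- Let the value at a range over everything and split it by membership in K. The part outside K
    -- has one fewer argument with range K, so it vanishes by induction.
    have h1 := sum_piFinset_update_univ hf t a
    have hfilter : ∀ L : Finset κ, (Fintype.piFinset (Function.update t a univ)).filter
        (fun ψ => ψ a ∈ L) = Fintype.piFinset (Function.update t a L) := by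
      intro L
      ext ψ
      rw [Finset.mem_filter, Fintype.mem_piFinset, Fintype.mem_piFinset]
      constructor
      · rintro ⟨h2, h3⟩ i
        by_cases hi : i = a
        · subst hi; simpa using h3
        · have := h2 i
          simpa [Function.update_of_ne hi] using this
      · intro h2
        refine ⟨fun i => ?_, by simpa using h2 a⟩
        by_cases hi : i = a
        · subst hi; simp
        · have := h2 i
          simpa [Function.update_of_ne hi] using this
    have h2 := ih (Function.update t a Kᶜ)
      (fun i hi => by
        rw [Function.update_of_ne (by rintro rfl; exact ha hi)]
        exact ht i (Finset.mem_insert_of_mem hi))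
      (fun i hi => by
        by_cases hia : i = a
        · subst hia; simp
        · rw [Function.update_of_ne hia]
          exact ht' i fun h => (Finset.mem_insert.1 h).elim hia hi)
    rw [← Finset.sum_filter_add_sum_filter_not _ (fun ψ => ψ a ∈ K), hfilter] at h1
    simp only [← Finset.mem_compl] at h1
    rw [hfilter, h2, add_zero] at h1
    have h3 : Function.update t a K = t := by
      rw [← ht a (Finset.mem_insert_self _ _), Function.update_eq_self]
    rwa [h3] at h1

variable {m n : ℕ}

theorem toLex_lt_iff {w w' : Fin n → Letter m} :
    toLex w < toLex w' ↔ ∃ k, (∀ j < k, w j = w' j) ∧ w k < w' k := Iff.rfl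

/-- Rearranging a word on a set of places where it weakly increases makes it larger. -/
theorem wordOf_lt_of_monotoneOn {φ ψ : Fin m → Fin n} (hφ : Function.Injective φ)
    (hψ : Function.Injective ψ) (hne : ψ ≠ φ) {K : Finset (Fin n)}
    (hmono : MonotoneOn (wordOf φ) K) (hK : ∀ a, φ a ∈ K → ψ a ∈ K)
    (hK' : ∀ a, φ a ∉ K → ψ a = φ a) : toLex (wordOf φ) < toLex (wordOf ψ) := by
  rcases lt_trichotomy (toLex (wordOf φ)) (toLex (wordOf ψ)) with h | h | h
  · exact h
  · exact absurd (wordOf_injective_of_injective hφ hψ (toLex_inj.1 h)).symm hne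
  · exfalso
    obtain ⟨k, hag, hlt⟩ := toLex_lt_iff.1 h
    obtain ⟨a, ha⟩ := WithTop.ne_top_iff_exists.1 (lt_of_lt_of_le hlt le_top).ne
    have hak := (wordOf_eq_coe_iff hψ).1 ha.symm
    have hne : φ a ≠ k := fun h' => by
      rw [← ha, (wordOf_eq_coe_iff hφ).2 h'] at hlt
      exact lt_irrefl _ hlt
    -- At the first difference k, the rearranged word has the smaller letter a, which φ places
    -- elsewhere. If φ places it earlier, the words already differ there; if later, it is at least
    -- the letter at k because the word increases on K.
    by_cases hmem : φ a ∈ K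
    · have hkK := hK a hmem
      rw [hak] at hkK
      rcases lt_or_gt_of_ne hne with h1 | h1
      · have h2 := hag _ h1
        rw [(wordOf_eq_coe_iff hφ).2 rfl, wordOf_eq_coe_iff hψ, hak] at h2
        exact hne h2.symm
      · have h2 := hmono hkK hmem h1.le
        rw [(wordOf_eq_coe_iff hφ).2 rfl, ha] at h2
        exact absurd h2 (not_le.2 hlt)
    · exact hne ((hK' a hmem).symm.trans hak)

/-- The values of a balanced function are generated by its values at the words that come from pairs
of tableaux. -/
theorem IsBalanced.mem_of_tableauPair {M : Type*} [AddCommGroup M] (hmn : m ≤ n)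
    {f : (Fin m → Fin n) → M} (hf : IsBalanced f) (N : Submodule ℤ M)
    (hN : ∀ p : TableauPair m n, f p.place ∈ N) (φ : Fin m → Fin n) : f φ ∈ N := by
  induction hw : toLex (wordOf φ) using WellFoundedGT.induction generalizing φ with
  | ind w ih =>
    subst hw
    by_cases hφ : Function.Injective φ
    swap
    · rw [hf.eq_zero φ hφ]
      exact N.zero_mem
    by_cases hgood : ∀ K : Finset (Fin n), K.card = n - m + 1 → ¬ MonotoneOn (wordOf φ) K
    · obtain ⟨p, hp⟩ := exists_tableauPair hφ hgood
      rw [p.word_eq_wordOf] at hp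
      rw [← wordOf_injective_of_injective p.place_injective hφ hp]
      exact hN p
    · push Not at hgood
      obtain ⟨K, hK, hmono⟩ := hgood
      -- The length n - m + 1 is chosen so that only m - 1 places remain outside K.
      have hcard : Kᶜ.card < Fintype.card (Fin m) := by
        have := Finset.card_le_univ K
        rw [Finset.card_compl]
        rw [Fintype.card_fin] at this ⊢
        rw [Fintype.card_fin]
        omega
      -- Letters standing in K move freely within K and the others stay fixed. The identity term is
      -- then minus the sum of terms at larger words.
      set t : Fin m → Finset (Fin n) := fun a => if φ a ∈ K then K else {φ a} with ht
      have hsum := hf.sum_piFinset_eq_zero hcard (univ.filter fun a => φ a ∈ K) t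
        (fun a ha => if_pos (Finset.mem_filter.1 ha).2)
        (fun a ha => by
          have ha : φ a ∉ K := fun h => ha (Finset.mem_filter.2 ⟨Finset.mem_univ _, h⟩)
          rw [ht]
          dsimp only
          rw [if_neg ha, Finset.singleton_subset_iff, Finset.mem_compl]
          exact ha)
      have hmem : φ ∈ Fintype.piFinset t := Fintype.mem_piFinset.2 fun a => by
        rw [ht]; dsimp only; split_ifs with h
        · exact h
        · exact Finset.mem_singleton_self _
      rw [← Finset.add_sum_erase _ _ hmem] at hsum
      rw [eq_neg_of_add_eq_zero_left hsum]
      refine N.neg_mem (N.sum_mem fun ψ hψ => ?_)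
      obtain ⟨hne, hψ⟩ := Finset.mem_erase.1 hψ
      by_cases hψi : Function.Injective ψ
      · refine ih _ (wordOf_lt_of_monotoneOn hφ hψi hne hmono (fun a ha => ?_)
          fun a ha => ?_) ψ rfl
        · have := Fintype.mem_piFinset.1 hψ a
          rw [ht] at this
          dsimp only at this
          rwa [if_pos ha] at this
        · have := Fintype.mem_piFinset.1 hψ a
          rw [ht] at this
          dsimp only at this
          rwa [if_neg ha, Finset.mem_singleton] at this
      · rw [hf.eq_zero ψ hψi]
        exact N.zero_mem

end Straightening

/-! ### Wedge products of cycles on disjoint boards. -/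

section WedgeOfCycles

theorem mem_cycles_iff {V : Type*} [LinearOrder V] {Δ : PreAbstractSimplicialComplex V} {k : ℕ}
    {z : Chain V} : z ∈ cycles Δ k ↔ z ∈ chains Δ k ∧ boundary z = 0 := Iff.rfl

variable {m n : ℕ}

theorem chains_mono {A A' : Finset (Fin m)} {B B' : Finset (Fin n)} (hA : A ⊆ A') (hB : B ⊆ B')
    (k : ℕ) : chains (chessboard A B) k ≤ chains (chessboard A' B') k := by
  intro z hz
  rw [mem_chains_iff] at hz ⊢
  exact fun s hs => ⟨augFaces_mono hA hB (hz s hs).1, (hz s hs).2⟩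

theorem cycles_mono {A A' : Finset (Fin m)} {B B' : Finset (Fin n)} (hA : A ⊆ A') (hB : B ⊆ B')
    (k : ℕ) : cycles (chessboard A B) k ≤ cycles (chessboard A' B') k :=
  inf_le_inf_right _ (chains_mono hA hB k)

theorem wedge_mem_cycles {A A' : Finset (Fin m)} {B B' : Finset (Fin n)} (hA : Disjoint A A')
    (hB : Disjoint B B') {k l : ℕ} {f g : Chain (Square m n)}
    (hf : f ∈ cycles (chessboard A B) k) (hg : g ∈ cycles (chessboard A' B') l) :
    wedge f g ∈ cycles (chessboard (A ∪ A') (B ∪ B')) (k + l) := by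
  have hf' := mem_chains_iff.1 hf.1
  have hg' := mem_chains_iff.1 hg.1
  refine mem_cycles_iff.2 ⟨?_, ?_⟩
  · rw [mem_chains_iff]
    intro u hu
    obtain ⟨s, t, hs, ht, hd, rfl⟩ := exists_of_wedge_ne_zero hu
    obtain ⟨hs1, hs2⟩ := hf' s hs
    obtain ⟨ht1, ht2⟩ := hg' t ht
    rw [mem_augFaces_chessboard] at hs1 ht1
    refine ⟨mem_augFaces_chessboard.2 ⟨fun x hx => ?_, fun x hx y hy hne => ?_⟩, by
      rw [Finset.card_union_of_disjoint hd, hs2, ht2]⟩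
    · rcases Finset.mem_union.1 hx with hx | hx
      · exact ⟨Finset.mem_union_left _ (hs1.1 x hx).1, Finset.mem_union_left _ (hs1.1 x hx).2⟩
      · exact ⟨Finset.mem_union_right _ (ht1.1 x hx).1, Finset.mem_union_right _ (ht1.1 x hx).2⟩
    · have key : ∀ x ∈ s, ∀ y ∈ t,
          (ofLex x).1 ≠ (ofLex y).1 ∧ (ofLex x).2 ≠ (ofLex y).2 := fun x hx y hy =>
        ⟨fun h => Finset.disjoint_left.1 hA (hs1.1 x hx).1 (h ▸ (ht1.1 y hy).1),
          fun h => Finset.disjoint_left.1 hB (hs1.1 x hx).2 (h ▸ (ht1.1 y hy).2)⟩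
      rcases Finset.mem_union.1 hx with hx | hx <;> rcases Finset.mem_union.1 hy with hy | hy
      · exact hs1.2 x hx y hy hne
      · exact key x hx y hy
      · exact ⟨(key y hy x hx).1.symm, (key y hy x hx).2.symm⟩
      · exact ht1.2 x hx y hy hne
  · rw [boundary_wedge (k := k) (fun s hs => (hf' s hs).2), (mem_cycles_iff.1 hf).2,
      (mem_cycles_iff.1 hg).2,
      ← wedgeHom_apply, ← wedgeHom_apply, map_zero, map_zero, AddMonoidHom.zero_apply, smul_zero,
      add_zero]
    intro s t hs ht
    rw [Finset.disjoint_left]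
    intro x hxs hxt
    exact Finset.disjoint_left.1 hA ((mem_augFaces_chessboard.1 (hf' s hs).1).1 x hxs).1
      ((mem_augFaces_chessboard.1 (hg' t ht).1).1 x hxt).1

/-- The wedge product of the fundamental cycles `ρ_{A i, B i}`, for `i` in a list. -/
noncomputable def wedgeRho (A : ℕ → Finset (Fin m)) (B : ℕ → Finset (Fin n)) (l : List ℕ) :
    Chain (Square m n) :=
  (l.map fun i => rho (A i) (B i)).foldr wedge (orientedSimplex [])

variable {A : ℕ → Finset (Fin m)} {B : ℕ → Finset (Fin n)}

theorem wedgeRho_nil : wedgeRho A B [] = Finsupp.single ∅ 1 := orientedSimplex_nil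

theorem wedgeRho_cons (i : ℕ) (l : List ℕ) :
    wedgeRho A B (i :: l) = wedge (rho (A i) (B i)) (wedgeRho A B l) := rfl

theorem disjoint_biUnion_toFinset {α : Type*} [DecidableEq α] {A : ℕ → Finset α}
    (hA : Pairwise fun i j => Disjoint (A i) (A j)) {i : ℕ} {l : List ℕ} (hi : i ∉ l) :
    Disjoint (A i) (l.toFinset.biUnion A) := by
  rw [Finset.disjoint_biUnion_right]
  intro j hj
  refine hA ?_
  rintro rfl
  exact hi (List.mem_toFinset.1 hj)

theorem wedgeRho_mem_cycles (hA : Pairwise fun i j => Disjoint (A i) (A j))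
    (hB : Pairwise fun i j => Disjoint (B i) (B j)) {l : List ℕ} (hl : l.Nodup)
    (hAB : ∀ i ∈ l, (B i).card = (A i).card + 1) :
    wedgeRho A B l ∈ cycles (chessboard (l.toFinset.biUnion A) (l.toFinset.biUnion B))
      (∑ i ∈ l.toFinset, (A i).card) := by
  induction l with
  | nil =>
    rw [wedgeRho_nil]
    refine mem_cycles_iff.2 ⟨single_mem_chains (s := ∅) (Or.inl rfl) 1, ?_⟩
    rw [boundary_single, Finset.sum_empty]
  | cons i l ih =>
    obtain ⟨h1, h2⟩ := List.nodup_cons.1 hl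
    rw [wedgeRho_cons, List.toFinset_cons, Finset.biUnion_insert, Finset.biUnion_insert,
      Finset.sum_insert (by rwa [List.mem_toFinset])]
    exact wedge_mem_cycles (disjoint_biUnion_toFinset hA h1) (disjoint_biUnion_toFinset hB h1)
      (rho_mem_cycles (hAB i List.mem_cons_self))
      (ih h2 fun j hj => hAB j (List.mem_cons_of_mem _ hj))

theorem col_mem_of_wedgeRho_ne_zero (hA : Pairwise fun i j => Disjoint (A i) (A j))
    {l : List ℕ} (hl : l.Nodup)
    (hAB : ∀ i ∈ l, (B i).card = (A i).card + 1) {u : Finset (Square m n)}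
    (hu : wedgeRho A B l u ≠ 0) {i : ℕ} {x : Square m n} (hx : x ∈ u)
    (hxi : (ofLex x).1 ∈ A i) : (ofLex x).2 ∈ B i := by
  induction l generalizing u with
  | nil =>
    rw [wedgeRho_nil, Finsupp.single_apply_ne_zero] at hu
    rw [hu.1] at hx
    simp at hx
  | cons j l ih =>
    obtain ⟨h1, h2⟩ := List.nodup_cons.1 hl
    rw [wedgeRho_cons] at hu
    obtain ⟨s, t, hs, ht, -, rfl⟩ := exists_of_wedge_ne_zero hu
    rcases Finset.mem_union.1 hx with hx | hx
    · have h3 := mem_augFaces_chessboard.1 (mem_chains_iff.1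
        (rho_mem_cycles (hAB j List.mem_cons_self)).1 s hs).1
      obtain ⟨h4, h5⟩ := h3.1 x hx
      by_cases hij : i = j
      · rwa [hij]
      · exact absurd h4 (Finset.disjoint_left.1 (hA hij) hxi)
    · exact ih h2 (fun j hj => hAB j (List.mem_cons_of_mem _ hj)) ht hx

/-- Rows separate the factors: a facet that places each A i inside B i splits in just one way, and
its coefficient is a product of signs. The square expresses that this coefficient is ±1. -/
theorem wedgeRho_apply_sq (hA : Pairwise fun i j => Disjoint (A i) (A j))
    (hB : Pairwise fun i j => Disjoint (B i) (B j)) {l : List ℕ} (hl : l.Nodup)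
    (hAB : ∀ i ∈ l, (B i).card = (A i).card + 1) {u : Finset (Square m n)}
    (hu : u ∈ augFaces (board m n)) (hrow : ∀ x ∈ u, ∃ i ∈ l, (ofLex x).1 ∈ A i)
    (hrow' : ∀ i ∈ l, ∀ a ∈ A i, ∃ x ∈ u, (ofLex x).1 = a)
    (hcol : ∀ i ∈ l, ∀ x ∈ u, (ofLex x).1 ∈ A i → (ofLex x).2 ∈ B i) :
    wedgeRho A B l u * wedgeRho A B l u = 1 := by
  induction l generalizing u with
  | nil =>
    have : u = ∅ := Finset.eq_empty_of_forall_notMem fun x hx => by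
      obtain ⟨i, hi, -⟩ := hrow x hx
      simp at hi
    rw [this, wedgeRho_nil]
    simp
  | cons i l ih =>
    obtain ⟨h1, h2⟩ := List.nodup_cons.1 hl
    have hABl : ∀ j ∈ l, (B j).card = (A j).card + 1 := fun j hj =>
      hAB j (List.mem_cons_of_mem _ hj)
    have hi : i ∈ i :: l := List.mem_cons_self
    have hdisj := disjoint_biUnion_toFinset hA h1
    have hnotin : ∀ j ∈ l, ∀ a ∈ A j, a ∉ A i := fun j hj a ha hai =>
      Finset.disjoint_left.1 hdisj hai
        (Finset.mem_biUnion.2 ⟨j, List.mem_toFinset.2 hj, ha⟩)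
    rw [wedgeRho_cons, wedge_apply_of_separated (fun x => (ofLex x).1 ∈ A i)]
    · have hleft : u.filter (fun x => (ofLex x).1 ∈ A i) ∈ augFaces (chessboard (A i) (B i)) := by
        refine mem_augFaces_chessboard.2 ⟨fun x hx => ?_, fun x hx y hy => ?_⟩
        · obtain ⟨hx1, hx2⟩ := Finset.mem_filter.1 hx
          exact ⟨hx2, hcol i hi x hx1 hx2⟩
        · exact (mem_augFaces_chessboard.1 hu).2 x (Finset.mem_filter.1 hx).1 y
            (Finset.mem_filter.1 hy).1
      have hcard : (u.filter fun x => (ofLex x).1 ∈ A i).card = (A i).card := by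
        rw [← card_image_row hleft]
        congr 1
        refine Finset.Subset.antisymm (image_row_subset hleft) fun a ha => ?_
        obtain ⟨x, hx, rfl⟩ := hrow' i hi a ha
        exact Finset.mem_image.2 ⟨x, Finset.mem_filter.2 ⟨hx, ha⟩, rfl⟩
      have h3 := rho_apply_sq (hAB i hi) hleft hcard
      have h4 := ih h2 hABl (u := u.filter fun x => ¬ (ofLex x).1 ∈ A i)
        (augFaces_of_subset hu (Finset.filter_subset _ _))
        (fun x hx => by
          obtain ⟨hx1, hx2⟩ := Finset.mem_filter.1 hx
          obtain ⟨j, hj, hxj⟩ := hrow x hx1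
          rcases List.mem_cons.1 hj with rfl | hj
          · exact absurd hxj hx2
          · exact ⟨j, hj, hxj⟩)
        (fun j hj a ha => by
          obtain ⟨x, hx, rfl⟩ := hrow' j (List.mem_cons_of_mem _ hj) a ha
          exact ⟨x, Finset.mem_filter.2 ⟨hx, hnotin j hj _ ha⟩, rfl⟩)
        (fun j hj x hx hxj => hcol j (List.mem_cons_of_mem _ hj) x (Finset.mem_filter.1 hx).1 hxj)
      have h5 := shuffleSign_mul_self (u.filter fun x => (ofLex x).1 ∈ A i)
        (u.filter fun x => ¬ (ofLex x).1 ∈ A i)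
      calc _ = (shuffleSign (u.filter fun x => (ofLex x).1 ∈ A i)
            (u.filter fun x => ¬ (ofLex x).1 ∈ A i) * shuffleSign
            (u.filter fun x => (ofLex x).1 ∈ A i) (u.filter fun x => ¬ (ofLex x).1 ∈ A i)) *
            ((rho (A i) (B i) (u.filter fun x => (ofLex x).1 ∈ A i) *
              rho (A i) (B i) (u.filter fun x => (ofLex x).1 ∈ A i)) *
            (wedgeRho A B l (u.filter fun x => ¬ (ofLex x).1 ∈ A i) *
              wedgeRho A B l (u.filter fun x => ¬ (ofLex x).1 ∈ A i))) := by ring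
        _ = 1 := by rw [h3, h4, h5]; norm_num
    · intro s hs x hx
      exact ((mem_augFaces_chessboard.1 (mem_chains_iff.1 (rho_mem_cycles (hAB i hi)).1 s hs).1).1
        x hx).1
    · intro s hs x hx
      obtain ⟨j, hj, hxj⟩ := Finset.mem_biUnion.1 ((mem_augFaces_chessboard.1 (mem_chains_iff.1
        (wedgeRho_mem_cycles hA hB h2 hABl).1 s hs).1).1 x hx).1
      exact hnotin j (List.mem_toFinset.1 hj) _ hxj

theorem signedSum_zero (e : Fin 0 ↪o Fin m) (b : Fin (0 + 1) ↪o Fin n) :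
    signedSum e b = Finsupp.single ∅ 1 := by
  rw [signedSum, Finset.sum_eq_single 1]
  · simp [graph]
  · exact fun σ _ hσ => absurd (Equiv.ext fun x => Subsingleton.elim (α := Fin 1) _ _) hσ
  · exact fun h => absurd (Finset.mem_univ _) h

/-- A top cell that pops only ∞ contributes the unit of the wedge product, so it can be dropped from
η. -/
theorem rho_of_eq_empty {A : Finset (Fin m)} {B : Finset (Fin n)} (hA : A = ∅)
    (h : B.card = A.card + 1) : rho A B = Finsupp.single ∅ 1 := by
  subst hA
  rw [rho_eq_signedSum h]
  exact signedSum_zero _ _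

/-- A wedge product of fundamental cycles begins with one of positive dimension. -/
theorem exists_wedgeRho_eq (l : List ℕ) (hl : l.Nodup)
    (hAB : ∀ i ∈ l, (B i).card = (A i).card + 1) (hne : ∃ i ∈ l, A i ≠ ∅) :
    ∃ i l', i ∈ l ∧ A i ≠ ∅ ∧ l'.Nodup ∧ i ∉ l' ∧ l' ⊆ l ∧
      (∀ j ∈ l, j ≠ i → j ∉ l' → A j = ∅) ∧
      wedgeRho A B l = wedge (rho (A i) (B i)) (wedgeRho A B l') := by
  induction l with
  | nil => simp at hne
  | cons j l ih =>
    obtain ⟨h1, h2⟩ := List.nodup_cons.1 hl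
    by_cases hj : A j = ∅
    · obtain ⟨i, l', h3, h4, h5, h6, h7, h8, h9⟩ := ih h2
        (fun k hk => hAB k (List.mem_cons_of_mem _ hk)) (by
          obtain ⟨i, hi, hne⟩ := hne
          rcases List.mem_cons.1 hi with rfl | hi
          · exact absurd hj hne
          · exact ⟨i, hi, hne⟩)
      refine ⟨i, l', List.mem_cons_of_mem _ h3, h4, h5, h6, fun x hx =>
        List.mem_cons_of_mem _ (h7 hx), ?_, ?_⟩
      · intro k hk
        rcases List.mem_cons.1 hk with rfl | hk
        · exact fun _ _ => hj
        · exact h8 k hk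
      · rw [wedgeRho_cons, rho_of_eq_empty hj (hAB j List.mem_cons_self), wedge_one_left, h9]
    · refine ⟨j, l, List.mem_cons_self, hj, h2, h1, fun x hx => List.mem_cons_of_mem _ hx, ?_, rfl⟩
      intro k hk hkj hkl
      exact absurd ((List.mem_cons.1 hk).resolve_left hkj) hkl

end WedgeOfCycles

/-! ### Bases from matrices with unit determinant. -/

section Unitriangular

variable {ι : Type*} [Fintype ι]

theorem isUnit_det_of_triangular [LinearOrder ι] {N : Matrix ι ι ℤ} (hdiag : ∀ i, N i i * N i i = 1)
    (htri : ∀ i j, N i j ≠ 0 → j ≤ i) : IsUnit N.det := by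
  rw [Matrix.det_of_isLowerTriangular N fun i j hij => by
    by_contra hne
    exact absurd (htri i j hne) (not_le.2 hij)]
  refine IsUnit.of_mul_eq_one (∏ i, N i i) ?_
  rw [← Finset.prod_mul_distrib]
  exact Finset.prod_eq_one fun i _ => hdiag i

variable {X : Type*} [AddCommGroup X]

theorem linearIndependent_of_isUnit_det [DecidableEq ι] {N : Matrix ι ι ℤ}
    (hN : IsUnit N.det) {x : ι → X}
    (E : X →ₗ[ℤ] ι → ℤ) (hE : ∀ i j, E (x i) j = N i j) : LinearIndependent ℤ x := by
  refine LinearIndependent.of_comp E ?_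
  have : (E ∘ x : ι → ι → ℤ) = N.row := by
    funext i j
    exact hE i j
  rw [this]
  exact Matrix.linearIndependent_rows_of_isUnit ((Matrix.isUnit_iff_isUnit_det N).2 hN)

/-- The images already span all integer vectors, so an injective E leaves room for nothing more. -/
theorem span_eq_top_of_isUnit_det [DecidableEq ι] {N : Matrix ι ι ℤ}
    (hN : IsUnit N.det) {x : ι → X}
    (E : X →ₗ[ℤ] ι → ℤ) (hE : ∀ i j, E (x i) j = N i j) (hinj : Function.Injective E) :
    Submodule.span ℤ (Set.range x) = ⊤ := by
  rw [eq_top_iff]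
  intro z _
  obtain ⟨c, hc⟩ :=
    Matrix.vecMul_surjective_iff_isUnit.2 ((Matrix.isUnit_iff_isUnit_det N).2 hN) (E z)
  have : z = ∑ i, c i • x i := by
    apply hinj
    rw [← hc, map_sum]
    funext j
    simp [Matrix.vecMul, dotProduct, hE]
  rw [this]
  exact Submodule.sum_mem _ fun i _ => Submodule.smul_mem _ _ (Submodule.subset_span ⟨i, rfl⟩)

end Unitriangular

/-! ### Facets modulo coboundaries. -/

section TopCohomology

variable {m n : ℕ}

/-- The facet of `M_{m,n}` with the square `(a, φ a)` in the row `a`, for each `a`. -/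
abbrev facet (φ : Fin m → Fin n) : Finset (Square m n) := graph (RelEmbedding.refl _) φ

theorem image_refl_univ :
    (univ : Finset (Fin m)).image (RelEmbedding.refl (α := Fin m) (· ≤ ·)) = univ := by
  ext; simp

theorem facet_mem_iff {φ : Fin m → Fin n} :
    facet φ ∈ augFaces (board m n) ↔ Function.Injective φ := by
  rw [graph_mem_iff (fun _ => Finset.mem_univ _)]
  simp

theorem mem_facet {φ : Fin m → Fin n} {x : Square m n} :
    x ∈ facet φ ↔ φ (ofLex x).1 = (ofLex x).2 :=
  mk_mem_graph (e := RelEmbedding.refl _) (i := (ofLex x).1) (b := (ofLex x).2)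

theorem exists_eq_facet {s : Finset (Square m n)} (hs : s ∈ augFaces (board m n))
    (hm : s.card = m) : ∃ φ, Function.Injective φ ∧ s = facet φ := by
  obtain ⟨φ, rfl⟩ := exists_eq_graph image_refl_univ hs hm
  exact ⟨φ, facet_mem_iff.1 hs, rfl⟩

/-- A simplex with m squares already uses every row and cannot be enlarged. -/
theorem coboundary_eq_zero {z : Chain (Square m n)} (hz : z ∈ chains (board m n) m) :
    coboundary (board m n) z = 0 := by
  rw [coboundary, Finsupp.linearCombination_apply]
  refine Finset.sum_eq_zero fun s hs => ?_
  obtain ⟨-, h2⟩ := mem_chains_iff.1 hz s (Finsupp.mem_support_iff.1 hs)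
  refine smul_eq_zero_of_right _ (Finset.sum_eq_zero fun x _ => ?_)
  rw [if_neg]
  rintro ⟨hx, hface⟩
  have := card_le_of_mem_augFaces hface
  rw [Finset.card_insert_of_notMem hx, h2, Finset.card_univ, Fintype.card_fin] at this
  omega

theorem mem_cocycles {z : Chain (Square m n)} (hz : z ∈ chains (board m n) m) :
    z ∈ cocycles (board m n) m := ⟨hz, coboundary_eq_zero hz⟩

open Classical in
/-- The facets as chains. -/
noncomputable def facetChain (φ : Fin m → Fin n) : Chain (Square m n) :=
  if Function.Injective φ then Finsupp.single (facet φ) 1 else 0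

theorem coboundary_single_erase (φ : Fin m → Fin n) (i : Fin m) :
    coboundary (board m n) (Finsupp.single ((facet φ).erase (toLex (i, φ i))) 1) =
      placeSign (toLex (i, φ i)) ((facet φ).erase (toLex (i, φ i))) •
        ∑ b, facetChain (Function.update φ i b) := by
  classical
  set u := (facet φ).erase (toLex (i, φ i)) with hu
  have hrow : ∀ v ∈ u, (ofLex v).1 ≠ i := fun v hv =>
    row_ne_of_mem_erase_graph (e := RelEmbedding.refl _) hv
  rw [coboundary, Finsupp.linearCombination_single, one_smul,
    ← Finset.sum_subset (Finset.subset_univ (univ.image fun b : Fin n => toLex (i, b))),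
    Finset.sum_image, Finset.smul_sum]
  · refine Finset.sum_congr rfl fun b _ => ?_
    have hins : insert (toLex (i, b)) u = facet (Function.update φ i b) :=
      (graph_update_eq_insert (e := RelEmbedding.refl _) φ i b).symm
    rw [hins, facet_mem_iff, facetChain,
      placeSign_eq_of_row (x := toLex (i, b)) (y := toLex (i, φ i)) rfl hrow]
    have hb : (toLex (i, b) : Square m n) ∉ u := fun h => hrow _ h rfl
    split_ifs with h1 h2 h2
    · rw [Finsupp.smul_single, smul_eq_mul, mul_one]
    · exact absurd h1.2 h2
    · exact absurd ⟨hb, h2⟩ h1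
    · rw [smul_zero]
  · intro b _ c _ h
    exact (Prod.ext_iff.1 (toLex_inj.1 h)).2
  · intro x _ hx
    rw [if_neg]
    rintro ⟨hxu, hface⟩
    by_cases hxi : (ofLex x).1 = i
    · exact hx (Finset.mem_image.2 ⟨(ofLex x).2, Finset.mem_univ _, by rw [← hxi]; rfl⟩)
    · have hmem : (toLex ((ofLex x).1, φ (ofLex x).1) : Square m n) ∈ u :=
        Finset.mem_erase.2 ⟨fun h => hxi (Prod.ext_iff.1 (toLex_inj.1 h)).1, mem_facet.2 rfl⟩
      refine ((mem_augFaces_chessboard.1 hface).2 x (Finset.mem_insert_self _ _) _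
        (Finset.mem_insert_of_mem hmem) ?_).1 rfl
      intro h
      exact hxu (h ▸ hmem)

/-- Up to sign, the coboundary of a ridge is the sum of the facets through it. This carries
straightening over to cohomology. -/
theorem isBalanced_mk_facetChain :
    IsBalanced fun φ : Fin m → Fin n =>
      (coboundaries (board m n) m).mkQ (facetChain φ) where
  eq_zero φ hφ := by rw [facetChain, if_neg hφ, map_zero]
  sum_update φ i := by
    rw [← map_sum, Submodule.mkQ_apply, Submodule.Quotient.mk_eq_zero]
    by_cases h : ∃ b, Function.Injective (Function.update φ i b)
    · obtain ⟨b, hb⟩ := h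
      have hface : (facet φ).erase (toLex (i, φ i)) ∈ augFaces (board m n) := by
        refine augFaces_of_subset (facet_mem_iff.2 hb) ?_
        exact (Finset.subset_insert (toLex (i, b)) _).trans_eq
          (graph_update_eq_insert (e := RelEmbedding.refl _) φ i b).symm
      have hcard : ((facet φ).erase (toLex (i, φ i))).card + 1 = m := by
        rw [Finset.card_erase_add_one (mem_facet.2 rfl), card_graph]
      have hmem : coboundary (board m n) (Finsupp.single ((facet φ).erase (toLex (i, φ i))) 1) ∈
          coboundaries (board m n) m := by
        have h1 := single_mem_chains hface 1
        -- A row i exists, so m is positive and `coboundaries` is in its nonzero case.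
        obtain ⟨k, rfl⟩ : ∃ k, m = k + 1 := ⟨_, hcard.symm⟩
        rw [Nat.add_right_cancel hcard] at h1
        exact Submodule.mem_map_of_mem h1
      rw [coboundary_single_erase] at hmem
      have := Submodule.smul_mem _
        (placeSign (toLex (i, φ i)) ((facet φ).erase (toLex (i, φ i)))) hmem
      rwa [smul_smul, placeSign_mul_self, one_smul] at this
    · push Not at h
      rw [Finset.sum_eq_zero]
      · exact Submodule.zero_mem _
      · exact fun b _ => if_neg (h b)

end TopCohomology

/-! ### The leading word of η(S, T). -/

namespace TableauPair

variable {m n : ℕ} (p : TableauPair m n)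

instance : Finite (TableauPair m n) := Finite.of_injective _ word_injective

noncomputable instance : Fintype (TableauPair m n) := Fintype.ofFinite _

/-- Lexicographic order of the words, for which the coefficient matrix is triangular. -/
noncomputable instance : LinearOrder (TableauPair m n) :=
  LinearOrder.lift' (fun p => toLex p.word) fun _ _ h => word_injective (toLex_inj.1 h)

theorem le_iff {p q : TableauPair m n} : p ≤ q ↔ toLex p.word ≤ toLex q.word := Iff.rfl

theorem disjoint_setB : Pairwise fun i j => Disjoint (p.setB i) (p.setB j) := by
  intro i j hij
  refine Finset.disjoint_left.2 fun k hi hj => hij ?_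
  rw [← p.mem_setB.1 hi, p.mem_setB.1 hj]

theorem disjoint_setA : Pairwise fun i j => Disjoint (p.setA i) (p.setA j) := by
  intro i j hij
  exact Finset.disjoint_left.2 fun a hi hj =>
    Finset.disjoint_left.1 (p.disjoint_setB hij) (p.mem_setA.1 hi) (p.mem_setA.1 hj)

theorem card_setB_of_mem_range : ∀ i ∈ List.range (n - m), (p.setB i).card = (p.setA i).card + 1 :=
  fun _ hi => p.card_setB (List.mem_range.1 hi)

theorem exists_mem_setA (a : Fin m) : ∃ i ∈ List.range (n - m), a ∈ p.setA i :=
  ⟨_, List.mem_range.2 (p.popped_snd_lt _), p.mem_setA.2 (p.mem_setB.2 rfl)⟩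

theorem sum_card_setA : ∑ i ∈ (List.range (n - m)).toFinset, (p.setA i).card = m := by
  rw [← Finset.card_biUnion fun i _ j _ hij => p.disjoint_setA hij]
  have : (List.range (n - m)).toFinset.biUnion p.setA = univ := by
    refine Finset.eq_univ_of_forall fun a => ?_
    obtain ⟨i, hi, ha⟩ := p.exists_mem_setA a
    exact Finset.mem_biUnion.2 ⟨i, List.mem_toFinset.2 hi, ha⟩
  rw [this, Finset.card_univ, Fintype.card_fin]

theorem eta_mem_cycles : p.eta ∈ cycles (board m n) m := by
  have := wedgeRho_mem_cycles p.disjoint_setA p.disjoint_setB List.nodup_range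
    p.card_setB_of_mem_range
  rw [p.sum_card_setA] at this
  exact cycles_mono (Finset.subset_univ _) (Finset.subset_univ _) m this

theorem eta_apply_sq : p.eta (facet p.place) * p.eta (facet p.place) = 1 := by
  refine wedgeRho_apply_sq p.disjoint_setA p.disjoint_setB List.nodup_range
    p.card_setB_of_mem_range (facet_mem_iff.2 p.place_injective) ?_ ?_ ?_
  · exact fun x _ => p.exists_mem_setA _
  · exact fun i _ a _ => ⟨toLex (a, p.place a), mem_facet.2 rfl, rfl⟩
  · intro i _ x hx hxi
    rw [← mem_facet.1 hx]
    exact p.mem_setA.1 hxi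

/-- The word of `(S, T)` is the largest one in the support of `η(S, T)`. -/
theorem word_le_of_eta_ne_zero {φ : Fin m → Fin n} (hφ : Function.Injective φ)
    (h : p.eta (facet φ) ≠ 0) : toLex (wordOf φ) ≤ toLex p.word := by
  have hmem : ∀ i a, a ∈ p.setA i → φ a ∈ p.setB i := by
    intro i a ha
    exact col_mem_of_wedgeRho_ne_zero p.disjoint_setA List.nodup_range p.card_setB_of_mem_range h
      (x := toLex (a, φ a)) (mem_facet.2 rfl) ha
  by_contra! hlt
  obtain ⟨k, hag, hk⟩ := toLex_lt_iff.1 hlt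
  induction hw : wordOf φ k using WithTop.recTopCoe with
  | top =>
    -- The class of k pops its ∞ at a place k₀ before k, where the words agree. A further ∞ at k
    -- would leave too few places of this class for its finite letters.
    obtain ⟨k₀, hk₀, htop⟩ := p.exists_top_mem_setB (p.popped_snd_lt k)
    have hne : k₀ ≠ k := by
      rintro rfl
      rw [htop] at hk
      exact not_top_lt hk
    have hlt : k₀ < k := by
      refine lt_of_le_of_ne ?_ hne
      by_contra! h1
      have := p.word_lt_word h1 (p.mem_setB.1 hk₀).symm
      rw [htop] at this
      exact not_top_lt this
    have htop' : wordOf φ k₀ = ⊤ := (hag k₀ hlt).symm.trans htop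
    have hsub : (p.setA (p.popped k).2).image φ ⊆
        ((p.setB (p.popped k).2).erase k).erase k₀ := by
      intro l hl
      obtain ⟨a, ha, rfl⟩ := Finset.mem_image.1 hl
      have ha' : wordOf φ (φ a) = a := (wordOf_eq_coe_iff hφ).2 rfl
      refine Finset.mem_erase.2 ⟨?_, Finset.mem_erase.2 ⟨?_, hmem _ a ha⟩⟩
      · intro h1
        rw [h1, htop'] at ha'
        exact WithTop.coe_ne_top ha'.symm
      · intro h1
        rw [h1, hw] at ha'
        exact WithTop.coe_ne_top ha'.symm
    have hcard := Finset.card_le_card hsub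
    rw [Finset.card_image_of_injective _ hφ,
      Finset.card_erase_of_mem (Finset.mem_erase.2 ⟨hne, hk₀⟩),
      Finset.card_erase_of_mem (p.mem_setB.2 rfl), p.card_setB (p.popped_snd_lt k)] at hcard
    have : 2 ≤ (p.setB (p.popped k).2).card := by
      rw [← Finset.card_pair hne]
      refine Finset.card_le_card fun x hx => ?_
      rcases Finset.mem_insert.1 hx with rfl | hx
      · exact hk₀
      · rw [Finset.mem_singleton.1 hx]
        exact p.mem_setB.2 rfl
    rw [p.card_setB (p.popped_snd_lt k)] at this
    omega
  | coe b =>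
    have hb := (wordOf_eq_coe_iff hφ).1 hw
    have h1 : k ∈ p.setB (p.popped (p.place b)).2 :=
      hb ▸ hmem _ b (p.mem_setA.2 (p.mem_setB.2 rfl))
    rw [hw, ← p.word_place b] at hk
    -- The letter b stays in its class, whose letters decrease in the word of p. Being larger than
    -- that word's letter at k, it occurs before k, where the words agree, so φ has it there too and
    -- not at k.
    have h2 : p.place b < k := by
      by_contra! hle
      rcases hle.eq_or_lt with h3 | h3
      · rw [h3] at hk
        exact lt_irrefl _ hk
      · exact lt_asymm hk (p.word_lt_word h3 (p.mem_setB.1 h1))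
    have h3 := hag _ h2
    rw [p.word_place, eq_comm, wordOf_eq_coe_iff hφ, hb] at h3
    exact h2.ne h3.symm

/-- The defining simplex lists its squares by columns, whereas basis simplices list them by rows; ε
is the sign of the reordering. -/
theorem exists_gamma_eq : ∃ ε : ℤ, ε * ε = 1 ∧ p.gamma = Finsupp.single (facet p.place) ε := by
  set f : Fin n → Option (Square m n) := fun k =>
    match p.word k with
    | ⊤ => none
    | (a : Fin m) => some (toLex (a, k)) with hf
  have hfk : ∀ k x, f k = some x ↔ (ofLex x).2 = k ∧ p.place (ofLex x).1 = k := by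
    intro k x
    rw [← p.word_eq_coe_iff]
    rw [hf]
    dsimp only
    induction p.word k using WithTop.recTopCoe with
    | top =>
      constructor
      · intro h
        simp at h
      · exact fun h => absurd h.2 WithTop.coe_ne_top.symm
    | coe a =>
      rw [WithTop.coe_inj]
      constructor
      · intro h
        have := Option.some.inj h
        subst this
        exact ⟨rfl, rfl⟩
      · rintro ⟨rfl, rfl⟩
        rfl
  have hnodup : ((List.finRange n).filterMap f).Nodup := by
    refine (List.nodup_finRange n).filterMap fun k l x hk hl => ?_
    rw [← ((hfk k x).1 hk).1, ← ((hfk l x).1 hl).1]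
  refine ⟨(-1) ^ inversions ((List.finRange n).filterMap f), by simp [← mul_pow], ?_⟩
  have hgamma : p.gamma = orientedSimplex ((List.finRange n).filterMap f) := rfl
  rw [hgamma, orientedSimplex, if_pos hnodup]
  congr 1
  ext x
  rw [List.mem_toFinset, List.mem_filterMap, mem_facet]
  constructor
  · rintro ⟨k, -, hk⟩
    obtain ⟨h1, h2⟩ := (hfk k x).1 hk
    rw [h1, h2]
  · intro h
    exact ⟨_, List.mem_finRange _, (hfk (ofLex x).2 x).2 ⟨rfl, h⟩⟩

theorem gamma_mem_chains : p.gamma ∈ chains (board m n) m := by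
  obtain ⟨ε, -, h⟩ := p.exists_gamma_eq
  have := single_mem_chains (facet_mem_iff.2 p.place_injective) ε
  rw [h]
  rwa [card_graph] at this

theorem gamma_mem_cocycles : p.gamma ∈ cocycles (board m n) m := mem_cocycles p.gamma_mem_chains

end TableauPair

/-! ### The bases of homology and free cohomology, and the generators ρ ∧ τ. -/

section Bases

variable {m n : ℕ}

/-- The coefficients of a top-dimensional homology class at the words of the pairs of tableaux. -/
noncomputable def coeffMap (m n : ℕ) : Homology (board m n) m →ₗ[ℤ] TableauPair m n → ℤ :=
  (LinearMap.pi fun q => Finsupp.lapply (facet q.place)) ∘ₗ (cycles (board m n) m).subtype ∘ₗ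
    (topHomologyEquiv (by simp)).toLinearMap

theorem coeffMap_homologyClass {z : Chain (Square m n)} (hz : z ∈ cycles (board m n) m)
    (q : TableauPair m n) : coeffMap m n (homologyClass _ m z hz) q = z (facet q.place) := by
  simp [coeffMap, topHomologyEquiv_homologyClass]

/-- Straightening with the zero submodule: a cycle that vanishes at all words of pairs vanishes
everywhere. -/
theorem coeffMap_injective (hmn : m ≤ n) : Function.Injective (coeffMap m n) := by
  rw [injective_iff_map_eq_zero]
  intro x hx
  obtain ⟨⟨z, hz⟩, rfl⟩ := Submodule.Quotient.mk_surjective _ x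
  have h0 : z = 0 := by
    ext s
    by_contra hne
    obtain ⟨h1, h2⟩ := mem_chains_iff.1 hz.1 s hne
    obtain ⟨φ, -, rfl⟩ := exists_eq_facet h1 h2
    refine hne ((Submodule.mem_bot ℤ).1 ((isBalanced_of_mem_cycles image_refl_univ
      hz).mem_of_tableauPair hmn ⊥ (fun p => ?_) φ))
    rw [Submodule.mem_bot, ← coeffMap_homologyClass hz]
    exact congrFun hx p
  subst h0
  exact (Submodule.Quotient.mk_eq_zero _).2 (Submodule.zero_mem _)

theorem isUnit_det_eta :
    IsUnit (Matrix.of fun p q : TableauPair m n => p.eta (facet q.place)).det :=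
  isUnit_det_of_triangular (fun p => p.eta_apply_sq) fun p q h => by
    rw [TableauPair.le_iff, q.word_eq_wordOf]
    exact p.word_le_of_eta_ne_zero q.place_injective h

/-- The classes `η(S, T)` form a basis of the top homology. -/
noncomputable def etaBasis (hmn : m ≤ n) :
    Module.Basis (TableauPair m n) ℤ (Homology (board m n) m) :=
  Module.Basis.mk (v := fun p => homologyClass _ m p.eta p.eta_mem_cycles)
    (linearIndependent_of_isUnit_det isUnit_det_eta (coeffMap m n) fun p q =>
      coeffMap_homologyClass p.eta_mem_cycles q)
    (span_eq_top_of_isUnit_det isUnit_det_eta (coeffMap m n) (fun p q =>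
      coeffMap_homologyClass p.eta_mem_cycles q) (coeffMap_injective hmn)).ge

theorem etaBasis_apply (hmn : m ≤ n) (p : TableauPair m n) :
    etaBasis hmn p = homologyClass _ m p.eta p.eta_mem_cycles :=
  Module.Basis.mk_apply _ _ p

/-- `pairing` as a linear map in its second argument. -/
noncomputable def pairingMap {V : Type*} [LinearOrder V] [Fintype V] (u : Chain V) :
    Chain V →ₗ[ℤ] ℤ :=
  ∑ s ∈ u.support, u s • Finsupp.lapply s

theorem pairingMap_apply {V : Type*} [LinearOrder V] [Fintype V] (u v : Chain V) :
    pairingMap u v = pairing u v := by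
  simp [pairingMap, pairing, Finsupp.sum]

theorem pairing_single {V : Type*} [LinearOrder V] [Fintype V] (u : Chain V) (s : Finset V)
    (a : ℤ) : pairing u (Finsupp.single s a) = u s * a := by
  rw [pairing, Finsupp.sum, Finset.sum_eq_single s]
  · rw [Finsupp.single_eq_same]
  · intro t _ hne
    rw [Finsupp.single_eq_of_ne hne, mul_zero]
  · intro h
    rw [Finsupp.notMem_support_iff.1 h, zero_mul]

/-- By adjointness the pairing becomes one with the boundary of a cycle. -/
theorem pairing_eq_zero_of_mem_coboundaries {V : Type*} [LinearOrder V] [Fintype V]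
    {Δ : PreAbstractSimplicialComplex V} {k : ℕ} {u v : Chain V} (hu : u ∈ cycles Δ k)
    (hv : v ∈ coboundaries Δ k) : pairing u v = 0 := by
  cases k with
  | zero =>
    rw [coboundaries, Submodule.mem_bot] at hv
    rw [hv, ← pairingMap_apply, map_zero]
  | succ k =>
    obtain ⟨w, -, rfl⟩ := hv
    rw [pairing_coboundary Δ _ u w hu.1, (mem_cycles_iff.1 hu).2]
    simp [pairing]

/-- The pairings of a top-dimensional cohomology class with the cycles `η(S, T)`. -/
noncomputable def pairingEta (m n : ℕ) :
    FreeCohomology (board m n) m →ₗ[ℤ] TableauPair m n → ℤ :=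
  (Submodule.torsion ℤ (Cohomology (board m n) m)).liftQ
    (((coboundaries (board m n) m).submoduleOf (cocycles (board m n) m)).liftQ
      ((LinearMap.pi fun p : TableauPair m n => pairingMap p.eta) ∘ₗ
        (cocycles (board m n) m).subtype) (by
      intro v hv
      funext p
      exact (pairingMap_apply _ _).trans (pairing_eq_zero_of_mem_coboundaries p.eta_mem_cycles hv)))
    (by
      intro x hx
      -- A nonzero integer kills the class, hence also its vector of pairings, and integer vectors
      -- have no torsion.
      obtain ⟨a, ha⟩ := (Submodule.mem_torsion_iff x).1 hx
      rw [LinearMap.mem_ker]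
      have h1 := congrArg (((coboundaries (board m n) m).submoduleOf
        (cocycles (board m n) m)).liftQ ((LinearMap.pi fun p : TableauPair m n =>
          pairingMap p.eta) ∘ₗ (cocycles (board m n) m).subtype) (by
        intro v hv
        funext p
        exact (pairingMap_apply _ _).trans
          (pairing_eq_zero_of_mem_coboundaries p.eta_mem_cycles hv))) ha
      rw [Submonoid.smul_def, map_smul, map_zero] at h1
      exact (smul_eq_zero.1 h1).resolve_left (nonZeroDivisors.ne_zero a.2))

theorem pairingEta_mk {z : Chain (Square m n)} (hz : z ∈ cocycles (board m n) m)
    (p : TableauPair m n) :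
    pairingEta m n (Submodule.Quotient.mk (cohomologyClass (board m n) m z hz)) p =
      pairing p.eta z :=
  pairingMap_apply _ _

/-- Each γ is a single signed facet, so pairing with it reads off a coefficient of η; the
triangularity is that of the matrix for homology, transposed. -/
theorem isUnit_det_pairing :
    IsUnit (Matrix.of fun q p : TableauPair m n => pairing p.eta q.gamma).det := by
  rw [← Matrix.det_transpose]
  refine isUnit_det_of_triangular (fun p => ?_) fun p q h => ?_
  · obtain ⟨ε, hε, h⟩ := p.exists_gamma_eq
    rw [Matrix.transpose_apply, Matrix.of_apply, h, pairing_single]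
    linear_combination ε * ε * p.eta_apply_sq + hε
  · obtain ⟨ε, hε, h'⟩ := q.exists_gamma_eq
    rw [Matrix.transpose_apply, Matrix.of_apply, h', pairing_single] at h
    rw [TableauPair.le_iff, q.word_eq_wordOf]
    exact p.word_le_of_eta_ne_zero q.place_injective (left_ne_zero_of_mul h)

/-- Straightening in the quotient by coboundaries, with the span of the images of the γ as
submodule. -/
theorem mem_span_gamma (hmn : m ≤ n) {z : Chain (Square m n)} (hz : z ∈ chains (board m n) m) :
    z ∈ Submodule.span ℤ (Set.range (TableauPair.gamma : TableauPair m n → _)) ⊔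
      coboundaries (board m n) m := by
  have hfacet : ∀ φ : Fin m → Fin n, facetChain φ ∈
      Submodule.span ℤ (Set.range (TableauPair.gamma : TableauPair m n → _)) ⊔
        coboundaries (board m n) m := by
    intro φ
    have := isBalanced_mk_facetChain.mem_of_tableauPair hmn
      ((Submodule.span ℤ (Set.range (TableauPair.gamma : TableauPair m n → _))).map
        (coboundaries (board m n) m).mkQ) (fun p => ?_) φ
    · rw [← Submodule.mem_comap, Submodule.comap_map_mkQ, sup_comm] at this
      exact this
    · obtain ⟨ε, hε, h⟩ := p.exists_gamma_eq
      have h2 : facetChain p.place = ε • p.gamma := by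
        rw [facetChain, if_pos p.place_injective, h, Finsupp.smul_single, smul_eq_mul, hε]
      exact Submodule.mem_map_of_mem
        (h2 ▸ Submodule.smul_mem _ ε (Submodule.subset_span ⟨p, rfl⟩))
  rw [← Finsupp.sum_single z]
  refine Submodule.sum_mem _ fun s hs => ?_
  obtain ⟨h1, h2⟩ := mem_chains_iff.1 hz s (Finsupp.mem_support_iff.1 hs)
  obtain ⟨φ, hφ, rfl⟩ := exists_eq_facet h1 h2
  have h3 := Submodule.smul_mem _ (z (facet φ)) (hfacet φ)
  rwa [facetChain, if_pos hφ, Finsupp.smul_single, smul_eq_mul, mul_one] at h3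

theorem span_gamma_eq_top (hmn : m ≤ n) : Submodule.span ℤ (Set.range fun p : TableauPair m n =>
    (Submodule.Quotient.mk (cohomologyClass (board m n) m p.gamma p.gamma_mem_cocycles) :
      FreeCohomology (board m n) m)) = ⊤ := by
  rw [eq_top_iff]
  rintro x -
  obtain ⟨y, rfl⟩ := Submodule.Quotient.mk_surjective _ x
  obtain ⟨⟨z, hz⟩, rfl⟩ := Submodule.Quotient.mk_surjective _ y
  obtain ⟨u, hu, v, hv, rfl⟩ := Submodule.mem_sup.1 (mem_span_gamma hmn hz.1)
  obtain ⟨c, rfl⟩ := (Submodule.mem_span_range_iff_exists_fun ℤ).1 hu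
  have hsum : ∑ p : TableauPair m n, c p • p.gamma ∈ cocycles (board m n) m :=
    Submodule.sum_mem _ fun p _ => Submodule.smul_mem _ _ p.gamma_mem_cocycles
  have h1 : (Submodule.Quotient.mk ⟨∑ p : TableauPair m n, c p • p.gamma + v, hz⟩ :
      Cohomology (board m n) m) =
      ∑ p : TableauPair m n, c p • cohomologyClass (board m n) m p.gamma p.gamma_mem_cocycles := by
    have h2 : ∑ p : TableauPair m n, c p • cohomologyClass (board m n) m p.gamma
        p.gamma_mem_cocycles = Submodule.Quotient.mk (∑ p : TableauPair m n,
          c p • (⟨p.gamma, p.gamma_mem_cocycles⟩ : cocycles (board m n) m)) := by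
      rw [← Submodule.mkQ_apply, map_sum]
      rfl
    rw [h2, Submodule.Quotient.eq, Submodule.submoduleOf,
      Submodule.mem_comap, Submodule.subtype_apply]
    have h3 : ((∑ p : TableauPair m n, c p • (⟨p.gamma, p.gamma_mem_cocycles⟩ :
        cocycles (board m n) m) : cocycles (board m n) m) : Chain (Square m n)) =
        ∑ p : TableauPair m n, c p • p.gamma := by
      rw [Submodule.coe_sum]
      rfl
    rw [Submodule.coe_sub, h3, add_sub_cancel_left]
    exact hv
  rw [h1, ← Submodule.mkQ_apply, map_sum]
  exact Submodule.sum_mem _ fun p _ => by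
    rw [map_smul]
    exact Submodule.smul_mem _ _ (Submodule.subset_span ⟨p, rfl⟩)

/-- The classes `γ(S, T)` form a basis of the free part of the top cohomology. -/
noncomputable def gammaBasis (hmn : m ≤ n) :
    Module.Basis (TableauPair m n) ℤ (FreeCohomology (board m n) m) :=
  Module.Basis.mk (v := fun p : TableauPair m n =>
      (Submodule.Quotient.mk (cohomologyClass (board m n) m p.gamma p.gamma_mem_cocycles) :
        FreeCohomology (board m n) m))
    (linearIndependent_of_isUnit_det isUnit_det_pairing (pairingEta m n) fun q p =>
      pairingEta_mk q.gamma_mem_cocycles p)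
    (span_gamma_eq_top hmn).ge

theorem gammaBasis_apply (hmn : m ≤ n) (p : TableauPair m n) :
    gammaBasis hmn p = Submodule.Quotient.mk
      (cohomologyClass (board m n) m p.gamma p.gamma_mem_cocycles) :=
  Module.Basis.mk_apply _ _ p

theorem wedge_rho_mem_cycles {A : Finset (Fin m)} {B : Finset (Fin n)} {τ : Chain (Square m n)}
    (hAB : B.card = A.card + 1) (hτ : τ ∈ cycles (chessboard Aᶜ Bᶜ) (m - A.card)) :
    wedge (rho A B) τ ∈ cycles (board m n) m := by
  have := wedge_mem_cycles disjoint_compl_right disjoint_compl_right (rho_mem_cycles hAB) hτ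
  have hA : A.card ≤ m := by simpa using Finset.card_le_univ A
  rw [Nat.add_sub_cancel' hA] at this
  exact cycles_mono (Finset.subset_univ _) (Finset.subset_univ _) m this

/-- As m is positive, some A_i is nonempty. The factors before the first such i are units, and those
after it form τ, which uses only rows and columns outside A_i and B_i; rows of dropped factors are
empty, so τ has the right dimension. -/
theorem TableauPair.exists_eta_eq_wedge (p : TableauPair m n) (hm : 1 ≤ m) :
    ∃ (A : Finset (Fin m)) (B : Finset (Fin n)) (τ : Chain (Square m n)),
      1 ≤ A.card ∧ B.card = A.card + 1 ∧ τ ∈ cycles (chessboard Aᶜ Bᶜ) (m - A.card) ∧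
        p.eta = wedge (rho A B) τ := by
  obtain ⟨j, hj, haj⟩ := p.exists_mem_setA ⟨0, hm⟩
  obtain ⟨i, l, hi, hne, hl, hil, hsub, hempty, heq⟩ := exists_wedgeRho_eq (A := p.setA)
    (B := p.setB) _ List.nodup_range p.card_setB_of_mem_range ⟨j, hj, Finset.ne_empty_of_mem haj⟩
  refine ⟨p.setA i, p.setB i, wedgeRho p.setA p.setB l, Finset.card_pos.2
    (Finset.nonempty_iff_ne_empty.2 hne), p.card_setB_of_mem_range i hi, ?_, heq⟩
  have hcyc := wedgeRho_mem_cycles p.disjoint_setA p.disjoint_setB hl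
    fun k hk => p.card_setB_of_mem_range k (hsub hk)
  have hsum : ∑ k ∈ l.toFinset, (p.setA k).card = m - (p.setA i).card := by
    have h1 := p.sum_card_setA
    rw [← Finset.add_sum_erase _ _ (List.mem_toFinset.2 hi)] at h1
    rw [Finset.sum_subset (s₂ := (List.range (n - m)).toFinset.erase i)]
    · omega
    · intro k hk
      rw [List.mem_toFinset] at hk
      exact Finset.mem_erase.2 ⟨by rintro rfl; exact hil hk, List.mem_toFinset.2 (hsub hk)⟩
    · intro k hk hkl
      obtain ⟨h2, h3⟩ := Finset.mem_erase.1 hk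
      rw [hempty k (List.mem_toFinset.1 h3) h2 (by rwa [List.mem_toFinset] at hkl),
        Finset.card_empty]
  rw [hsum] at hcyc
  refine cycles_mono ?_ ?_ _ hcyc
  · exact Finset.subset_compl_iff_disjoint_left.2 (disjoint_biUnion_toFinset p.disjoint_setA hil)
  · exact Finset.subset_compl_iff_disjoint_left.2 (disjoint_biUnion_toFinset p.disjoint_setB hil)

theorem span_wedge_rho_eq_top (hmn : m ≤ n) (hm : 1 ≤ m) :
    Submodule.span ℤ {x : Homology (board m n) m |
      ∃ (A : Finset (Fin m)) (B : Finset (Fin n)) (τ : Chain (Square m n)),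
        1 ≤ A.card ∧ B.card = A.card + 1 ∧ τ ∈ cycles (chessboard Aᶜ Bᶜ) (m - A.card) ∧
          ∃ h : wedge (rho A B) τ ∈ cycles (board m n) m,
            x = homologyClass (board m n) m _ h} = ⊤ := by
  rw [eq_top_iff, ← (etaBasis hmn).span_eq]
  refine Submodule.span_mono ?_
  rintro _ ⟨p, rfl⟩
  obtain ⟨A, B, τ, h1, h2, h3, h4⟩ := p.exists_eta_eq_wedge hm
  refine ⟨A, B, τ, h1, h2, h3, wedge_rho_mem_cycles h2 h3, ?_⟩
  rw [etaBasis_apply]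
  congr 1

end Bases

end Chessboard

theorem theorem6p2 (m n : ℕ) (hmn : m ≤ n) :
    -- each `M_{A,B}` with `|A| = |B| - 1` is a pseudomanifold with fundamental cycle `ρ_{A,B}`
    (∀ (A : Finset (Fin m)) (B : Finset (Fin n)), B.card = A.card + 1 →
      Chessboard.IsPseudomanifold (Chessboard.chessboard A B) A.card ∧
      Chessboard.IsFundamentalCycle (Chessboard.chessboard A B) A.card (Chessboard.rho A B)) ∧
    -- the classes `η(S,T)` form a basis of `H̃_{m-1}(M_{m,n})`
    (∃ (hη : ∀ p : Chessboard.TableauPair m n,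
          p.eta ∈ Chessboard.cycles (Chessboard.board m n) m)
        (b : Module.Basis (Chessboard.TableauPair m n) ℤ
          (Chessboard.Homology (Chessboard.board m n) m)),
      ∀ p, b p = Chessboard.homologyClass (Chessboard.board m n) m p.eta (hη p)) ∧
    -- the classes `γ(S,T)` form a basis of the free part of `H̃^{m-1}(M_{m,n})`
    (∃ (hγ : ∀ p : Chessboard.TableauPair m n,
          p.gamma ∈ Chessboard.cocycles (Chessboard.board m n) m)
        (b : Module.Basis (Chessboard.TableauPair m n) ℤ
          (Chessboard.FreeCohomology (Chessboard.board m n) m)),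
      ∀ p, b p = Submodule.Quotient.mk
        (Chessboard.cohomologyClass (Chessboard.board m n) m p.gamma (hγ p))) ∧
    -- the wedges `ρ_{A,B} ∧ τ` are cycles, and they generate `H̃_{m-1}(M_{m,n})`
    (1 ≤ m →
      (∀ (A : Finset (Fin m)) (B : Finset (Fin n)) (τ : Chessboard.Chain (Chessboard.Square m n)),
        1 ≤ A.card → B.card = A.card + 1 →
        τ ∈ Chessboard.cycles (Chessboard.chessboard Aᶜ Bᶜ) (m - A.card) →
        Chessboard.wedge (Chessboard.rho A B) τ ∈
          Chessboard.cycles (Chessboard.board m n) m) ∧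
      Submodule.span ℤ {x : Chessboard.Homology (Chessboard.board m n) m |
        ∃ (A : Finset (Fin m)) (B : Finset (Fin n)) (τ : Chessboard.Chain (Chessboard.Square m n)),
          1 ≤ A.card ∧ B.card = A.card + 1 ∧
          τ ∈ Chessboard.cycles (Chessboard.chessboard Aᶜ Bᶜ) (m - A.card) ∧
          ∃ h : Chessboard.wedge (Chessboard.rho A B) τ ∈
              Chessboard.cycles (Chessboard.board m n) m,
            x = Chessboard.homologyClass (Chessboard.board m n) m _ h} = ⊤) :=
  ⟨fun _ _ h => ⟨Chessboard.isPseudomanifold_chessboard h, Chessboard.isFundamentalCycle_rho h⟩,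
    ⟨fun p => p.eta_mem_cycles, Chessboard.etaBasis hmn, Chessboard.etaBasis_apply hmn⟩,
    ⟨fun p => p.gamma_mem_cocycles, Chessboard.gammaBasis hmn, Chessboard.gammaBasis_apply hmn⟩,
    fun hm => ⟨fun _ _ _ _ hAB hτ => Chessboard.wedge_rho_mem_cycles hAB hτ,
      Chessboard.span_wedge_rho_eq_top hmn hm⟩⟩
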